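/- Notation. For $K\subset\mathbb R^2$ compact convex with non-empty interior and $x\in K$ let $N_K(x)=\{n:\langle n,y-x\rangle\le 0\ \forall y\in K\}$ be the outer normal cone; $x\in\partial K$ is *smooth* if $N_K(x)$ contains exactly one unit vector. A *$(K,T)$-Minkowski billiard trajectory with dual billiard trajectory $p$* is a sequence of points $q=(q_j)_{j\ge 0}$ on $\partial K$ together with a sequence $p=(p_j)_{j\ge0}$ on $\partial T$ such that, for all $j$, $$q_{j+1}-q_j\in N_T(p_j),\qquad p_{j+1}-p_j\in -N_K(q_{j+1}),$$ where $q_j\ne q_{j+1}$ and $q_{j+1}\notin[q_j,q_{j+2}]$. The trajectory (resp. the dual trajectory) is *regular* if all $q_j$ are smooth points of $\partial K$ (resp. all $p_j$ are smooth points of $\partial T$). It is *closed* with $m\ge2$ vertices if $q_{j+m}=q_j$ and $p_{j+m}=p_j$ for all $j$; its $\ell_T$-length is then $\ell_T(q)=\sum_{j=0}^{m-1}\max_{y\in T}\langle q_{j+1}-q_j,y\rangle$ (which is the length measured with the Minkowski functional of the polar $T^\circ$ if the origin is interior to $T$). A closed trajectory is *$\ell_T$-minimizing* if no closed $(K,T)$-Minkowski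 billiard trajectory has smaller $\ell_T$-length. The *path* of $q$ is $\bigcup_j[q_j,q_{j+1}]$, and similarly for $p$. Let $J=\begin{pmatrix}0&1\\-1&0\end{pmatrix}$ and $\diamondsuit(a_1,a_2)=\operatorname{conv}\big(\{a_1\}\times[0,1]\,\cup\,[0,1]\times\{a_2\}\big)$ for $a_1,a_2\in[0,1]$. **Theorem.** Let $K,T\subset\mathbb R^2$ be such that, up to a scaling by a positive factor and a translation of $T$, one of the following holds: (a) $K=\Delta$ is a triangle and $T=\operatorname{conv}(J\Delta\cup(-J\Delta+t))$, where $t$ minimizes the area of $\operatorname{conv}(J\Delta\cup(-J\Delta+\tilde t))$ over all $\tilde t\in\mathbb R^2$; (b) $K$ is a square with sides parallel to the coordinate axes and $T=\diamondsuit(a_1,a_2)$ for some $a_1,a_2\in[0,1]$; (c) $K$ is a trapezoid which is neither a triangle nor a parallelogram and $T$ is the parallelogram $(\varphi^T)^{-1}([0,1]^2)$, where $\varphi$ is a linear isomorphism with $K=\varphi(\diamondsuit(a_1,a_2))+c$ for some $a_1,a_2\in[0,1]$, $c\in\mathbb R^2$ (such $\varphi$ exists, and $T$ does not depend on its choice up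 to translation). Then: (i) every regular $(K,T)$-Minkowski billiard trajectory $q$ with regular dual billiard trajectory $p$ is closed with exactly $4$ bouncing points, i.e. $q_{j+4}=q_j$ and $p_{j+4}=p_j$ for all $j$, and $4$ is the minimal period of $q$ (bouncing points are counted with multiplicity along one period); moreover $q$ is $\ell_T$-minimizing; (ii) the union of the paths of all the trajectories $q$ in (i) is dense in $K$; (iii) the union of the paths of all their dual trajectories $p$ is dense in $T$. -/

import Mathlib

/-- The Euclidean plane. -/
abbrev Plane := EuclideanSpace ℝ (Fin 2)

namespace Billiard

/-! ### Minkowski billiards -/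

/-- The outer normal cone `N_K(x)` of `K` at `x`. -/
def normalCone (K : Set Plane) (x : Plane) : Set Plane :=
  {n | ∀ y ∈ K, inner ℝ n (y - x) ≤ 0}

/-- `x` is a smooth boundary point of `K`: a boundary point with exactly one outer unit normal. -/
def IsSmoothPoint (K : Set Plane) (x : Plane) : Prop :=
  x ∈ frontier K ∧ ∃! n : Plane, ‖n‖ = 1 ∧ n ∈ normalCone K x

/-- `q` is a (not necessarily closed) `(K,T)`-Minkowski billiard trajectory with dual billiard
trajectory `p`; the values of `q` are its consecutive bouncing points. The fields `ne` and
`not_between` say that the `q j` are genuine vertices of the polygonal curve. -/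
structure IsTrajectory (K T : Set Plane) (q p : ℕ → Plane) : Prop where
  q_mem : ∀ j, q j ∈ frontier K
  p_mem : ∀ j, p j ∈ frontier T
  ne : ∀ j, q j ≠ q (j + 1)
  not_between : ∀ j, q (j + 1) ∉ segment ℝ (q j) (q (j + 2))
  q_step : ∀ j, q (j + 1) - q j ∈ normalCone T (p j)
  p_step : ∀ j, -(p (j + 1) - p j) ∈ normalCone K (q (j + 1))

/-- A trajectory that is regular and whose dual trajectory is regular: all vertices of `q` are
smooth boundary points of `K` and all vertices of `p` are smooth boundary points of `T`. -/
structure IsRegularTrajectory (K T : Set Plane) (q p : ℕ → Plane) : Prop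
    extends IsTrajectory K T q p where
  q_smooth : ∀ j, IsSmoothPoint K (q j)
  p_smooth : ∀ j, IsSmoothPoint T (p j)

/-- `q` is a closed `(K,T)`-Minkowski billiard trajectory with vertices `q 0, …, q (m - 1)` (the
indices are read modulo `m`) and with closed dual trajectory `p`. -/
structure IsClosedTrajectory (K T : Set Plane) (m : ℕ) (q p : ℕ → Plane) : Prop
    extends IsTrajectory K T q p where
  two_le : 2 ≤ m
  q_periodic : ∀ j, q (j + m) = q j
  p_periodic : ∀ j, p (j + m) = p j

/-- The support function of `T`, which is the Minkowski functional of the polar body of `T` when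
`T` contains the origin in its interior (see `supportFn_eq_gauge_polar`). -/
noncomputable def supportFn (T : Set Plane) (x : Plane) : ℝ :=
  sSup ((fun p : Plane => inner ℝ x p) '' T)

/-- The `ℓ_T`-length of the closed polygonal curve with vertices `q 0, …, q (m - 1)`, where
`q m = q 0`. -/
noncomputable def ellLength (T : Set Plane) (m : ℕ) (q : ℕ → Plane) : ℝ :=
  ∑ j ∈ Finset.range m, supportFn T (q (j + 1) - q j)

/-- `q` minimizes the `ℓ_T`-length among all closed `(K,T)`-Minkowski billiard trajectories. -/
def IsMinimizer (K T : Set Plane) (m : ℕ) (q p : ℕ → Plane) : Prop :=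
  IsClosedTrajectory K T m q p ∧
    ∀ (m' : ℕ) (q' p' : ℕ → Plane), IsClosedTrajectory K T m' q' p' →
      ellLength T m q ≤ ellLength T m' q'

/-- The path of the polygonal curve with consecutive vertices `q 0, q 1, …`. -/
def path (q : ℕ → Plane) : Set Plane :=
  ⋃ j, segment ℝ (q j) (q (j + 1))

theorem supportFn_eq_gauge_polar {T : Set Plane} (hT : IsCompact T) (h0 : (0 : Plane) ∈ T)
    (x : Plane) :
    supportFn T x = gauge {y : Plane | ∀ p ∈ T, inner ℝ y p ≤ 1} x := by
  have hb : BddAbove ((fun p : Plane => inner ℝ x p) '' T) :=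
    (hT.image (by fun_prop)).bddAbove
  have hne : ((fun p : Plane => (inner ℝ x p : ℝ)) '' T).Nonempty := ⟨_, 0, h0, rfl⟩
  have hpos : 0 ≤ supportFn T x := le_csSup hb ⟨0, h0, by simp⟩
  have key : ∀ r : ℝ, 0 < r →
      (r⁻¹ • x ∈ {y : Plane | ∀ p ∈ T, inner ℝ y p ≤ 1} ↔ supportFn T x ≤ r) := by
    intro r hr
    unfold supportFn
    rw [csSup_le_iff hb hne]
    simp only [Set.mem_ofPred_eq, Set.forall_mem_image, inner_smul_left, RCLike.conj_to_real]
    refine forall₂_congr fun p _ => ?_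
    rw [inv_mul_le_iff₀ hr, mul_one]
  rw [gauge_def']
  refine le_antisymm ?_ ?_
  · refine le_csInf ⟨supportFn T x + 1, ?_⟩ ?_
    · exact ⟨by simp only [Set.mem_Ioi]; linarith, (key _ (by linarith)).2 (by linarith)⟩
    · rintro r ⟨hr, hrx⟩
      exact (key r hr).1 hrx
  · refine le_of_forall_pos_le_add fun ε hε => csInf_le ⟨0, fun r hr => le_of_lt hr.1⟩ ?_
    exact ⟨by simp only [Set.mem_Ioi]; linarith, (key _ (by linarith)).2 (by linarith)⟩

/-! ### The equality cases -/

/-- The rotation `J = (0 1; -1 0)`. -/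
noncomputable def rotJ (x : Plane) : Plane := !₂[x 1, -x 0]

/-- `Δ` is a (non-degenerate) triangle. -/
def IsTriangle (Δ : Set Plane) : Prop :=
  ∃ A B C : Plane, AffineIndependent ℝ ![A, B, C] ∧ Δ = convexHull ℝ {A, B, C}

/-- `conv {JΔ, -JΔ + t}`. -/
noncomputable def hullJ (Δ : Set Plane) (t : Plane) : Set Plane :=
  convexHull ℝ (rotJ '' Δ ∪ (fun x => -rotJ x + t) '' Δ)

/-- The set `𝒯_Δ` of volume-minimizing convex hulls of `JΔ` and translates of `-JΔ`. -/
def hullFamily (Δ : Set Plane) : Set (Set Plane) :=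
  {T | ∃ t : Plane, (∀ t' : Plane,
    MeasureTheory.volume (hullJ Δ t) ≤ MeasureTheory.volume (hullJ Δ t')) ∧ T = hullJ Δ t}

/-- The axis-parallel square with lower left corner `c` and side length `a`. -/
def square (c : Plane) (a : ℝ) : Set Plane :=
  {x | ∀ i, x i ∈ Set.Icc (c i) (c i + a)}

/-- The diamond in basic form `◇(a₁,a₂) = conv {a₁ × [0,1], [0,1] × a₂}`. -/
def diamond (a₁ a₂ : ℝ) : Set Plane :=
  convexHull ℝ ({x : Plane | x 0 = a₁ ∧ x 1 ∈ Set.Icc (0 : ℝ) 1} ∪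
    {x : Plane | x 0 ∈ Set.Icc (0 : ℝ) 1 ∧ x 1 = a₂})

/-- `Q` is a trapezoid that is neither a triangle nor a parallelogram: its vertices are, in cyclic
order, `A`, `B`, `D + r (B - A)`, `D`, so that the sides at `A, B` and at `D` are parallel, and
they have different lengths since `r ≠ 1`. -/
def IsProperTrapezoid (Q : Set Plane) : Prop :=
  ∃ (A B D : Plane) (r : ℝ), AffineIndependent ℝ ![A, B, D] ∧ 0 < r ∧ r ≠ 1 ∧
    Q = convexHull ℝ {A, B, D + r • (B - A), D}

/-- The parallelogram `(φᵀ)⁻¹ ([0,1]²)`, written as a preimage under `φᵀ`. -/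
noncomputable def dualParallelogram (φ : Plane ≃ₗ[ℝ] Plane) : Set Plane :=
  (LinearMap.adjoint (φ : Plane →ₗ[ℝ] Plane)) ⁻¹' square 0 1

/-- The equality cases `K × T`, before scaling and translating `T`. In the third case every proper
trapezoid `K` is of the form `φ(◇(a₁,a₂)) + c`, and a different choice of `φ` only translates the
parallelogram. -/
inductive IsBasicEqualityCase : Set Plane → Set Plane → Prop
  | triangle (Δ T : Set Plane) (hΔ : IsTriangle Δ) (hT : T ∈ hullFamily Δ) :
      IsBasicEqualityCase Δ T
  | square (c : Plane) (a a₁ a₂ : ℝ) (ha : 0 < a)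
      (h₁ : a₁ ∈ Set.Icc (0 : ℝ) 1) (h₂ : a₂ ∈ Set.Icc (0 : ℝ) 1) :
      IsBasicEqualityCase (square c a) (diamond a₁ a₂)
  | trapezoid (Q : Set Plane) (hQ : IsProperTrapezoid Q) (φ : Plane ≃ₗ[ℝ] Plane) (c : Plane)
      (a₁ a₂ : ℝ) (h₁ : a₁ ∈ Set.Icc (0 : ℝ) 1) (h₂ : a₂ ∈ Set.Icc (0 : ℝ) 1)
      (hφ : Q = (fun x => φ x + c) '' diamond a₁ a₂) :
      IsBasicEqualityCase Q (dualParallelogram φ)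

/-- The equality cases `K × T`, with scaling and translation of the second component. -/
def IsEqualityCase (K T : Set Plane) : Prop :=
  ∃ (T₀ : Set Plane) (s : ℝ) (v : Plane), IsBasicEqualityCase K T₀ ∧ 0 < s ∧
    T = (fun y => s • y + v) '' T₀

end Billiard

/-! ### Smooth points, regular trajectories and polygons in general. -/

namespace Billiard

open Set

/-! The property to be proved is `IsZoll`: every regular trajectory closes after exactly four steps
with one common action `L`, and every closed cycle has action at least `L`. Since each step of `q`
is normal to `T` at the dual point, the `ℓ_T`-length of a closed trajectory is its action `∑ ⟨q
(j+1) - q j, p j⟩` (`IsTrajectory.ellLength_eq`), so (i) follows from `IsZoll`.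

Reduction to two models. `IsZoll` survives affine maps of `K` and `T` whose linear parts satisfy `⟨φ
x, ψ y⟩ = r ⟨x, y⟩` with `r > 0` (`IsZoll.image`), and the exchange of `(K, T)` for `(T, -K)`, which
makes the dual trajectory the trajectory (`IsZoll.dual`). The square case becomes the unit square
with a diamond, and the trapezoid case is its dual. In the triangle case `J φ J⁻¹` is `det φ` times
the inverse transpose of `φ`, so the triangle may be taken to be the standard one. Minimality of the
area then says that the hull is a hexagon with non-negative parameters (`nonneg_of_minimal`,
`hullJ_eq_hexagon`).

Closing. In both models the dual trajectory has a conserved parameter `w`: all dual points are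
corners of one rectangle inscribed in the diamond (`exists_forall_corner`), or sit at the same
parameter on the sides of the hexagon (`HexCorner.next`). With `w` fixed only finitely many
itineraries remain, and comparing slopes along them shows that the fourth point is the initial one
(`SqOrbit.closed`, `TriOrbit.closed`).

Minimality. The normals along a cycle sum to zero, so no translate of the cycle fits into the
interior of `K` (`IsCycle.exists_notMem_interior`). On the other hand, an arc of a cycle has at
least the action of its chord paired with any point of `T`. Well-chosen points of `T` show that a
cycle of action below one is so small that it would fit (`IsCycle.one_le_action`,
`IsCycle.one_le_action_hexagon`).

Density. Trajectories in polygons use finitely many directions, and a chord in a given direction is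
determined by its end point. Hence only countably many starting points ever lead to a non-smooth
vertex (`countable_bad`), and almost every ray carries a regular trajectory (`closure_path_eq`).
Density of the dual paths follows by exchanging the roles of the two bodies. -/

theorem inner_plane (x y : Plane) : inner ℝ x y = x 0 * y 0 + x 1 * y 1 := by
  simp [PiLp.inner_apply, Fin.sum_univ_two, mul_comm]

theorem plane_ext {x y : Plane} (h0 : x 0 = y 0) (h1 : x 1 = y 1) : x = y := by
  ext i; fin_cases i <;> assumption

/-! ### Smooth points -/

theorem smul_mem_normalCone {K : Set Plane} {x n : Plane} {r : ℝ} (hr : 0 ≤ r)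
    (hn : n ∈ normalCone K x) : r • n ∈ normalCone K x := by
  intro y hy
  rw [inner_smul_left]
  exact mul_nonpos_of_nonneg_of_nonpos (by simpa using hr) (hn y hy)

/-- Both vectors normalize to the unique unit normal. This is the form in which smoothness is used:
any known normal gives the direction of a step up to a positive factor. -/
theorem IsSmoothPoint.pos_smul {K : Set Plane} {x n₁ n₂ : Plane} (hx : IsSmoothPoint K x)
    (h₁ : n₁ ∈ normalCone K x) (h₂ : n₂ ∈ normalCone K x) (h₁0 : n₁ ≠ 0) (h₂0 : n₂ ≠ 0) :
    ∃ r : ℝ, 0 < r ∧ n₂ = r • n₁ := by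
  obtain ⟨-, n, -, hu⟩ := hx
  have hp₁ : 0 < ‖n₁‖ := norm_pos_iff.2 h₁0
  have hp₂ : 0 < ‖n₂‖ := norm_pos_iff.2 h₂0
  have e₁ := hu (‖n₁‖⁻¹ • n₁) ⟨norm_smul_inv_norm (𝕜 := ℝ) h₁0, smul_mem_normalCone (by positivity) h₁⟩
  have e₂ := hu (‖n₂‖⁻¹ • n₂) ⟨norm_smul_inv_norm (𝕜 := ℝ) h₂0, smul_mem_normalCone (by positivity) h₂⟩
  refine ⟨‖n₂‖ * ‖n₁‖⁻¹, by positivity, ?_⟩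
  rw [mul_smul, e₁, ← e₂, smul_smul, mul_inv_cancel₀ hp₂.ne', one_smul]

/-- A description of smoothness by rays instead of unit vectors; free of the norm, it can be carried
along linear maps. -/
theorem isSmoothPoint_iff {K : Set Plane} {x : Plane} :
    IsSmoothPoint K x ↔ x ∈ frontier K ∧ ∃ n, n ≠ 0 ∧ n ∈ normalCone K x ∧
      ∀ n' ∈ normalCone K x, ∃ r : ℝ, 0 ≤ r ∧ n' = r • n := by
  constructor
  · intro h
    obtain ⟨n, ⟨hn, hnK⟩, -⟩ := h.2
    have hn0 : n ≠ 0 := by rintro rfl; simp at hn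
    refine ⟨h.1, n, hn0, hnK, fun n' hn' => ?_⟩
    by_cases h0 : n' = 0
    · exact ⟨0, le_rfl, by simp [h0]⟩
    · obtain ⟨r, hr, e⟩ := h.pos_smul hnK hn' hn0 h0
      exact ⟨r, hr.le, e⟩
  · rintro ⟨hx, n, hn0, hn, hu⟩
    have hp : 0 < ‖n‖ := norm_pos_iff.2 hn0
    refine ⟨hx, ‖n‖⁻¹ • n, ⟨norm_smul_inv_norm (𝕜 := ℝ) hn0, smul_mem_normalCone (by positivity) hn⟩, ?_⟩
    rintro n' ⟨h1, hn'⟩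
    obtain ⟨r, hr, rfl⟩ := hu n' hn'
    rw [norm_smul, Real.norm_of_nonneg hr] at h1
    rw [eq_inv_of_mul_eq_one_left h1]

/-! ### Regular trajectories -/

section Regular

variable {K T : Set Plane} {q p : ℕ → Plane}

theorem mem_of_mem_frontier (hK : IsClosed K) {x : Plane} (hx : x ∈ frontier K) : x ∈ K :=
  hK.frontier_subset hx

theorem IsRegularTrajectory.step_ne_zero (h : IsRegularTrajectory K T q p) (j : ℕ) :
    q (j + 1) - q j ≠ 0 := sub_ne_zero.2 (h.ne j).symm

theorem mem_segment_of_sub_eq_smul {x y z : Plane} {r : ℝ} (hr : 0 < r)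
    (h : z - y = r • (y - x)) : y ∈ segment ℝ x z := by
  refine ⟨r / (1 + r), 1 / (1 + r), by positivity, by positivity, by field_simp; ring, ?_⟩
  have : z = y + r • (y - x) := by rw [← h]; abel
  rw [this]
  have h1 : (1 + r) ≠ 0 := by positivity
  refine plane_ext ?_ ?_ <;> simp <;> field_simp <;> ring

/-- Otherwise the incoming and the outgoing step would both span the normal ray at the smooth point
`p (j + 1)`, so the trajectory would go straight on. -/
theorem IsRegularTrajectory.not_step_mem_normalCone (h : IsRegularTrajectory K T q p) (j : ℕ) :
    q (j + 1) - q j ∉ normalCone T (p (j + 1)) := by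
  intro hm
  obtain ⟨r, hr, e⟩ := (h.p_smooth (j + 1)).pos_smul hm (h.q_step (j + 1))
    (h.step_ne_zero j) (h.step_ne_zero (j + 1))
  exact h.not_between j (mem_segment_of_sub_eq_smul hr e)

theorem IsRegularTrajectory.inner_step_pos (h : IsRegularTrajectory K T q p)
    (j : ℕ) : 0 < inner ℝ (q (j + 1) - q j) (p j - p (j + 1)) := by
  by_contra hc
  apply h.not_step_mem_normalCone j
  intro y hy
  have h1 := h.q_step j y hy
  have : y - p (j + 1) = (y - p j) + (p j - p (j + 1)) := by abel
  rw [this, inner_add_right]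
  linarith

theorem IsRegularTrajectory.inner_next_step_neg (h : IsRegularTrajectory K T q p) (j : ℕ) :
    inner ℝ (q (j + 2) - q (j + 1)) (p j - p (j + 1)) < 0 := by
  by_contra hc
  have hm : q (j + 2) - q (j + 1) ∈ normalCone T (p j) := by
    intro y hy
    have h1 := h.q_step (j + 1) y hy
    have : y - p j = (y - p (j + 1)) - (p j - p (j + 1)) := by abel
    rw [this, inner_sub_right]
    linarith
  obtain ⟨r, hr, e⟩ := (h.p_smooth j).pos_smul (h.q_step j) hm
    (h.step_ne_zero j) (h.step_ne_zero (j + 1))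
  exact h.not_between j (mem_segment_of_sub_eq_smul hr e)

theorem IsRegularTrajectory.dual_step_ne_zero (h : IsRegularTrajectory K T q p)
    (j : ℕ) : p j - p (j + 1) ≠ 0 := by
  intro h0
  have := h.inner_step_pos j
  simp [h0] at this

theorem IsRegularTrajectory.dual_step (h : IsRegularTrajectory K T q p) (j : ℕ) :
    p j - p (j + 1) ∈ normalCone K (q (j + 1)) := by
  have := h.p_step j
  rwa [neg_sub] at this

/-- Trajectories arrive transversally: the normal is a positive multiple of the dual step, for which
strictness is `inner_step_pos`. -/
theorem IsRegularTrajectory.inner_normal_pos (h : IsRegularTrajectory K T q p)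
    {j : ℕ} {n : Plane} (hn : n ∈ normalCone K (q (j + 1))) (hn0 : n ≠ 0) :
    0 < inner ℝ n (q (j + 1) - q j) := by
  obtain ⟨r, hr, rfl⟩ := (h.q_smooth (j + 1)).pos_smul (h.dual_step j) hn
    (h.dual_step_ne_zero j) hn0
  rw [inner_smul_left, real_inner_comm]
  exact mul_pos (by simpa using hr) (h.inner_step_pos j)

/-- Trajectories leave transversally, also at time zero: a step along the side would make `n` normal
at the next point too, contradicting transversal arrival there. -/
theorem IsRegularTrajectory.inner_normal_neg (h : IsRegularTrajectory K T q p) (hK : IsClosed K)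
    {j : ℕ} {n : Plane} (hn : n ∈ normalCone K (q j)) (hn0 : n ≠ 0) :
    inner ℝ n (q (j + 1) - q j) < 0 := by
  by_contra hc
  have hm : n ∈ normalCone K (q (j + 1)) := by
    intro y hy
    have h1 := hn y hy
    have : y - q (j + 1) = (y - q j) - (q (j + 1) - q j) := by abel
    rw [this, inner_sub_right]
    linarith
  have h1 := h.inner_normal_pos hm hn0
  have h2 := hn _ (mem_of_mem_frontier hK (h.q_mem (j + 1)))
  linarith

theorem IsRegularTrajectory.exists_smul_normal (h : IsRegularTrajectory K T q p) {j : ℕ}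
    {m : Plane} (hm : m ∈ normalCone T (p j)) (hm0 : m ≠ 0) :
    ∃ l : ℝ, 0 < l ∧ q (j + 1) - q j = l • m :=
  (h.p_smooth j).pos_smul hm (h.q_step j) hm0 (h.step_ne_zero j)

theorem IsRegularTrajectory.exists_smul_dual_normal (h : IsRegularTrajectory K T q p)
    {j : ℕ} {n : Plane} (hn : n ∈ normalCone K (q (j + 1))) (hn0 : n ≠ 0) :
    ∃ l : ℝ, 0 < l ∧ p j - p (j + 1) = l • n :=
  (h.q_smooth (j + 1)).pos_smul hn (h.dual_step j) hn0 (h.dual_step_ne_zero j)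

theorem IsRegularTrajectory.shift (h : IsRegularTrajectory K T q p) (k : ℕ) :
    IsRegularTrajectory K T (fun j => q (j + k)) (fun j => p (j + k)) where
  q_mem j := h.q_mem _
  p_mem j := h.p_mem _
  ne j := by simpa only [add_right_comm] using h.ne (j + k)
  not_between j := by simpa only [add_right_comm] using h.not_between (j + k)
  q_step j := by simpa only [add_right_comm] using h.q_step (j + k)
  p_step j := by simpa only [add_right_comm] using h.p_step (j + k)
  q_smooth j := h.q_smooth _
  p_smooth j := h.p_smooth _

/-- A regular trajectory is determined backwards in time. -/
theorem IsRegularTrajectory.eq_of_succ_eq (h : IsRegularTrajectory K T q p) (hK : IsClosed K)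
    {i j : ℕ} (hq : q (i + 1) = q (j + 1)) (hp : p i = p j) : q i = q j := by
  -- If `r > 1`, then `q j` lies beyond `q i` on the backward ray, on the outer side of a supporting
  -- line at `q i`.
  have key : ∀ i j : ℕ, q (i + 1) = q (j + 1) → ∀ r : ℝ, 0 < r →
      q (j + 1) - q j = r • (q (i + 1) - q i) → r ≤ 1 := by
    intro i j hq r hr e
    obtain ⟨-, n, hn0, hn, -⟩ := isSmoothPoint_iff.1 (h.q_smooth i)
    have h1 := h.inner_normal_neg hK hn hn0
    have h2 := hn _ (mem_of_mem_frontier hK (h.q_mem j))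
    have : q j - q i = (1 - r) • (q (i + 1) - q i) := by
      rw [sub_smul, ← e, ← hq]; simp
    rw [this, inner_smul_right] at h2
    nlinarith
  have hj := h.q_step j
  rw [← hp] at hj
  obtain ⟨r, hr, e⟩ := (h.p_smooth i).pos_smul (h.q_step i) hj (h.step_ne_zero i)
    (h.step_ne_zero j)
  have h1 := key i j hq r hr e
  have h2 := key j i hq.symm r⁻¹ (by positivity) (by rw [e, smul_smul, inv_mul_cancel₀ hr.ne', one_smul])
  have h3 : r = 1 := by
    have := (inv_le_one₀ hr).1 h2
    linarith
  rw [h3, one_smul, hq] at e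
  simpa using e.symm

end Regular

/-! ### Polygons -/

/-- `K` is a compact set with non-empty interior which is the intersection of the half-planes
`⟨n i, x⟩ ≤ c i`. Vanishing normals are allowed. -/
structure IsPolygon {ι : Type} (n : ι → Plane) (c : ι → ℝ) (K : Set Plane) : Prop where
  eq : K = {x | ∀ i, inner ℝ (n i) x ≤ c i}
  compact : IsCompact K
  nonempty : (interior K).Nonempty

namespace IsPolygon

variable {ι : Type} {n : ι → Plane} {c : ι → ℝ} {K : Set Plane}

theorem mem_iff (h : IsPolygon n c K) {x : Plane} : x ∈ K ↔ ∀ i, inner ℝ (n i) x ≤ c i := by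
  rw [h.eq]; rfl

theorem isClosed (h : IsPolygon n c K) : IsClosed K := h.compact.isClosed

theorem convex (h : IsPolygon n c K) : Convex ℝ K := by
  intro x hx y hy a b ha hb hab
  rw [h.mem_iff] at *
  intro i
  rw [inner_add_right, inner_smul_right, inner_smul_right]
  calc a * inner ℝ (n i) x + b * inner ℝ (n i) y ≤ a * c i + b * c i :=
        add_le_add (mul_le_mul_of_nonneg_left (hx i) ha) (mul_le_mul_of_nonneg_left (hy i) hb)
    _ = c i := by rw [← add_mul, hab, one_mul]

theorem mem_normalCone (h : IsPolygon n c K) {x : Plane} {i : ι} (hi : inner ℝ (n i) x = c i) :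
    n i ∈ normalCone K x := by
  intro y hy
  rw [inner_sub_right, hi, sub_nonpos]
  exact h.mem_iff.1 hy i

theorem mem_interior_of_lt [Finite ι] (h : IsPolygon n c K) {x : Plane} (hx : x ∈ K)
    (hlt : ∀ i, n i ≠ 0 → inner ℝ (n i) x < c i) : x ∈ interior K := by
  rw [mem_interior_iff_mem_nhds]
  have : ∀ᶠ y in nhds x, ∀ i, inner ℝ (n i) y ≤ c i := by
    rw [Filter.eventually_all]
    intro i
    by_cases h0 : n i = 0
    · have := h.mem_iff.1 hx i
      filter_upwards with y
      simpa [h0] using this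
    · have hc : Continuous fun y : Plane => inner ℝ (n i) y := by fun_prop
      filter_upwards [hc.continuousAt.eventually_lt continuousAt_const (hlt i h0)] with y hy
      exact hy.le
  filter_upwards [this] with y hy
  exact h.mem_iff.2 hy

theorem exists_active [Finite ι] (h : IsPolygon n c K) {x : Plane} (hx : x ∈ frontier K) :
    ∃ i, n i ≠ 0 ∧ inner ℝ (n i) x = c i := by
  by_contra! hc
  have hxK := h.isClosed.frontier_subset hx
  exact hx.2 (h.mem_interior_of_lt hxK fun i hi => lt_of_le_of_ne (h.mem_iff.1 hxK i) (hc i hi))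

end IsPolygon

/-- From an interior point one can still move a little in direction `n` without leaving `K`, so the
inequality is strict. -/
theorem inner_neg_of_mem_interior {K : Set Plane} {x y n : Plane} (hn : n ∈ normalCone K x)
    (hn0 : n ≠ 0) (hy : y ∈ interior K) : inner ℝ n (y - x) < 0 := by
  have hc : Continuous fun t : ℝ => y + t • n := by fun_prop
  have h1 : ∀ᶠ t in nhds (0 : ℝ), y + t • n ∈ K := by
    apply hc.continuousAt.eventually
    simpa using mem_interior_iff_mem_nhds.1 hy
  have h2 : ∀ᶠ t in nhdsWithin (0 : ℝ) (Ioi 0), y + t • n ∈ K ∧ 0 < t :=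
    (h1.filter_mono nhdsWithin_le_nhds).and self_mem_nhdsWithin
  obtain ⟨t, ht, ht0⟩ := h2.exists
  have h3 := hn _ ht
  rw [add_sub_right_comm, inner_add_right, inner_smul_right, real_inner_self_eq_norm_sq] at h3
  have : 0 < t * ‖n‖ ^ 2 := by have := norm_pos_iff.2 hn0; positivity
  linarith

namespace IsPolygon

variable {ι : Type} {n : ι → Plane} {c : ι → ℝ} {K : Set Plane}

/-- A boundary point all of whose active constraints have positively proportional normals is
smooth. -/
theorem isSmoothPoint [Finite ι] (h : IsPolygon n c K) {x : Plane} (hx : x ∈ frontier K) {i : ι}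
    (hi0 : n i ≠ 0) (hi : inner ℝ (n i) x = c i)
    (hu : ∀ k, n k ≠ 0 → inner ℝ (n k) x = c k → ∃ r : ℝ, 0 < r ∧ n k = r • n i) :
    IsSmoothPoint K x := by
  have hxK := h.isClosed.frontier_subset hx
  -- All active normals are proportional to `n i`, so every such `v` points into `K`.
  have key : ∀ m ∈ normalCone K x, ∀ v : Plane, inner ℝ (n i) v < 0 → inner ℝ m v ≤ 0 := by
    intro m hm v hv
    have : ∀ᶠ t in nhdsWithin (0 : ℝ) (Ioi 0), ∀ k, inner ℝ (n k) (x + t • v) ≤ c k := by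
      rw [Filter.eventually_all]
      intro k
      by_cases h0 : n k = 0
      · have := h.mem_iff.1 hxK k
        filter_upwards with y
        simpa [h0] using this
      rcases (h.mem_iff.1 hxK k).lt_or_eq with hk | hk
      · have hc : Continuous fun t : ℝ => inner ℝ (n k) (x + t • v) := by fun_prop
        have : ∀ᶠ t in nhds (0 : ℝ), inner ℝ (n k) (x + t • v) < c k :=
          hc.continuousAt.eventually_lt continuousAt_const (by simpa using hk)
        exact (this.mono fun t ht => ht.le).filter_mono nhdsWithin_le_nhds
      · obtain ⟨r, hr, e⟩ := hu k h0 hk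
        filter_upwards [self_mem_nhdsWithin] with t ht
        rw [inner_add_right, hk, e, inner_smul_right, inner_smul_left]
        have : (t : ℝ) * (r * inner ℝ (n i) v) < 0 :=
          mul_neg_of_pos_of_neg ht (mul_neg_of_pos_of_neg hr hv)
        simp only [conj_trivial]
        linarith
    obtain ⟨t, ht, ht0⟩ := (this.and self_mem_nhdsWithin).exists
    have h1 := hm _ (h.mem_iff.2 ht)
    rw [add_sub_cancel_left, inner_smul_right] at h1
    exact nonpos_of_mul_nonpos_right h1 ht0
  refine isSmoothPoint_iff.2 ⟨hx, n i, hi0, h.mem_normalCone hi, fun m hm => ?_⟩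
  set a := n i with ha
  have hpos : 0 < a 0 * a 0 + a 1 * a 1 := by
    rw [← inner_plane, real_inner_self_eq_norm_sq]
    have := norm_pos_iff.2 hi0
    positivity
  have hcross : m 0 * a 1 - m 1 * a 0 = 0 := by
    by_contra hne
    -- The test vector is `-a` plus `s` times a rotation of `a`; its product with `a` is negative
    -- for every `s`. The value of `s` used below makes its product with `m` equal to one.
    have hk := fun s : ℝ => key m hm !₂[s * a 1 - a 0, - s * a 0 - a 1] (by
      rw [inner_plane]; simp; nlinarith)
    simp only [inner_plane] at hk
    simp at hk
    have := hk ((m 0 * a 0 + m 1 * a 1 + 1) / (m 0 * a 1 - m 1 * a 0))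
    have e : (m 0 * a 0 + m 1 * a 1 + 1) / (m 0 * a 1 - m 1 * a 0) * (m 0 * a 1 - m 1 * a 0) =
      m 0 * a 0 + m 1 * a 1 + 1 := div_mul_cancel₀ _ hne
    nlinarith
  have hdot : 0 ≤ m 0 * a 0 + m 1 * a 1 := by
    have := key m hm (-a) (by rw [inner_neg_right, inner_plane]; linarith)
    rw [inner_neg_right, inner_plane] at this
    linarith
  refine ⟨(m 0 * a 0 + m 1 * a 1) / (a 0 * a 0 + a 1 * a 1), by positivity, plane_ext ?_ ?_⟩
  · simp only [PiLp.smul_apply, smul_eq_mul]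
    rw [div_mul_eq_mul_div, eq_div_iff hpos.ne']
    linear_combination (a 1) * hcross
  · simp only [PiLp.smul_apply, smul_eq_mul]
    rw [div_mul_eq_mul_div, eq_div_iff hpos.ne']
    linear_combination (-a 0) * hcross

/-- Two active constraints with non-zero normals are either positively proportional or linearly
independent. -/
theorem pos_smul_or_det_ne_zero (h : IsPolygon n c K) {x : Plane} {i k : ι}
    (hi0 : n i ≠ 0) (hi : inner ℝ (n i) x = c i) (hk0 : n k ≠ 0) (hk : inner ℝ (n k) x = c k) :
    (∃ r : ℝ, 0 < r ∧ n k = r • n i) ∨ n i 0 * n k 1 - n i 1 * n k 0 ≠ 0 := by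
  by_cases hdet : n i 0 * n k 1 - n i 1 * n k 0 = 0
  · left
    obtain ⟨y, hy⟩ := h.nonempty
    have h1 := inner_neg_of_mem_interior (h.mem_normalCone hi) hi0 hy
    have h2 := inner_neg_of_mem_interior (h.mem_normalCone hk) hk0 hy
    refine ⟨inner ℝ (n k) (y - x) / inner ℝ (n i) (y - x), div_pos_of_neg_of_neg h2 h1,
      plane_ext ?_ ?_⟩
    · simp only [PiLp.smul_apply, smul_eq_mul]
      rw [div_mul_eq_mul_div, eq_div_iff h1.ne, inner_plane, inner_plane]
      linear_combination (-(y - x) 1) * hdet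
    · simp only [PiLp.smul_apply, smul_eq_mul]
      rw [div_mul_eq_mul_div, eq_div_iff h1.ne, inner_plane, inner_plane]
      linear_combination ((y - x) 0) * hdet
  · exact Or.inr hdet

/-- A non-smooth boundary point lies on two active lines with independent normals, and each of the
finitely many pairs of lines determines at most one point. -/
theorem countable_nonsmooth [Finite ι] (h : IsPolygon n c K) :
    {x | x ∈ frontier K ∧ ¬ IsSmoothPoint K x}.Countable := by
  have : {x | x ∈ frontier K ∧ ¬ IsSmoothPoint K x} ⊆ ⋃ ik : ι × ι,
      {x | n ik.1 0 * n ik.2 1 - n ik.1 1 * n ik.2 0 ≠ 0 ∧ inner ℝ (n ik.1) x = c ik.1 ∧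
        inner ℝ (n ik.2) x = c ik.2} := by
    rintro x ⟨hx, hs⟩
    obtain ⟨i, hi0, hi⟩ := h.exists_active hx
    by_contra hn
    simp only [mem_iUnion, Prod.exists, not_exists] at hn
    refine hs (h.isSmoothPoint hx hi0 hi fun k hk0 hk => ?_)
    exact (h.pos_smul_or_det_ne_zero hi0 hi hk0 hk).resolve_right fun hd => hn i k ⟨hd, hi, hk⟩
  refine Countable.mono this (countable_iUnion fun ik => Subsingleton.countable ?_)
  rintro x ⟨hd, h1, h2⟩ y ⟨-, h3, h4⟩
  rw [inner_plane] at h1 h2 h3 h4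
  refine plane_ext ?_ ?_
  · apply mul_left_cancel₀ hd
    linear_combination (n ik.2 1) * (h1 - h3) - (n ik.1 1) * (h2 - h4)
  · apply mul_left_cancel₀ hd
    linear_combination (n ik.1 0) * (h2 - h4) - (n ik.2 0) * (h1 - h3)

/-- At a smooth point, constraints that are not parallel to an active one are inactive. -/
theorem lt_of_det_ne_zero (h : IsPolygon n c K) {x : Plane} (hx : IsSmoothPoint K x) (hxK : x ∈ K)
    {i k : ι} (hi : inner ℝ (n i) x = c i) (hd : n i 0 * n k 1 - n i 1 * n k 0 ≠ 0) :
    inner ℝ (n k) x < c k := by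
  refine lt_of_le_of_ne (h.mem_iff.1 hxK k) fun hk => ?_
  obtain ⟨r, -, e⟩ := hx.pos_smul (h.mem_normalCone hi) (h.mem_normalCone hk)
    (by intro h0; simp [h0] at hd) (by intro h0; simp [h0] at hd)
  apply hd
  rw [e]
  simp
  ring

end IsPolygon

end Billiard

/-! ### Regular trajectories from all but countably many initial points, and density of their paths.
-/

namespace Billiard

open Set

/-! ### Chords -/

/-- The points `x`, `y` are the end points of a chord of `K` in direction `m` through the interior. -/
def Chord (K : Set Plane) (m x y : Plane) : Prop :=
  x ∈ frontier K ∧ y ∈ frontier K ∧ ∃ l : ℝ, 0 < l ∧ y = x + l • m ∧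
    ∀ t : ℝ, 0 < t → t < l → x + t • m ∈ interior K

/-- Going back from `y`, the longer chord would contain the starting point of the shorter one in its
open part, which is interior. This injectivity keeps the preimages of countable sets countable. -/
theorem Chord.left_unique {K : Set Plane} {m x₁ x₂ y : Plane} (h₁ : Chord K m x₁ y)
    (h₂ : Chord K m x₂ y) : x₁ = x₂ := by
  have key : ∀ x₁ x₂ : Plane, ∀ l₁ l₂ : ℝ, x₁ ∈ frontier K → 0 < l₁ → x₁ + l₁ • m = x₂ + l₂ • m →
      (∀ t : ℝ, 0 < t → t < l₂ → x₂ + t • m ∈ interior K) → l₂ ≤ l₁ := by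
    intro x₁ x₂ l₁ l₂ hx h0 e hi
    by_contra! hlt
    have h1 := hi (l₂ - l₁) (by linarith) (by linarith)
    have h2 : x₂ + (l₂ - l₁) • m = x₁ := by
      rw [sub_smul, ← add_sub_assoc, ← e]; simp
    exact hx.2 (h2 ▸ h1)
  obtain ⟨hf₁, -, l₁, h0₁, e₁, hi₁⟩ := h₁
  obtain ⟨hf₂, -, l₂, h0₂, e₂, hi₂⟩ := h₂
  have h := le_antisymm (key x₂ x₁ l₂ l₁ hf₂ h0₂ (e₂.symm.trans e₁) hi₁)
    (key x₁ x₂ l₁ l₂ hf₁ h0₁ (e₁.symm.trans e₂) hi₂)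
  rw [e₁, h] at e₂
  exact add_right_cancel e₂

/-- The exit is the last parameter for which the line is in the compact set `K`; convexity then puts
the open segment into the interior. The value `t₀ = 0` is allowed, for an interior starting point.
-/
theorem exists_exit {K : Set Plane} (hc : IsCompact K) (hK : Convex ℝ K) {x m : Plane}
    (hm : m ≠ 0) {t₀ : ℝ} (hx : x ∈ K) (hi : x + t₀ • m ∈ interior K) :
    ∃ l : ℝ, t₀ < l ∧ x + l • m ∈ frontier K ∧
      ∀ t : ℝ, 0 < t → t < l → x + t • m ∈ interior K := by
  have hcont : Continuous fun t : ℝ => x + t • m := by fun_prop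
  have hemb : Topology.IsClosedEmbedding fun t : ℝ => x + t • m :=
    (Homeomorph.addLeft x).isClosedEmbedding.comp (isClosedEmbedding_smul_left hm)
  have hS : IsCompact ((fun t : ℝ => x + t • m) ⁻¹' K) := hemb.isCompact_preimage hc
  have hi' : x + t₀ • m ∈ K := interior_subset hi
  obtain ⟨l, hl, hmax⟩ := hS.exists_isMaxOn ⟨t₀, hi'⟩ continuousOn_id
  have hnot : x + l • m ∉ interior K := by
    intro hlK
    have h1 : ∀ᶠ t in nhds l, x + t • m ∈ K :=
      hcont.continuousAt.eventually (mem_interior_iff_mem_nhds.1 hlK)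
    have h2 : ∀ᶠ t in nhdsWithin l (Ioi l), x + t • m ∈ K ∧ l < t :=
      (h1.filter_mono nhdsWithin_le_nhds).and self_mem_nhdsWithin
    obtain ⟨t, ht, hlt⟩ := h2.exists
    exact absurd (hmax ht) (not_le.2 hlt)
  have hlt : t₀ < l := lt_of_le_of_ne (hmax hi') fun h => hnot (h ▸ hi)
  refine ⟨l, hlt, ⟨subset_closure hl, hnot⟩, fun t ht htl => ?_⟩
  -- Up to `t₀` the point is a combination of `x` and the interior point, afterwards of the interior
  -- point and the exit.
  rcases le_total t t₀ with h | h
  · have hp : 0 < t₀ := lt_of_lt_of_le ht h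
    have := hK.combo_self_interior_mem_interior hx hi (a := 1 - t / t₀) (b := t / t₀)
      (by rw [sub_nonneg, div_le_one hp]; exact h) (by positivity) (by ring)
    convert this using 1
    have e : t = t / t₀ * t₀ := by field_simp
    rw [smul_add, smul_smul, ← e, ← add_assoc, ← add_smul]; simp
  · have hp : 0 < l - t₀ := by linarith
    have := hK.combo_interior_self_mem_interior hi hl (a := (l - t) / (l - t₀))
      (b := (t - t₀) / (l - t₀)) (div_pos (by linarith) hp) (div_nonneg (by linarith) hp.le)
      (by field_simp; ring)
    convert this using 1
    refine plane_ext ?_ ?_ <;> simp <;> field_simp <;> ring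

theorem exists_chord {K : Set Plane} (hc : IsCompact K) (hK : Convex ℝ K) {x m : Plane}
    (hm : m ≠ 0) {t₀ : ℝ} (hx : x ∈ frontier K) (h0 : 0 < t₀) (hi : x + t₀ • m ∈ interior K) :
    ∃ l : ℝ, t₀ < l ∧ Chord K m x (x + l • m) := by
  obtain ⟨l, hl, hf, h⟩ := exists_exit hc hK hm (hc.isClosed.frontier_subset hx) hi
  exact ⟨l, hl, hx, hf, l, h0.trans hl, rfl, h⟩

theorem Chord.inner_pos {K : Set Plane} {m x y n : Plane} (h : Chord K m x y)
    (hn : n ∈ normalCone K y) (hn0 : n ≠ 0) : 0 < inner ℝ n m := by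
  obtain ⟨-, -, l, hl, rfl, hi⟩ := h
  have := inner_neg_of_mem_interior hn hn0 (hi (l / 2) (by positivity) (by linarith))
  have e : x + (l / 2) • m - (x + l • m) = (-(l / 2)) • m := by
    refine plane_ext ?_ ?_ <;> simp <;> ring
  rw [e, inner_smul_right] at this
  nlinarith

/-- The points from which some sequence of chords with directions in `M` ends in a boundary point
that is not smooth. -/
inductive Bad (K M : Set Plane) : Plane → Prop
  | nonsmooth {x : Plane} (hx : x ∈ frontier K) (hs : ¬ IsSmoothPoint K x) : Bad K M x
  | chord {m x y : Plane} (hm : m ∈ M) (hxy : Chord K m x y) (hy : Bad K M y) : Bad K M x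

theorem countable_bad {K M : Set Plane} (hM : M.Countable)
    (hK : {x | x ∈ frontier K ∧ ¬ IsSmoothPoint K x}.Countable) : {x | Bad K M x}.Countable := by
  -- Level `k` consists of the points from which `k` chords lead to a non-smooth point. Each level
  -- is countable because a chord is determined by its direction and its end.
  let level : ℕ → Set Plane := fun k => k.rec {x | x ∈ frontier K ∧ ¬ IsSmoothPoint K x}
    fun _ s => ⋃ m ∈ M, ⋃ y ∈ s, {x | Chord K m x y}
  have hcount : ∀ k, (level k).Countable := by
    intro k
    induction k with
    | zero => exact hK
    | succ k ih =>
      refine hM.biUnion fun m _ => ih.biUnion fun y _ => Subsingleton.countable ?_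
      exact fun x hx x' hx' => Chord.left_unique hx hx'
  refine (countable_iUnion hcount).mono fun x hx => ?_
  change Bad K M x at hx
  rw [mem_iUnion]
  induction hx with
  | nonsmooth hx hs => exact ⟨0, hx, hs⟩
  | chord hm hxy _ ih =>
    obtain ⟨k, hk⟩ := ih
    exact ⟨k + 1, mem_iUnion₂.2 ⟨_, hm, mem_iUnion₂.2 ⟨_, hk, hxy⟩⟩⟩

theorem isSmoothPoint_of_not_bad {K M : Set Plane} {x : Plane} (hx : x ∈ frontier K)
    (h : ¬ Bad K M x) : IsSmoothPoint K x := by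
  by_contra hs
  exact h (Bad.nonsmooth hx hs)

/-- Close to any interior point there is one whose ray in direction `-m` leaves `K` outside of a
given countable set. -/
theorem exists_entry_notMem {K C U : Set Plane} (hc : IsCompact K) (hK : Convex ℝ K)
    {x m : Plane} (hm : m ≠ 0) (hC : C.Countable) (hx : x ∈ interior K) (hU : U ∈ nhds x) :
    ∃ y ∈ U, y ∈ interior K ∧ ∃ z ∈ frontier K, z ∉ C ∧ ∃ t : ℝ, 0 < t ∧ y = z + t • m := by
  have hpos : 0 < m 0 * m 0 + m 1 * m 1 := by
    rw [← inner_plane, real_inner_self_eq_norm_sq]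
    have := norm_pos_iff.2 hm
    positivity
  set e : Plane := !₂[m 1, -m 0] with he
  have hcont : Continuous fun s : ℝ => x + s • e := by fun_prop
  have hev : ∀ᶠ s in nhds (0 : ℝ), x + s • e ∈ U ∩ interior K := by
    apply hcont.continuousAt.eventually
    simpa using Filter.inter_mem hU (isOpen_interior.mem_nhds hx)
  obtain ⟨δ, hδ, hball⟩ := Metric.eventually_nhds_iff.1 hev
  by_contra! hne
  -- The parallel rays through `x + s • e` enter at points from which `s` can be read off. If all of
  -- them entered in `C`, an interval would be countable.
  have hsub : Ioo 0 δ ⊆ (fun z : Plane => (inner ℝ z e - inner ℝ x e) / (m 0 * m 0 + m 1 * m 1)) '' C := by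
    intro s hs
    have hy := hball (y := s) (by simpa [abs_of_pos hs.1] using hs.2)
    obtain ⟨l, hl, hf, -⟩ := exists_exit hc hK (x := x + s • e) (m := -m) (t₀ := 0) (by simpa using hm)
      (interior_subset hy.2) (by simpa using hy.2)
    have hzC : x + s • e + l • (-m) ∈ C := by
      by_contra hz
      exact hne _ hy.1 hy.2 _ hf hz l hl (by simp)
    refine ⟨_, hzC, ?_⟩
    rw [div_eq_iff hpos.ne', inner_plane, inner_plane]
    simp [he]
    ring
  have := (hC.image _).mono hsub
  exact absurd (Cardinal.Real.Ioo_countable_iff.1 this) (not_le.2 hδ)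

theorem IsPolygon.exists_pos_mem_interior {ι : Type} [Finite ι] {n : ι → Plane} {c : ι → ℝ}
    {K : Set Plane} (h : IsPolygon n c K) {x a m : Plane} (hx : IsSmoothPoint K x)
    (ha : a ∈ normalCone K x) (ha0 : a ≠ 0) (ham : inner ℝ a m < 0) :
    ∃ t : ℝ, 0 < t ∧ x + t • m ∈ interior K := by
  have hxK := h.isClosed.frontier_subset hx.1
  have : ∀ᶠ t in nhdsWithin (0 : ℝ) (Ioi 0), ∀ k, n k ≠ 0 → inner ℝ (n k) (x + t • m) < c k := by
    rw [Filter.eventually_all]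
    intro k
    by_cases h0 : n k = 0
    · filter_upwards with y
      simp [h0]
    rcases (h.mem_iff.1 hxK k).lt_or_eq with hk | hk
    · have hc : Continuous fun t : ℝ => inner ℝ (n k) (x + t • m) := by fun_prop
      have : ∀ᶠ t in nhds (0 : ℝ), inner ℝ (n k) (x + t • m) < c k :=
        hc.continuousAt.eventually_lt continuousAt_const (by simpa using hk)
      exact (this.mono fun t ht _ => ht).filter_mono nhdsWithin_le_nhds
    · obtain ⟨r, hr, e⟩ := hx.pos_smul ha (h.mem_normalCone hk) ha0 h0
      filter_upwards [self_mem_nhdsWithin] with t ht _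
      rw [inner_add_right, hk, e, inner_smul_right, inner_smul_left]
      have : (t : ℝ) * (r * inner ℝ a m) < 0 :=
        mul_neg_of_pos_of_neg ht (mul_neg_of_pos_of_neg hr ham)
      simp only [conj_trivial]
      linarith
  obtain ⟨t, ht, ht0⟩ := (this.and self_mem_nhdsWithin).exists
  refine ⟨t, ht0, h.mem_interior_of_lt (h.mem_iff.2 fun k => ?_) ht⟩
  by_cases h0 : n k = 0
  · simpa [h0] using h.mem_iff.1 hxK k
  · exact (ht k h0).le

/-! ### Existence of regular trajectories -/

section Existence

variable {ι κ : Type} [Finite ι] [Finite κ] {n : ι → Plane} {c : ι → ℝ} {m : κ → Plane}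
  {d : κ → ℝ} {K T : Set Plane}

/-- Choosing the normal among the listed ones confines the directions of all steps to a finite set,
as needed for `Bad`. The implication is inside the existential so that `choose` gives a function on
the whole plane. -/
theorem IsPolygon.exists_normal (h : IsPolygon n c K) (x : Plane) :
    ∃ a : Plane, x ∈ frontier K → a ∈ range n ∧ a ≠ 0 ∧ a ∈ normalCone K x := by
  by_cases hx : x ∈ frontier K
  · obtain ⟨i, hi0, hi⟩ := h.exists_active hx
    exact ⟨n i, fun _ => ⟨⟨i, rfl⟩, hi0, h.mem_normalCone hi⟩⟩
  · exact ⟨0, fun h => absurd h hx⟩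

/-- The pair of current points is iterated: follow the chord of `K` in the direction of the normal
at `y`, then the chord of `T` against the normal at the new point of `K`. A point that is not bad
leads to a point that is not bad, so all vertices are smooth. -/
theorem exists_regularTrajectory (hK : IsPolygon n c K) (hT : IsPolygon m d T) {x y a b : Plane}
    (hx : x ∈ frontier K) (hxb : ¬ Bad K (range m) x) (ha : a ∈ normalCone K x) (ha0 : a ≠ 0)
    (hy : y ∈ frontier T) (hyb : ¬ Bad T (range fun i => -n i) y) (hb : b ∈ normalCone T y)
    (hb0 : b ≠ 0) (hab : inner ℝ a b < 0) :
    ∃ q p : ℕ → Plane, IsRegularTrajectory K T q p ∧ q 0 = x ∧ p 0 = y := by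
  choose ν hν using hK.exists_normal
  choose μ hμ using hT.exists_normal
  -- The last condition says that the next direction points into `K`; `Chord.inner_pos` reproduces
  -- it after each step.
  let good : Plane × Plane → Prop := fun s => s.1 ∈ frontier K ∧ ¬ Bad K (range m) s.1 ∧
    s.2 ∈ frontier T ∧ ¬ Bad T (range fun i => -n i) s.2 ∧ inner ℝ (ν s.1) (μ s.2) < 0
  have step : ∀ s : {s // good s}, ∃ s' : {s // good s}, Chord K (μ s.1.2) s.1.1 s'.1.1 ∧
      Chord T (-(ν s'.1.1)) s.1.2 s'.1.2 := by
    rintro ⟨⟨x, y⟩, hx, hxb, hy, hyb, hi⟩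
    dsimp only at hx hxb hy hyb hi ⊢
    obtain ⟨hμr, hμ0, hμn⟩ := hμ y hy
    obtain ⟨hνr, hν0, hνn⟩ := hν x hx
    obtain ⟨t, ht, hti⟩ := hK.exists_pos_mem_interior (isSmoothPoint_of_not_bad hx hxb) hνn hν0 hi
    obtain ⟨l, -, hch⟩ := exists_chord hK.compact hK.convex hμ0 hx ht hti
    generalize x + l • μ y = x' at hch
    have hxb' : ¬ Bad K (range m) x' := fun h => hxb (Bad.chord hμr hch h)
    obtain ⟨⟨i, hνr'⟩, hν0', hνn'⟩ := hν x' hch.2.1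
    have hpos := hch.inner_pos hνn' hν0'
    obtain ⟨t', ht', hti'⟩ := hT.exists_pos_mem_interior (m := -ν x') (isSmoothPoint_of_not_bad hy hyb) hμn hμ0
      (by rw [inner_neg_right, real_inner_comm]; linarith)
    obtain ⟨l', -, hch'⟩ := exists_chord hT.compact hT.convex (neg_ne_zero.2 hν0') hy ht' hti'
    generalize y + l' • -ν x' = y' at hch'
    have hyb' : ¬ Bad T (range fun i => -n i) y' := fun h => hyb (Bad.chord ⟨i, by simp [hνr']⟩ hch' h)
    obtain ⟨-, hμ0', hμn'⟩ := hμ y' hch'.2.1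
    have hpos' := hch'.inner_pos hμn' hμ0'
    rw [inner_neg_right, real_inner_comm] at hpos'
    exact ⟨⟨(x', y'), hch.2.1, hxb', hch'.2.1, hyb', by simpa using hpos'⟩, hch, hch'⟩
  choose f hf using step
  have hgood : good (x, y) := by
    refine ⟨hx, hxb, hy, hyb, ?_⟩
    obtain ⟨-, hν0, hνn⟩ := hν x hx
    obtain ⟨-, hμ0, hμn⟩ := hμ y hy
    obtain ⟨r, hr, e⟩ := (isSmoothPoint_of_not_bad hx hxb).pos_smul ha hνn ha0 hν0
    obtain ⟨r', hr', e'⟩ := (isSmoothPoint_of_not_bad hy hyb).pos_smul hb hμn hb0 hμ0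
    change inner ℝ (ν x) (μ y) < 0
    rw [e, e', inner_smul_left, inner_smul_right, conj_trivial]
    exact mul_neg_of_pos_of_neg hr (mul_neg_of_pos_of_neg hr' hab)
  let S : ℕ → {s // good s} := fun j => f^[j] ⟨(x, y), hgood⟩
  have hS : ∀ j, S (j + 1) = f (S j) := fun j => Function.iterate_succ_apply' f j _
  have hchK : ∀ j, Chord K (μ (S j).1.2) (S j).1.1 (S (j + 1)).1.1 := fun j => by
    rw [hS]; exact (hf (S j)).1
  have hchT : ∀ j, Chord T (-(ν (S (j + 1)).1.1)) (S j).1.2 (S (j + 1)).1.2 := fun j => by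
    rw [hS]; exact (hf (S j)).2
  have hμS := fun j => hμ _ (S j).2.2.2.1
  have hνS := fun j => hν _ (S j).2.1
  refine ⟨fun j => (S j).1.1, fun j => (S j).1.2, ?_, rfl, rfl⟩
  have hdir : ∀ j, ∃ l : ℝ, 0 < l ∧ (S (j + 1)).1.1 - (S j).1.1 = l • μ (S j).1.2 := fun j => by
    obtain ⟨-, -, l, hl, e, -⟩ := hchK j
    exact ⟨l, hl, by rw [e, add_sub_cancel_left]⟩
  refine
    { q_mem := fun j => (S j).2.1
      p_mem := fun j => (S j).2.2.2.1
      ne := fun j => ?_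
      not_between := fun j => ?_
      q_step := fun j => ?_
      p_step := fun j => ?_
      q_smooth := fun j => isSmoothPoint_of_not_bad (S j).2.1 (S j).2.2.1
      p_smooth := fun j => isSmoothPoint_of_not_bad (S j).2.2.2.1 (S j).2.2.2.2.1 }
  · obtain ⟨l, hl, e⟩ := hdir j
    intro he
    rw [← he, sub_self] at e
    exact smul_ne_zero hl.ne' (hμS j).2.1 e.symm
  · rintro ⟨u, v, hu, hv, huv, e⟩
    obtain ⟨l, hl, e₁⟩ := hdir j
    obtain ⟨l', hl', e₂⟩ := hdir (j + 1)
    have h1 := (hchK j).inner_pos (hνS (j + 1)).2.2 (hνS (j + 1)).2.1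
    have h2 := (S (j + 1)).2.2.2.2.2
    -- Going straight on contradicts the signs of the two directions against the normal at the
    -- bounce.
    have e₃ : (v * l') • μ (S (j + 1)).1.2 = (u * l) • μ (S j).1.2 := by
      rw [mul_smul, mul_smul, ← e₁, ← e₂, smul_sub, smul_sub]
      have e₄ : (S (j + 1)).1.1 = u • (S (j + 1)).1.1 + v • (S (j + 1)).1.1 := by
        rw [← add_smul, huv, one_smul]
      have e₅ := e.trans e₄
      change v • (S (j + 2)).1.1 - _ = _
      rw [sub_eq_sub_iff_add_eq_add, add_comm, e₅]
    have e₆ := congrArg (fun z => inner ℝ (ν (S (j + 1)).1.1) z) e₃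
    simp only [inner_smul_right] at e₆
    rcases hu.eq_or_lt with h0 | hu
    · rw [← h0] at e₆ huv
      rw [zero_add] at huv
      rw [huv] at e₆
      nlinarith
    · have := mul_pos (mul_pos hu hl) h1
      have := mul_nonneg hv hl'.le
      nlinarith
  · obtain ⟨l, hl, e⟩ := hdir j
    rw [e]
    exact smul_mem_normalCone hl.le (hμS j).2.2
  · obtain ⟨-, -, l, hl, e, -⟩ := hchT j
    rw [e, add_sub_cancel_left, smul_neg, neg_neg]
    exact smul_mem_normalCone hl.le (hνS (j + 1)).2.2

theorem path_subset (hK : IsClosed K) (hc : Convex ℝ K) {q : ℕ → Plane}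
    (hq : ∀ j, q j ∈ frontier K) : path q ⊆ K :=
  iUnion_subset fun j => hc.segment_subset (hK.frontier_subset (hq j)) (hK.frontier_subset (hq _))

/-- The paths of the regular trajectories in a pair of polygons are dense. -/
theorem closure_path_eq (hK : IsPolygon n c K) (hT : IsPolygon m d T) :
    closure {x : Plane | ∃ q p : ℕ → Plane, IsRegularTrajectory K T q p ∧ x ∈ path q} = K := by
  refine Subset.antisymm (hK.isClosed.closure_subset_iff.2 ?_) ?_
  · rintro x ⟨q, p, h, hx⟩
    exact path_subset hK.isClosed hK.convex h.q_mem hx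
  have hKint : K ⊆ closure (interior K) := by
    rw [hK.convex.closure_interior_eq_closure_of_nonempty_interior hK.nonempty]
    exact subset_closure
  refine hKint.trans (closure_minimal (fun x hx => ?_) isClosed_closure)
  rw [mem_closure_iff_nhds]
  intro U hU
  have hcK : {x | Bad K (range m) x}.Countable :=
    countable_bad (countable_range m) hK.countable_nonsmooth
  have hcT : {x | Bad T (range fun i => -n i) x}.Countable :=
    countable_bad (countable_range _) hT.countable_nonsmooth
  obtain ⟨y₀, hy₀⟩ := hT.nonempty
  have h1 : (!₂[1, 0] : Plane) ≠ 0 := fun h => by simpa using congrArg (fun z : Plane => z 0) h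
  -- The direction is arbitrary here; only some boundary point of `T` that is not bad is needed. Its
  -- normal then prescribes the first direction in `K`.
  obtain ⟨-, -, -, y, hyf, hyb, -⟩ := exists_entry_notMem hT.compact hT.convex h1 hcT hy₀ Filter.univ_mem
  obtain ⟨k, hk0, hk⟩ := hT.exists_active hyf
  obtain ⟨z, hzU, hzK, x₀, hxf, hxb, t, ht, e⟩ :=
    exists_entry_notMem hK.compact hK.convex hk0 hcK hx hU
  obtain ⟨i, hi0, hi⟩ := hK.exists_active hxf
  have hneg := inner_neg_of_mem_interior (hK.mem_normalCone hi) hi0 hzK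
  rw [e, add_sub_cancel_left, inner_smul_right] at hneg
  obtain ⟨q, p, h, hq0, hp0⟩ := exists_regularTrajectory hK hT hxf hxb (hK.mem_normalCone hi) hi0
    hyf hyb (hT.mem_normalCone hk) hk0 (by nlinarith)
  refine ⟨z, hzU, q, p, h, mem_iUnion.2 ⟨0, ?_⟩⟩
  obtain ⟨l, hl, el⟩ := h.exists_smul_normal (j := 0) (hp0.symm ▸ hT.mem_normalCone hk) hk0
  rw [zero_add] at el ⊢
  -- If the first bounce came before `z`, it would lie between a boundary point and an interior
  -- point, hence in the interior.
  have htl : t ≤ l := by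
    by_contra! hlt
    have h2 := hK.convex.combo_self_interior_mem_interior (hK.isClosed.frontier_subset hxf) hzK
      (a := 1 - l / t) (b := l / t) (by rw [sub_nonneg, div_le_one ht]; exact hlt.le)
      (by positivity) (by ring)
    apply (h.q_mem 1).2
    convert h2 using 1
    have e' : q 1 = x₀ + l • m k := by rw [← el, hq0]; abel
    have e₃ : l = l / t * t := by field_simp
    rw [e', e, smul_add, smul_smul, ← e₃, ← add_assoc, ← add_smul]; simp
  have e' : q 1 = x₀ + l • m k := by rw [← el, hq0]; abel
  rw [hq0, e', e, segment_eq_image']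
  refine ⟨t / l, ⟨by positivity, by rw [div_le_one hl]; exact htl⟩, ?_⟩
  simp only [add_sub_cancel_left, smul_smul]
  rw [div_mul_cancel₀ _ hl.ne']

end Existence

end Billiard

namespace Billiard

open Set
open scoped Pointwise

/-! ### Cycles and their action -/

/-- The action of a closed polygonal curve `q` and a closed polygonal curve `p`. -/
noncomputable def action (m : ℕ) (q p : ℕ → Plane) : ℝ :=
  ∑ j ∈ Finset.range m, inner ℝ (q (j + 1) - q j) (p j)

/-- A closed trajectory, without the requirements that its vertices are boundary points and that
they are genuine vertices. -/
structure IsCycle (K T : Set Plane) (m : ℕ) (q p : ℕ → Plane) : Prop where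
  pos : 0 < m
  q_mem : ∀ j, q j ∈ K
  p_mem : ∀ j, p j ∈ T
  q_periodic : ∀ j, q (j + m) = q j
  p_periodic : ∀ j, p (j + m) = p j
  q_step : ∀ j, q (j + 1) - q j ∈ normalCone T (p j)
  p_step : ∀ j, p j - p (j + 1) ∈ normalCone K (q (j + 1))
  nontrivial : ∃ j, q j ≠ q (j + 1)

theorem sum_range_shift_of_periodic {m : ℕ} {f : ℕ → ℝ} (hf : ∀ j, f (j + m) = f j) (k : ℕ) :
    ∑ j ∈ Finset.range m, f (j + k) = ∑ j ∈ Finset.range m, f j := by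
  induction k with
  | zero => rfl
  | succ k ih =>
    rw [← ih]
    have h1 := Finset.sum_range_succ (fun j => f (j + k)) m
    have h2 := Finset.sum_range_succ' (fun j => f (j + k)) m
    have h3 : f (m + k) = f (0 + k) := by rw [add_comm m, hf, zero_add]
    simp only [add_right_comm, ← add_assoc] at h2 ⊢
    linarith

/-- Summation by parts; it exhibits the symmetry of the action in `q` and `p`. -/
theorem action_eq_of_periodic {m : ℕ} {q p : ℕ → Plane} (hq : ∀ j, q (j + m) = q j)
    (hp : ∀ j, p (j + m) = p j) :
    action m q p = ∑ j ∈ Finset.range m, inner ℝ (q (j + 1)) (p j - p (j + 1)) := by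
  have h := sum_range_shift_of_periodic (m := m) (f := fun j => inner ℝ (q j) (p j))
    (fun j => by simp only [hq, hp]) 1
  simp only [action, inner_sub_left, inner_sub_right, Finset.sum_sub_distrib]
  rw [h]

/-- If every translate were interior, all `⟨w j, x⟩` would be non-positive and one negative, but
they add up to `⟨0, x⟩`. -/
theorem exists_add_notMem_interior {S : Set Plane} {m : ℕ} {w z : ℕ → Plane}
    (hw : ∀ j, w j ∈ normalCone S (z j)) (hsum : ∑ j ∈ Finset.range m, w j = 0) {j₀ : ℕ}
    (hj : j₀ < m) (hj0 : w j₀ ≠ 0) (x : Plane) : ∃ j, z j + x ∉ interior S := by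
  by_contra! h
  have h1 : ∑ j ∈ Finset.range m, inner ℝ (w j) x < ∑ j ∈ Finset.range m, (0 : ℝ) := by
    refine Finset.sum_lt_sum (fun j _ => ?_) ⟨j₀, Finset.mem_range.2 hj, ?_⟩
    · simpa using hw j _ (interior_subset (h j))
    · simpa using inner_neg_of_mem_interior (hw j₀) hj0 (h j₀)
  rw [← sum_inner, hsum] at h1
  simp at h1

theorem exists_lt_ne_of_periodic {m : ℕ} (hm : 0 < m) {q : ℕ → Plane} (hq : ∀ j, q (j + m) = q j)
    (h : ∃ j, q j ≠ q (j + 1)) : ∃ j < m, q j ≠ q (j + 1) := by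
  obtain ⟨j, hj⟩ := h
  have hper : Function.Periodic q m := hq
  refine ⟨j % m, Nat.mod_lt _ hm, ?_⟩
  have h1 : q (j % m) = q j := hper.map_mod_nat j
  have h2 : q (j % m + 1) = q (j + 1) := by
    rw [← hper.map_mod_nat (j % m + 1), ← hper.map_mod_nat (j + 1), Nat.mod_add_mod]
  rwa [h1, h2]

namespace IsCycle

variable {K T : Set Plane} {m : ℕ} {q p : ℕ → Plane}

theorem shift (h : IsCycle K T m q p) (k : ℕ) :
    IsCycle K T m (fun j => q (j + k)) (fun j => p (j + k)) where
  pos := h.pos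
  q_mem j := h.q_mem _
  p_mem j := h.p_mem _
  q_periodic j := by simpa only [add_right_comm] using h.q_periodic (j + k)
  p_periodic j := by simpa only [add_right_comm] using h.p_periodic (j + k)
  q_step j := by simpa only [add_right_comm] using h.q_step (j + k)
  p_step j := by simpa only [add_right_comm] using h.p_step (j + k)
  nontrivial := by
    by_contra! hc
    have hconst : ∀ j, q (j + k) = q k := by
      intro j
      induction j with
      | zero => rw [zero_add]
      | succ j ih => rw [← hc j, ih]
    obtain ⟨j, hj⟩ := h.nontrivial
    have hper : ∀ l i, q (i + l * m) = q i := by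
      intro l
      induction l with
      | zero => simp
      | succ l ih => intro i; rw [Nat.succ_mul, ← add_assoc, h.q_periodic, ih]
    have hall : ∀ i, q i = q k := by
      intro i
      -- Adding `k` periods moves any index past `k`, where the sequence is constant.
      have hk : k ≤ k * m := Nat.le_mul_of_pos_right _ h.pos
      rw [← hper k i, ← hconst (i + (k * m - k))]
      congr 1
      omega
    exact hj ((hall j).trans (hall (j + 1)).symm)

theorem action_shift (h : IsCycle K T m q p) (k : ℕ) :
    action m (fun j => q (j + k)) (fun j => p (j + k)) = action m q p := by
  have := sum_range_shift_of_periodic (m := m) (f := fun j => inner ℝ (q (j + 1) - q j) (p j))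
    (fun j => by simp only [h.q_periodic, h.p_periodic, add_right_comm j m 1]) k
  simpa only [action, add_right_comm] using this

theorem sum_step (h : IsCycle K T m q p) : ∑ j ∈ Finset.range m, (q (j + 1) - q j) = 0 := by
  rw [Finset.sum_range_sub, sub_eq_zero, ← h.q_periodic 0, zero_add]

theorem sum_dual_step (h : IsCycle K T m q p) :
    ∑ j ∈ Finset.range m, (p j - p (j + 1)) = 0 := by
  rw [Finset.sum_range_sub', sub_eq_zero, ← h.p_periodic 0, zero_add]

/-- With `p` constant, all steps of `q` would be normals at one point of `T`; as they sum to zero,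
that point could not be translated to an interior point. -/
theorem dual_nontrivial (h : IsCycle K T m q p) (hT : (interior T).Nonempty) :
    ∃ j, p j ≠ p (j + 1) := by
  by_contra! hc
  have hconst : ∀ j, p j = p 0 := fun j => by
    induction j with
    | zero => rfl
    | succ j ih => rw [← hc j, ih]
  obtain ⟨y, hy⟩ := hT
  obtain ⟨j₀, hj, hj0⟩ := exists_lt_ne_of_periodic h.pos h.q_periodic h.nontrivial
  obtain ⟨j, hj⟩ := exists_add_notMem_interior h.q_step h.sum_step hj
    (sub_ne_zero.2 hj0.symm) (y - p 0)
  rw [hconst, add_sub_cancel] at hj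
  exact hj hy

/-- A cycle cannot be translated into the interior of the table. -/
theorem exists_notMem_interior (h : IsCycle K T m q p) (hT : (interior T).Nonempty) (x : Plane) :
    ∃ j, q j + x ∉ interior K := by
  obtain ⟨j₀, hj, hj0⟩ := exists_lt_ne_of_periodic h.pos h.p_periodic (h.dual_nontrivial hT)
  obtain ⟨j, hj⟩ := exists_add_notMem_interior h.p_step h.sum_dual_step hj (sub_ne_zero.2 hj0) x
  exact ⟨j + 1, hj⟩

/-- The action of the part of a cycle between two indices is at least the action of the chord. -/
theorem inner_le_sum_Ico (h : IsCycle K T m q p) {w : Plane} (hw : w ∈ T) {a b : ℕ} (hab : a ≤ b) :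
    inner ℝ (q b - q a) w ≤ ∑ j ∈ Finset.Ico a b, inner ℝ (q (j + 1) - q j) (p j) := by
  rw [← Finset.sum_Ico_sub q hab, sum_inner]
  refine Finset.sum_le_sum fun j _ => ?_
  have := h.q_step j w hw
  rw [inner_sub_right] at this
  linarith

end IsCycle

/-! ### Reflection in the origin and duality -/

theorem mem_frontier_neg {K : Set Plane} {x : Plane} : x ∈ frontier (-K) ↔ -x ∈ frontier K := by
  have := (Homeomorph.neg Plane).preimage_frontier K
  have e : (Homeomorph.neg Plane) ⁻¹' K = -K := rfl
  rw [← e, ← this]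
  rfl

theorem mem_normalCone_neg {K : Set Plane} {x n : Plane} :
    n ∈ normalCone (-K) x ↔ -n ∈ normalCone K (-x) := by
  constructor
  · intro h y hy
    have := h (-y) (by simpa using hy)
    rw [inner_neg_left, ← inner_neg_right]
    convert this using 2
    abel
  · intro h y hy
    have := h (-y) hy
    rw [inner_neg_left, ← inner_neg_right] at this
    convert this using 2
    abel

theorem isSmoothPoint_neg {K : Set Plane} {x : Plane} :
    IsSmoothPoint (-K) x ↔ IsSmoothPoint K (-x) := by
  rw [isSmoothPoint_iff, isSmoothPoint_iff, mem_frontier_neg]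
  refine and_congr_right fun _ => ⟨?_, ?_⟩
  · rintro ⟨n, hn0, hn, hu⟩
    refine ⟨-n, neg_ne_zero.2 hn0, mem_normalCone_neg.1 hn, fun n' hn' => ?_⟩
    obtain ⟨r, hr, e⟩ := hu (-n') (mem_normalCone_neg.2 (by simpa using hn'))
    exact ⟨r, hr, by rw [smul_neg, ← e, neg_neg]⟩
  · rintro ⟨n, hn0, hn, hu⟩
    refine ⟨-n, neg_ne_zero.2 hn0, mem_normalCone_neg.2 (by simpa using hn), fun n' hn' => ?_⟩
    obtain ⟨r, hr, e⟩ := hu (-n') (mem_normalCone_neg.1 hn')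
    exact ⟨r, hr, by rw [smul_neg, ← e, neg_neg]⟩

/-- A regular trajectory in `(T, -K)` gives one in `(K, T)`. -/
theorem IsRegularTrajectory.of_dual {K T : Set Plane} {q p : ℕ → Plane}
    (h : IsRegularTrajectory T (-K) q p) :
    IsRegularTrajectory K T (fun j => -p j) (fun j => q (j + 1)) where
  q_mem j := mem_frontier_neg.1 (h.p_mem j)
  p_mem j := h.q_mem _
  ne j he := h.dual_step_ne_zero j (sub_eq_zero.2 (neg_injective he))
  not_between j := by
    rintro ⟨a, b, ha, hb, hab, e⟩
    -- The step `q (j + 2) - q (j + 1)` separates the two dual steps by sign, so they cannot have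
    -- the same direction.
    have h1 := h.inner_step_pos (j + 1)
    have h2 := h.inner_next_step_neg j
    have e' : a • (p j - p (j + 1)) = b • (p (j + 1) - p (j + 2)) := by
      have hp : p (j + 1) = a • p j + b • p (j + 2) := by
        rw [← neg_inj, ← e]; simp [smul_neg, add_comm]
      have hp2 : a • p (j + 1) + b • p (j + 1) = p (j + 1) := by rw [← add_smul, hab, one_smul]
      rw [smul_sub, smul_sub, sub_eq_sub_iff_add_eq_add, ← hp, add_comm (b • _), hp2]
    have e₂ := congrArg (fun z => inner ℝ (q (j + 2) - q (j + 1)) z) e'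
    simp only [inner_smul_right] at e₂
    rcases ha.eq_or_lt with h0 | ha
    · rw [← h0, zero_add] at hab
      rw [← h0, hab] at e₂
      linarith
    · have := mul_neg_of_pos_of_neg ha h2
      have := mul_nonneg hb h1.le
      linarith
  q_step j := by
    have := h.p_step j
    rwa [neg_sub, ← neg_sub_neg] at this
  p_step j := by
    have := mem_normalCone_neg.1 (h.q_step (j + 1))
    exact this
  q_smooth j := isSmoothPoint_neg.1 (h.p_smooth j)
  p_smooth j := h.q_smooth _

/-- The index shift reflects that the dual step from `p j` to `p (j + 1)` is governed by the bounce
at `q (j + 1)`. -/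
theorem IsCycle.of_dual {K T : Set Plane} {m : ℕ} {q p : ℕ → Plane} (h : IsCycle T (-K) m q p)
    (hK : (interior (-K)).Nonempty) :
    IsCycle K T m (fun j => -p j) (fun j => q (j + 1)) where
  pos := h.pos
  q_mem j := h.p_mem j
  p_mem j := h.q_mem _
  q_periodic j := by simp only [h.p_periodic]
  p_periodic j := by simpa only [add_right_comm] using h.q_periodic (j + 1)
  q_step j := by simpa only [neg_sub_neg] using h.p_step j
  p_step j := by
    have := mem_normalCone_neg.1 (h.q_step (j + 1))
    rwa [neg_sub] at this
  nontrivial := by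
    obtain ⟨j, hj⟩ := h.dual_nontrivial hK
    exact ⟨j, fun he => hj (neg_injective he)⟩

theorem action_of_dual {m : ℕ} {q p : ℕ → Plane}
    (hq : ∀ j, q (j + m) = q j) (hp : ∀ j, p (j + m) = p j) :
    action m (fun j => -p j) (fun j => q (j + 1)) = action m q p := by
  rw [action_eq_of_periodic hq hp]
  refine Finset.sum_congr rfl fun j _ => ?_
  rw [neg_sub_neg, real_inner_comm]

/-! ### Pairs all of whose regular trajectories are closed and minimizing -/

/-- All regular trajectories in `(K, T)` are closed with exactly four vertices and have action `L`,
and no cycle has a smaller action. -/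
structure IsZoll (K T : Set Plane) (L : ℝ) : Prop where
  q_periodic : ∀ q p, IsRegularTrajectory K T q p → ∀ j, q (j + 4) = q j
  p_periodic : ∀ q p, IsRegularTrajectory K T q p → ∀ j, p (j + 4) = p j
  q_not_periodic : ∀ q p, IsRegularTrajectory K T q p → ∃ j, q (j + 2) ≠ q j
  p_not_periodic : ∀ q p, IsRegularTrajectory K T q p → ∃ j, p (j + 2) ≠ p j
  action_eq : ∀ q p, IsRegularTrajectory K T q p → action 4 q p = L
  le_action : ∀ m q p, IsCycle K T m q p → L ≤ action m q p

/-- Because of the index shift, duality gives the period of `q` only from index one on;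
`eq_of_succ_eq` recovers index zero. -/
theorem IsZoll.dual {K T : Set Plane} {L : ℝ} (h : IsZoll K T L) (hT : IsClosed T)
    (hKi : (interior K).Nonempty) : IsZoll T (-K) L := by
  have hqp : ∀ q p, IsRegularTrajectory T (-K) q p → ∀ j, p (j + 4) = p j := fun q p hr j =>
    neg_injective (h.q_periodic _ _ hr.of_dual j)
  have hqq : ∀ q p, IsRegularTrajectory T (-K) q p → ∀ j, q (j + 4) = q j := fun q p hr j =>
    hr.eq_of_succ_eq hT (by simpa [add_right_comm] using h.p_periodic _ _ hr.of_dual j)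
      (hqp q p hr j)
  have hint : (interior (-K)).Nonempty := by
    obtain ⟨x, hx⟩ := hKi
    refine ⟨-x, ?_⟩
    have := (Homeomorph.neg Plane).preimage_interior K
    have e : (Homeomorph.neg Plane) ⁻¹' K = -K := rfl
    rw [← e, ← this]
    simpa using hx
  refine ⟨hqq, hqp, fun q p hr => ?_, fun q p hr => ?_, fun q p hr => ?_, fun m q p hc => ?_⟩
  · obtain ⟨j, hj⟩ := h.p_not_periodic _ _ hr.of_dual
    exact ⟨j + 1, by simpa only [add_right_comm] using hj⟩
  · obtain ⟨j, hj⟩ := h.q_not_periodic _ _ hr.of_dual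
    exact ⟨j, fun he => hj (by simp only [he])⟩
  · rw [← h.action_eq _ _ hr.of_dual, action_of_dual (hqq q p hr) (hqp q p hr)]
  · rw [← action_of_dual hc.q_periodic hc.p_periodic]
    exact h.le_action _ _ _ (hc.of_dual hint)

theorem supportFn_eq {T : Set Plane} {x y : Plane} (hy : y ∈ T) (hx : x ∈ normalCone T y) :
    supportFn T x = inner ℝ x y := by
  refine IsGreatest.csSup_eq ⟨⟨y, hy, rfl⟩, ?_⟩
  rintro _ ⟨z, hz, rfl⟩
  have := hx z hz
  rw [inner_sub_right] at this
  simpa using this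

theorem IsTrajectory.ellLength_eq {K T : Set Plane} {q p : ℕ → Plane} (h : IsTrajectory K T q p)
    (hT : IsClosed T) (m : ℕ) : ellLength T m q = action m q p :=
  Finset.sum_congr rfl fun j _ =>
    supportFn_eq (mem_of_mem_frontier hT (h.p_mem j)) (h.q_step j)

theorem IsClosedTrajectory.isCycle {K T : Set Plane} {m : ℕ} {q p : ℕ → Plane}
    (h : IsClosedTrajectory K T m q p) (hK : IsClosed K) (hT : IsClosed T) :
    IsCycle K T m q p where
  pos := by have := h.two_le; omega
  q_mem j := mem_of_mem_frontier hK (h.q_mem j)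
  p_mem j := mem_of_mem_frontier hT (h.p_mem j)
  q_periodic := h.q_periodic
  p_periodic := h.p_periodic
  q_step := h.q_step
  p_step j := by have := h.p_step j; rwa [neg_sub] at this
  nontrivial := ⟨0, h.ne 0⟩

theorem not_periodic_of_lt_four {q : ℕ → Plane} (h4 : ∀ j, q (j + 4) = q j)
    (h2 : ∃ j, q (j + 2) ≠ q j) {m : ℕ} (hm : 0 < m) (hm4 : m < 4) : ¬ ∀ j, q (j + m) = q j := by
  intro h
  obtain ⟨j, hj⟩ := h2
  -- A period `m` gives the period `2 * m`; for `m = 1` this is two, and for `m = 3` it is six, that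
  -- is, two modulo four.
  have h22 : ∀ i, q (i + m + m) = q i := fun i => by rw [h, h]
  interval_cases m
  · exact hj (h22 j)
  · exact hj (h j)
  · apply hj
    rw [← h22 j, ← h4 (j + 2)]

theorem IsZoll.closed_and_minimizing {K T : Set Plane} {L : ℝ} (h : IsZoll K T L)
    (hK : IsClosed K) (hT : IsClosed T) {q p : ℕ → Plane} (hr : IsRegularTrajectory K T q p) :
    IsClosedTrajectory K T 4 q p ∧ (∀ m : ℕ, 0 < m → m < 4 → ¬ ∀ j, q (j + m) = q j) ∧
      IsMinimizer K T 4 q p := by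
  have hc : IsClosedTrajectory K T 4 q p :=
    { hr.toIsTrajectory with
      two_le := by norm_num
      q_periodic := h.q_periodic q p hr
      p_periodic := h.p_periodic q p hr }
  refine ⟨hc, fun m hm hm4 => not_periodic_of_lt_four (h.q_periodic q p hr)
    (h.q_not_periodic q p hr) hm hm4, hc, fun m' q' p' hc' => ?_⟩
  rw [hr.ellLength_eq hT, hc'.ellLength_eq hT, h.action_eq q p hr]
  exact h.le_action _ _ _ (hc'.isCycle hK hT)

theorem IsPolygon.neg {ι : Type} {n : ι → Plane} {c : ι → ℝ} {K : Set Plane}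
    (h : IsPolygon n c K) : IsPolygon (fun i => -n i) c (-K) where
  eq := by
    ext x
    simp only [Set.mem_neg, h.mem_iff, mem_ofPred_eq, inner_neg_left, inner_neg_right]
  compact := h.compact.neg
  nonempty := by
    obtain ⟨x, hx⟩ := h.nonempty
    refine ⟨-x, ?_⟩
    have := (Homeomorph.neg Plane).preimage_interior K
    have e : (Homeomorph.neg Plane) ⁻¹' K = -K := rfl
    rw [← e, ← this]
    simpa using hx

/-- The regular trajectories in `(T, -K)` are dense in `T`, and each of them is, up to a shift, a
dual trajectory in `(K, T)`. -/
theorem IsZoll.closure_dual_path_eq {ι κ : Type} [Finite ι] [Finite κ] {n : ι → Plane}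
    {c : ι → ℝ} {m : κ → Plane} {d : κ → ℝ} {K T : Set Plane} {L : ℝ} (h : IsZoll K T L)
    (hK : IsPolygon n c K) (hT : IsPolygon m d T) :
    closure {y : Plane | ∃ q p : ℕ → Plane, IsRegularTrajectory K T q p ∧ y ∈ path p} = T := by
  refine Subset.antisymm (hT.isClosed.closure_subset_iff.2 ?_) ?_
  · rintro x ⟨q, p, h, hx⟩
    exact path_subset hT.isClosed hT.convex h.p_mem hx
  have h1 := closure_path_eq hT hK.neg
  conv_lhs => rw [← h1]
  refine closure_mono ?_
  rintro y ⟨q, p, hr, hy⟩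
  obtain ⟨j, hj⟩ := mem_iUnion.1 hy
  -- The dual trajectory begins at `q 1`; its segment number `j + 3` is segment `j + 4` of `q`,
  -- which equals segment `j` by periodicity.
  refine ⟨_, _, hr.of_dual, mem_iUnion.2 ⟨j + 3, ?_⟩⟩
  have hper := (h.dual hT.isClosed hK.nonempty).q_periodic _ _ hr
  have e1 := hper j
  have e2 := hper (j + 1)
  change y ∈ segment ℝ (q (j + 4)) (q (j + 1 + 4))
  rwa [e1, e2]

theorem IsZoll.conclusion {ι κ : Type} [Finite ι] [Finite κ] {n : ι → Plane}
    {c : ι → ℝ} {m : κ → Plane} {d : κ → ℝ} {K T : Set Plane} {L : ℝ} (h : IsZoll K T L)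
    (hK : IsPolygon n c K) (hT : IsPolygon m d T) :
    (∀ q p : ℕ → Plane, IsRegularTrajectory K T q p →
      IsClosedTrajectory K T 4 q p ∧
      (∀ m : ℕ, 0 < m → m < 4 → ¬ ∀ j, q (j + m) = q j) ∧
      IsMinimizer K T 4 q p) ∧
    closure {x : Plane | ∃ q p : ℕ → Plane,
      IsRegularTrajectory K T q p ∧ x ∈ path q} = K ∧
    closure {y : Plane | ∃ q p : ℕ → Plane,
      IsRegularTrajectory K T q p ∧ y ∈ path p} = T :=
  ⟨fun _ _ hr => h.closed_and_minimizing hK.isClosed hT.isClosed hr, closure_path_eq hK hT,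
    h.closure_dual_path_eq hK hT⟩

/-! ### Linear changes of coordinates -/

section Transport

variable {φ ψ : Plane ≃ₗ[ℝ] Plane} {c v : Plane} {r : ℝ} {K T : Set Plane}

/-- The affine homeomorphism `x ↦ φ x + c`. -/
noncomputable def affineHomeo (φ : Plane ≃ₗ[ℝ] Plane) (c : Plane) : Plane ≃ₜ Plane :=
  φ.toContinuousLinearEquiv.toHomeomorph.trans (Homeomorph.addRight c)

theorem affineHomeo_apply (φ : Plane ≃ₗ[ℝ] Plane) (c x : Plane) :
    affineHomeo φ c x = φ x + c := rfl

theorem affineHomeo_sub (φ : Plane ≃ₗ[ℝ] Plane) (c x y : Plane) :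
    affineHomeo φ c x - affineHomeo φ c y = φ (x - y) := by
  simp [affineHomeo_apply]

theorem mem_image_affineHomeo {x : Plane} : affineHomeo φ c x ∈ affineHomeo φ c '' K ↔ x ∈ K :=
  (affineHomeo φ c).injective.mem_set_image

theorem mem_frontier_image_affineHomeo {x : Plane} :
    affineHomeo φ c x ∈ frontier (affineHomeo φ c '' K) ↔ x ∈ frontier K := by
  rw [← (affineHomeo φ c).image_frontier, mem_image_affineHomeo]

/-- The hypothesis makes `ψ` equal to `r` times the inverse transpose of `φ`, which is how normals
transform when points transform by `φ`. -/
theorem mem_normalCone_image (hr : 0 < r)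
    (h : ∀ x y, inner ℝ (φ x) (ψ y) = r * inner ℝ x y) {x n : Plane} :
    ψ n ∈ normalCone (affineHomeo φ c '' K) (affineHomeo φ c x) ↔ n ∈ normalCone K x := by
  have key : ∀ y, inner ℝ (ψ n) (affineHomeo φ c y - affineHomeo φ c x) =
      r * inner ℝ n (y - x) := fun y => by
    rw [affineHomeo_sub, real_inner_comm, h, real_inner_comm]
  constructor
  · intro hn y hy
    have := hn _ (mem_image_of_mem _ hy)
    rw [key] at this
    exact nonpos_of_mul_nonpos_right this hr
  · rintro hn _ ⟨y, hy, rfl⟩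
    rw [key]
    exact mul_nonpos_of_nonneg_of_nonpos hr.le (hn y hy)

theorem isSmoothPoint_image (hr : 0 < r)
    (h : ∀ x y, inner ℝ (φ x) (ψ y) = r * inner ℝ x y) {x : Plane} :
    IsSmoothPoint (affineHomeo φ c '' K) (affineHomeo φ c x) ↔ IsSmoothPoint K x := by
  rw [isSmoothPoint_iff, isSmoothPoint_iff, mem_frontier_image_affineHomeo]
  refine and_congr_right fun _ => ⟨?_, ?_⟩
  · rintro ⟨n, hn0, hn, hu⟩
    obtain ⟨n, rfl⟩ := ψ.surjective n
    refine ⟨n, by simpa using hn0, (mem_normalCone_image hr h).1 hn, fun n' hn' => ?_⟩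
    obtain ⟨s, hs, e⟩ := hu (ψ n') ((mem_normalCone_image hr h).2 hn')
    exact ⟨s, hs, ψ.injective (by rw [e, map_smul])⟩
  · rintro ⟨n, hn0, hn, hu⟩
    refine ⟨ψ n, by simpa using hn0, (mem_normalCone_image hr h).2 hn, fun n' hn' => ?_⟩
    obtain ⟨n', rfl⟩ := ψ.surjective n'
    obtain ⟨s, hs, e⟩ := hu n' ((mem_normalCone_image hr h).1 hn')
    exact ⟨s, hs, by rw [e, map_smul]⟩

theorem mem_segment_image {x y z : Plane} :
    affineHomeo φ c x ∈ segment ℝ (affineHomeo φ c y) (affineHomeo φ c z) ↔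
      x ∈ segment ℝ y z := by
  have key : ∀ a b : ℝ, a + b = 1 → a • affineHomeo φ c y + b • affineHomeo φ c z =
      affineHomeo φ c (a • y + b • z) := by
    intro a b hab
    simp only [affineHomeo_apply, map_add, map_smul, smul_add]
    have : c = a • c + b • c := by rw [← add_smul, hab, one_smul]
    conv_rhs => rw [this]
    abel
  constructor
  · rintro ⟨a, b, ha, hb, hab, e⟩
    rw [key a b hab] at e
    exact ⟨a, b, ha, hb, hab, (affineHomeo φ c).injective e⟩
  · rintro ⟨a, b, ha, hb, hab, e⟩
    exact ⟨a, b, ha, hb, hab, by rw [key a b hab, e]⟩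

theorem isRegularTrajectory_of_image (hr : 0 < r)
    (h : ∀ x y, inner ℝ (φ x) (ψ y) = r * inner ℝ x y) {q p : ℕ → Plane}
    (hR : IsRegularTrajectory (affineHomeo φ c '' K) (affineHomeo ψ v '' T)
      (fun j => affineHomeo φ c (q j)) (fun j => affineHomeo ψ v (p j))) :
    IsRegularTrajectory K T q p := by
  have h' : ∀ x y, inner ℝ (ψ x) (φ y) = r * inner ℝ x y := fun x y => by
    rw [real_inner_comm, h, real_inner_comm]
  exact
  { q_mem := fun j => mem_frontier_image_affineHomeo.1 (hR.q_mem j)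
    p_mem := fun j => mem_frontier_image_affineHomeo.1 (hR.p_mem j)
    ne := fun j he => hR.ne j (by simp only [he])
    not_between := fun j he => hR.not_between j (mem_segment_image.2 he)
    q_step := fun j => (mem_normalCone_image hr h').1 (by
      have := hR.q_step j; rwa [affineHomeo_sub] at this)
    p_step := fun j => (mem_normalCone_image hr h).1 (by
      have := hR.p_step j; rwa [affineHomeo_sub, ← map_neg] at this)
    q_smooth := fun j => (isSmoothPoint_image hr h).1 (hR.q_smooth j)
    p_smooth := fun j => (isSmoothPoint_image hr h').1 (hR.p_smooth j) }

theorem isCycle_of_image (hr : 0 < r)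
    (h : ∀ x y, inner ℝ (φ x) (ψ y) = r * inner ℝ x y) {m : ℕ} {q p : ℕ → Plane}
    (hC : IsCycle (affineHomeo φ c '' K) (affineHomeo ψ v '' T) m
      (fun j => affineHomeo φ c (q j)) (fun j => affineHomeo ψ v (p j))) :
    IsCycle K T m q p := by
  have h' : ∀ x y, inner ℝ (ψ x) (φ y) = r * inner ℝ x y := fun x y => by
    rw [real_inner_comm, h, real_inner_comm]
  exact
  { pos := hC.pos
    q_mem := fun j => mem_image_affineHomeo.1 (hC.q_mem j)
    p_mem := fun j => mem_image_affineHomeo.1 (hC.p_mem j)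
    q_periodic := fun j => (affineHomeo φ c).injective (hC.q_periodic j)
    p_periodic := fun j => (affineHomeo ψ v).injective (hC.p_periodic j)
    q_step := fun j => (mem_normalCone_image hr h').1 (by
      have := hC.q_step j; rwa [affineHomeo_sub] at this)
    p_step := fun j => (mem_normalCone_image hr h).1 (by
      have := hC.p_step j; rwa [affineHomeo_sub] at this)
    nontrivial := by
      obtain ⟨j, hj⟩ := hC.nontrivial
      exact ⟨j, fun he => hj (by simp only [he])⟩ }

/-- The translation of the dual points contributes nothing, since the steps of a closed curve sum to
zero. -/
theorem action_image (h : ∀ x y, inner ℝ (φ x) (ψ y) = r * inner ℝ x y) {m : ℕ} {q p : ℕ → Plane}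
    (hq : ∀ j, q (j + m) = q j) :
    action m (fun j => affineHomeo φ c (q j)) (fun j => affineHomeo ψ v (p j)) =
      r * action m q p := by
  have hsum : ∑ j ∈ Finset.range m, (q (j + 1) - q j) = 0 := by
    rw [Finset.sum_range_sub, sub_eq_zero, ← hq 0, zero_add]
  simp only [action, affineHomeo_sub, affineHomeo_apply ψ, inner_add_right, h,
    Finset.sum_add_distrib, ← Finset.mul_sum]
  rw [← sum_inner, ← map_sum, hsum]
  simp

/-- Transport of `IsZoll` by a pair of affine maps. -/
theorem IsZoll.image {L : ℝ} (hZ : IsZoll K T L) (hr : 0 < r)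
    (h : ∀ x y, inner ℝ (φ x) (ψ y) = r * inner ℝ x y) :
    IsZoll (affineHomeo φ c '' K) (affineHomeo ψ v '' T) (r * L) := by
  have lift : ∀ (φ : Plane ≃ₗ[ℝ] Plane) (c : Plane) (q : ℕ → Plane),
      ∃ q' : ℕ → Plane, q = fun j => affineHomeo φ c (q' j) :=
    fun φ c q => ⟨fun j => (affineHomeo φ c).symm (q j), by simp⟩
  refine ⟨fun q p hR j => ?_, fun q p hR j => ?_, fun q p hR => ?_, fun q p hR => ?_,
    fun q p hR => ?_, fun m q p hC => ?_⟩ <;>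
  obtain ⟨q, rfl⟩ := lift φ c q <;> obtain ⟨p, rfl⟩ := lift ψ v p
  · have := isRegularTrajectory_of_image hr h hR
    simp only [hZ.q_periodic q p this j]
  · have := isRegularTrajectory_of_image hr h hR
    simp only [hZ.p_periodic q p this j]
  · obtain ⟨j, hj⟩ := hZ.q_not_periodic q p (isRegularTrajectory_of_image hr h hR)
    exact ⟨j, fun he => hj ((affineHomeo φ c).injective he)⟩
  · obtain ⟨j, hj⟩ := hZ.p_not_periodic q p (isRegularTrajectory_of_image hr h hR)
    exact ⟨j, fun he => hj ((affineHomeo ψ v).injective he)⟩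
  · have := isRegularTrajectory_of_image hr h hR
    rw [action_image h (hZ.q_periodic q p this), hZ.action_eq q p this]
  · have := isCycle_of_image hr h hC
    rw [action_image h this.q_periodic]
    exact mul_le_mul_of_nonneg_left (hZ.le_action m q p this) hr.le

theorem IsPolygon.image {ι : Type} {n : ι → Plane} {d : ι → ℝ} (hK : IsPolygon n d K)
    (φ : Plane ≃ₗ[ℝ] Plane) (c : Plane) :
    ∃ (n' : ι → Plane) (d' : ι → ℝ), IsPolygon n' d' (affineHomeo φ c '' K) := by
  refine ⟨fun i => LinearMap.adjoint (φ.symm : Plane →ₗ[ℝ] Plane) (n i),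
    fun i => d i + inner ℝ (n i) (φ.symm c), ?_, hK.compact.image (affineHomeo φ c).continuous, ?_⟩
  · ext x
    obtain ⟨x, rfl⟩ := (affineHomeo φ c).surjective x
    rw [mem_image_affineHomeo, hK.mem_iff]
    refine forall_congr' fun i => ?_
    rw [LinearMap.adjoint_inner_left, affineHomeo_apply]
    simp [inner_add_right]
  · rw [← (affineHomeo φ c).image_interior]
    exact hK.nonempty.image _

end Transport

end Billiard

namespace Billiard

open Set

/-! ### Orbits in the unit square, in coordinates -/

/-- The coordinates `(x, y)` of a trajectory in the unit square and `(ξ, η)` of its dual trajectory,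
whose points are corners of the rectangle
`[a - a w, a + (1 - a) w] × [b w, 1 - (1 - b) w]` inscribed in the diamond with parameters `a, b`. -/
structure SqOrbit (a b w : ℝ) (x y ξ η : ℕ → ℝ) : Prop where
  a_mem : 0 ≤ a ∧ a ≤ 1
  b_mem : 0 ≤ b ∧ b ≤ 1
  w_mem : 0 < w ∧ w < 1
  side : ∀ j, (x j = 1 ∧ 0 < y j ∧ y j < 1 ∧ ξ j = a - a * w) ∨
    (x j = 0 ∧ 0 < y j ∧ y j < 1 ∧ ξ j = a + (1 - a) * w) ∨
    (y j = 1 ∧ 0 < x j ∧ x j < 1 ∧ η j = b * w) ∨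
    (y j = 0 ∧ 0 < x j ∧ x j < 1 ∧ η j = 1 - (1 - b) * w)
  step : ∀ j, ∃ l : ℝ, 0 < l ∧
    ((ξ j = a + (1 - a) * w ∧ η j = b * w ∧
        x (j + 1) = x j + l * b ∧ y (j + 1) = y j - l * (1 - a)) ∨
      (ξ j = a + (1 - a) * w ∧ η j = 1 - (1 - b) * w ∧
        x (j + 1) = x j + l * (1 - b) ∧ y (j + 1) = y j + l * (1 - a)) ∨
      (ξ j = a - a * w ∧ η j = 1 - (1 - b) * w ∧
        x (j + 1) = x j - l * (1 - b) ∧ y (j + 1) = y j + l * a) ∨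
      (ξ j = a - a * w ∧ η j = b * w ∧
        x (j + 1) = x j - l * b ∧ y (j + 1) = y j - l * a))
  right : ∀ j, x (j + 1) = 1 → ξ j = a + (1 - a) * w ∧ η (j + 1) = η j
  left : ∀ j, x (j + 1) = 0 → ξ j = a - a * w ∧ η (j + 1) = η j
  top : ∀ j, y (j + 1) = 1 → η j = 1 - (1 - b) * w ∧ ξ (j + 1) = ξ j
  bottom : ∀ j, y (j + 1) = 0 → η j = b * w ∧ ξ (j + 1) = ξ j

/-- An orbit is closed after four steps but not after two, and has action one. -/
structure SqClosed (x y ξ η : ℕ → ℝ) : Prop where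
  x_eq : x 4 = x 0
  y_eq : y 4 = y 0
  ξ_eq : ξ 4 = ξ 0
  η_eq : η 4 = η 0
  q_ne : x 2 ≠ x 0 ∨ y 2 ≠ y 0
  p_ne : (ξ 2 ≠ ξ 0 ∨ η 2 ≠ η 0) ∨ (ξ 3 ≠ ξ 1 ∨ η 3 ≠ η 1)
  action_eq : (x 1 - x 0) * ξ 0 + (y 1 - y 0) * η 0 + ((x 2 - x 1) * ξ 1 + (y 2 - y 1) * η 1) +
    ((x 3 - x 2) * ξ 2 + (y 3 - y 2) * η 2) + ((x 4 - x 3) * ξ 3 + (y 4 - y 3) * η 3) = 1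

variable {a b w : ℝ} {x y ξ η : ℕ → ℝ}

/-- Reflection in the vertical midline. Together with `swap` it generates the symmetries that reduce
the closing argument to orbits leaving the left side downwards. -/
theorem SqOrbit.flip (h : SqOrbit a b w x y ξ η) :
    SqOrbit (1 - a) b w (fun j => 1 - x j) y (fun j => 1 - ξ j) η where
  a_mem := ⟨by linarith [h.a_mem.2], by linarith [h.a_mem.1]⟩
  b_mem := h.b_mem
  w_mem := h.w_mem
  side j := by
    rcases h.side j with ⟨h1, h2, h3, h4⟩ | ⟨h1, h2, h3, h4⟩ | ⟨h1, h2, h3, h4⟩ | ⟨h1, h2, h3, h4⟩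
    · exact Or.inr (Or.inl ⟨by linarith, h2, h3, by linarith⟩)
    · exact Or.inl ⟨by linarith, h2, h3, by linarith⟩
    · exact Or.inr (Or.inr (Or.inl ⟨h1, by linarith, by linarith, h4⟩))
    · exact Or.inr (Or.inr (Or.inr ⟨h1, by linarith, by linarith, h4⟩))
  step j := by
    obtain ⟨l, hl, h⟩ := h.step j
    refine ⟨l, hl, ?_⟩
    rcases h with ⟨h1, h2, h3, h4⟩ | ⟨h1, h2, h3, h4⟩ | ⟨h1, h2, h3, h4⟩ | ⟨h1, h2, h3, h4⟩
    · exact Or.inr (Or.inr (Or.inr ⟨by linarith, h2, by linarith, by linarith⟩))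
    · exact Or.inr (Or.inr (Or.inl ⟨by linarith, h2, by linarith, by linarith⟩))
    · exact Or.inr (Or.inl ⟨by linarith, h2, by linarith, by linarith⟩)
    · exact Or.inl ⟨by linarith, h2, by linarith, by linarith⟩
  right j hj := by
    obtain ⟨h1, h2⟩ := h.left j (by linarith)
    exact ⟨by linarith, h2⟩
  left j hj := by
    obtain ⟨h1, h2⟩ := h.right j (by linarith)
    exact ⟨by linarith, h2⟩
  top j hj := by
    obtain ⟨h1, h2⟩ := h.top j hj
    exact ⟨h1, by linarith⟩
  bottom j hj := by
    obtain ⟨h1, h2⟩ := h.bottom j hj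
    exact ⟨h1, by linarith⟩

/-- The inscribed rectangle has width `w` and height `1 - w`, so exchanging the axes exchanges these
numbers. -/
theorem SqOrbit.swap (h : SqOrbit a b w x y ξ η) : SqOrbit b a (1 - w) y x η ξ where
  a_mem := h.b_mem
  b_mem := h.a_mem
  w_mem := ⟨by linarith [h.w_mem.2], by linarith [h.w_mem.1]⟩
  side j := by
    rcases h.side j with ⟨h1, h2, h3, h4⟩ | ⟨h1, h2, h3, h4⟩ | ⟨h1, h2, h3, h4⟩ | ⟨h1, h2, h3, h4⟩
    · exact Or.inr (Or.inr (Or.inl ⟨h1, h2, h3, by linarith⟩))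
    · exact Or.inr (Or.inr (Or.inr ⟨h1, h2, h3, by linarith⟩))
    · exact Or.inl ⟨h1, h2, h3, by linarith⟩
    · exact Or.inr (Or.inl ⟨h1, h2, h3, by linarith⟩)
  step j := by
    obtain ⟨l, hl, h⟩ := h.step j
    refine ⟨l, hl, ?_⟩
    rcases h with ⟨h1, h2, h3, h4⟩ | ⟨h1, h2, h3, h4⟩ | ⟨h1, h2, h3, h4⟩ | ⟨h1, h2, h3, h4⟩
    · exact Or.inr (Or.inr (Or.inl ⟨by linarith, by linarith, h4, h3⟩))
    · exact Or.inr (Or.inl ⟨by linarith, by linarith, h4, h3⟩)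
    · exact Or.inl ⟨by linarith, by linarith, h4, h3⟩
    · exact Or.inr (Or.inr (Or.inr ⟨by linarith, by linarith, h4, h3⟩))
  right j hj := by
    obtain ⟨h1, h2⟩ := h.top j hj
    exact ⟨by linarith, h2⟩
  left j hj := by
    obtain ⟨h1, h2⟩ := h.bottom j hj
    exact ⟨by linarith, h2⟩
  top j hj := by
    obtain ⟨h1, h2⟩ := h.right j hj
    exact ⟨by linarith, h2⟩
  bottom j hj := by
    obtain ⟨h1, h2⟩ := h.left j hj
    exact ⟨by linarith, h2⟩

theorem SqClosed.swap (h : SqClosed x y ξ η) : SqClosed y x η ξ where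
  x_eq := h.y_eq
  y_eq := h.x_eq
  ξ_eq := h.η_eq
  η_eq := h.ξ_eq
  q_ne := h.q_ne.symm
  p_ne := h.p_ne.imp Or.symm Or.symm
  action_eq := by linarith [h.action_eq]

theorem SqClosed.of_flip (h : SqClosed (fun j => 1 - x j) y (fun j => 1 - ξ j) η) :
    SqClosed x y ξ η where
  x_eq := by linarith [h.x_eq]
  y_eq := h.y_eq
  ξ_eq := by linarith [h.ξ_eq]
  η_eq := h.η_eq
  q_ne := h.q_ne.imp_left fun h1 h2 => h1 (by rw [h2])
  p_ne := h.p_ne.imp (Or.imp_left fun h1 h2 => h1 (by rw [h2]))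
    (Or.imp_left fun h1 h2 => h1 (by rw [h2]))
  action_eq := by
    have h1 := h.action_eq
    have h2 := h.x_eq
    linarith

/-- The current corner excludes an arrival at the left or top side. The side that is reached fixes
one new dual coordinate, and the bounce keeps the other. The remaining three corners follow by
symmetry. -/
theorem SqOrbit.next_right_down (h : SqOrbit a b w x y ξ η) {j k : ℕ} (hk : j + 1 = k) (hξ : ξ j = a + (1 - a) * w)
    (hη : η j = b * w) : ∃ l : ℝ, 0 < l ∧ x k = x j + l * b ∧
      y k = y j - l * (1 - a) ∧
      ((x k = 1 ∧ 0 < y k ∧ y k < 1 ∧ ξ k = a - a * w ∧ η k = b * w) ∨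
      (y k = 0 ∧ 0 < x k ∧ x k < 1 ∧ ξ k = a + (1 - a) * w ∧
        η k = 1 - (1 - b) * w)) := by
  subst hk
  have hw := h.w_mem
  have hs : ∃ l : ℝ, 0 < l ∧ x (j + 1) = x j + l * b ∧ y (j + 1) = y j - l * (1 - a) := by
    obtain ⟨l, hl, ⟨h1, h2, h3, h4⟩ | ⟨h1, h2, h3, h4⟩ | ⟨h1, h2, h3, h4⟩ | ⟨h1, h2, h3, h4⟩⟩ :=
      h.step j
    · exact ⟨l, hl, h3, h4⟩
    all_goals exfalso; linarith
  obtain ⟨l, hl, hx, hy⟩ := hs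
  refine ⟨l, hl, hx, hy, ?_⟩
  rcases h.side (j + 1) with ⟨h1, h2, h3, h4⟩ | ⟨h1, h2, h3, h4⟩ | ⟨h1, h2, h3, h4⟩ | ⟨h1, h2, h3, h4⟩
  · exact Or.inl ⟨h1, h2, h3, h4, (h.right j h1).2.trans hη⟩
  · exfalso; linarith [(h.left j h1).1]
  · exfalso; linarith [(h.top j h1).1]
  · exact Or.inr ⟨h1, h2, h3, (h.bottom j h1).2.trans hξ, h4⟩

theorem SqOrbit.next_right_up (h : SqOrbit a b w x y ξ η) {j k : ℕ} (hk : j + 1 = k) (hξ : ξ j = a + (1 - a) * w)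
    (hη : η j = 1 - (1 - b) * w) : ∃ l : ℝ, 0 < l ∧ x k = x j + l * (1 - b) ∧
      y k = y j + l * (1 - a) ∧
      ((x k = 1 ∧ 0 < y k ∧ y k < 1 ∧ ξ k = a - a * w ∧
        η k = 1 - (1 - b) * w) ∨
      (y k = 1 ∧ 0 < x k ∧ x k < 1 ∧ ξ k = a + (1 - a) * w ∧
        η k = b * w)) := by
  subst hk
  obtain ⟨l, hl, h1, h2, h3⟩ := h.swap.flip.swap.next_right_down rfl (by linarith) (by linarith)
  refine ⟨l, hl, by linarith, by linarith, ?_⟩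
  rcases h3 with ⟨h3, h4, h5, h6, h7⟩ | ⟨h3, h4, h5, h6, h7⟩
  · exact Or.inl ⟨h3, by linarith, by linarith, by linarith, by linarith⟩
  · exact Or.inr ⟨by linarith, h4, h5, by linarith, by linarith⟩

theorem SqOrbit.next_left_up (h : SqOrbit a b w x y ξ η) {j k : ℕ} (hk : j + 1 = k) (hξ : ξ j = a - a * w)
    (hη : η j = 1 - (1 - b) * w) : ∃ l : ℝ, 0 < l ∧ x k = x j - l * (1 - b) ∧
      y k = y j + l * a ∧
      ((x k = 0 ∧ 0 < y k ∧ y k < 1 ∧ ξ k = a + (1 - a) * w ∧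
        η k = 1 - (1 - b) * w) ∨
      (y k = 1 ∧ 0 < x k ∧ x k < 1 ∧ ξ k = a - a * w ∧
        η k = b * w)) := by
  subst hk
  obtain ⟨l, hl, h1, h2, h3⟩ := h.flip.next_right_up rfl (by linarith) (by linarith)
  refine ⟨l, hl, by linarith, by linarith, ?_⟩
  rcases h3 with ⟨h3, h4, h5, h6, h7⟩ | ⟨h3, h4, h5, h6, h7⟩
  · exact Or.inl ⟨by linarith, h4, h5, by linarith, h7⟩
  · exact Or.inr ⟨h3, by linarith, by linarith, by linarith, h7⟩

theorem SqOrbit.next_left_down (h : SqOrbit a b w x y ξ η) {j k : ℕ} (hk : j + 1 = k) (hξ : ξ j = a - a * w)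
    (hη : η j = b * w) : ∃ l : ℝ, 0 < l ∧ x k = x j - l * b ∧
      y k = y j - l * a ∧
      ((x k = 0 ∧ 0 < y k ∧ y k < 1 ∧ ξ k = a + (1 - a) * w ∧
        η k = b * w) ∨
      (y k = 0 ∧ 0 < x k ∧ x k < 1 ∧ ξ k = a - a * w ∧
        η k = 1 - (1 - b) * w)) := by
  subst hk
  obtain ⟨l, hl, h1, h2, h3⟩ := h.flip.next_right_down rfl (by linarith) (by linarith)
  refine ⟨l, hl, by linarith, by linarith, ?_⟩
  rcases h3 with ⟨h3, h4, h5, h6, h7⟩ | ⟨h3, h4, h5, h6, h7⟩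
  · exact Or.inl ⟨by linarith, h4, h5, by linarith, h7⟩
  · exact Or.inr ⟨h3, by linarith, by linarith, by linarith, h7⟩

/-- The only possible itinerary is left, right, bottom, top, left. -/
theorem SqOrbit.closed_of_left_right (h : SqOrbit a b w x y ξ η) (hx0 : x 0 = 0) (hy0 : y 0 < 1)
    (hξ0 : ξ 0 = a + (1 - a) * w) (hη0 : η 0 = b * w) {l₀ : ℝ} (hl₀ : 0 < l₀)
    (ex1 : x 1 = x 0 + l₀ * b) (ey1 : y 1 = y 0 - l₀ * (1 - a)) (x1 : x 1 = 1)
    (ξ1 : ξ 1 = a - a * w) (η1 : η 1 = b * w) : SqClosed x y ξ η := by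
  obtain ⟨ha0, ha1⟩ := h.a_mem
  obtain ⟨hb0, hb1⟩ := h.b_mem
  obtain ⟨hw0, hw1⟩ := h.w_mem
  have e1 : l₀ * b = 1 := by linarith
  have hb : 0 < b := pos_of_mul_pos_right (by rw [e1]; norm_num) hl₀.le
  -- The relations `F1` to `F4` eliminate the step lengths: each is the slope of a step, multiplied
  -- out so that vanishing components of the direction are allowed.
  have F1 : b * y 1 = b * y 0 - (1 - a) := by linear_combination b * ey1 - (1 - a) * e1
  obtain ⟨l₁, hl₁, ex2, ey2, ⟨x2, y2, -⟩ | ⟨y2, x2, x2', ξ2, η2⟩⟩ :=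
    h.next_left_down (k := 2) rfl ξ1 η1
  · exfalso
    have e2 : l₁ = l₀ := mul_right_cancel₀ hb.ne' (by linarith)
    have e3 : l₀ * b ≤ l₀ * 1 := mul_le_mul_of_nonneg_left hb1 hl₀.le
    have e4 : y 2 = y 0 - l₀ := by rw [ey2, ey1, e2]; ring
    linarith
  have F2 : a * x 2 = a - b * y 1 := by
    linear_combination a * ex2 + a * x1 - b * ey2 + b * y2
  obtain ⟨l₂, hl₂, ex3, ey3, ⟨x3, y3, y3', -⟩ | ⟨y3, x3, x3', ξ3, η3⟩⟩ :=
    h.next_left_up (k := 3) rfl ξ2 η2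
  · exfalso
    have F3 : (1 - b) * y 3 = a * x 2 := by
      linear_combination (1 - b) * ey3 + (1 - b) * y2 - a * x3 + a * ex3
    have e3 : b * y 0 < b * 1 := mul_lt_mul_of_pos_left hy0 hb
    have e4 : (1 - b) * y 3 ≤ (1 - b) * 1 := mul_le_mul_of_nonneg_left y3'.le (by linarith)
    linarith
  have F3 : a * x 3 = a * x 2 - (1 - b) := by
    linear_combination a * ex3 - (1 - b) * (y3 - ey3 - y2)
  have ha : 0 < a := pos_of_mul_pos_right (by rw [← sub_eq_iff_eq_add'.2 ey3, y3, y2]; norm_num) hl₂.le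
  obtain ⟨l₃, hl₃, ex4, ey4, ⟨x4, y4, y4', ξ4, η4⟩ | ⟨y4, x4, -⟩⟩ :=
    h.next_left_down (k := 4) rfl ξ3 η3
  · have hy4 : y 4 = y 0 := mul_left_cancel₀ hb.ne' (by
      have F4 : b * y 4 = b - a * x 3 := by
        linear_combination b * ey4 + b * y3 - a * ex4 + a * x4
      linarith)
    refine ⟨by linarith, hy4, by linarith, by linarith, Or.inr (by linarith),
      Or.inl (Or.inl fun he => by linarith), ?_⟩
    rw [hξ0, hη0, ξ1, η1, ξ2, η2, ξ3, η3, hy4, x4, y3, y2, x1, hx0]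
    ring
  · exfalso
    have F4 : a * x 4 = a * x 3 - b := by
      linear_combination a * ex4 - b * ey4 + b * y4 - b * y3
    have := mul_pos ha x4
    have := mul_pos ha (sub_pos.2 x2')
    linarith

/-- Two itineraries survive: left, bottom, right, top, left, and left, bottom, top, right, left. -/
theorem SqOrbit.closed_of_left_bottom (h : SqOrbit a b w x y ξ η) (hx0 : x 0 = 0) (hy0 : 0 < y 0)
    (hξ0 : ξ 0 = a + (1 - a) * w) (hη0 : η 0 = b * w) {l₀ : ℝ}
    (ex1 : x 1 = x 0 + l₀ * b) (ey1 : y 1 = y 0 - l₀ * (1 - a)) (y1 : y 1 = 0) (x1 : 0 < x 1)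
    (ξ1 : ξ 1 = a + (1 - a) * w) (η1 : η 1 = 1 - (1 - b) * w) : SqClosed x y ξ η := by
  obtain ⟨ha0, ha1⟩ := h.a_mem
  obtain ⟨hb0, hb1⟩ := h.b_mem
  obtain ⟨hw0, hw1⟩ := h.w_mem
  have F1 : (1 - a) * x 1 = b * y 0 := by
    linear_combination (1 - a) * ex1 + (1 - a) * hx0 + b * ey1 - b * y1
  have hby : 0 ≤ b * y 0 := mul_nonneg hb0 hy0.le
  obtain ⟨l₁, hl₁, ex2, ey2, ⟨x2, y2, y2', ξ2, η2⟩ | ⟨y2, x2, x2', ξ2, η2⟩⟩ :=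
    h.next_right_up (k := 2) rfl ξ1 η1
  · have F2 : (1 - b) * y 2 = (1 - a) * (1 - x 1) := by
      linear_combination (1 - b) * ey2 + (1 - b) * y1 - (1 - a) * ex2 + (1 - a) * x2
    obtain ⟨l₂, hl₂, ex3, ey3, ⟨x3, y3, y3', -⟩ | ⟨y3, x3, x3', ξ3, η3⟩⟩ :=
      h.next_left_up (k := 3) rfl ξ2 η2
    · exfalso
      have F3 : (1 - b) * y 3 = (1 - b) * y 2 + a := by
        linear_combination (1 - b) * ey3 + a * ex3 - a * x3 + a * x2
      have hb : 0 < 1 - b := by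
        refine pos_of_mul_pos_right (a := l₂) ?_ hl₂.le
        linarith
      have := mul_lt_mul_of_pos_left y3' hb
      have hyb : y 0 < 1 := by
        rcases h.side 0 with h' | h' | h' | h' <;> linarith [h'.1, h'.2.1, h'.2.2.1]
      have : b * y 0 ≤ b * 1 := mul_le_mul_of_nonneg_left hyb.le hb0
      linarith
    have F3 : a * x 3 = a - (1 - b) * (1 - y 2) := by
      linear_combination a * ex3 + a * x2 - (1 - b) * (y3 - ey3)
    obtain ⟨l₃, hl₃, ex4, ey4, ⟨x4, y4, y4', ξ4, η4⟩ | ⟨y4, x4, -⟩⟩ :=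
      h.next_left_down (k := 4) rfl ξ3 η3
    · have hb : b ≠ 0 := by rintro rfl; linarith
      have hy4 : y 4 = y 0 := mul_left_cancel₀ hb (by
        have F4 : b * y 4 = b - a * x 3 := by
          linear_combination b * ey4 + b * y3 - a * ex4 + a * x4
        linarith)
      refine ⟨by linarith, hy4, by linarith, by linarith, Or.inl (by linarith),
        Or.inl (Or.inl fun he => by linarith), ?_⟩
      rw [hξ0, hη0, ξ1, η1, ξ2, η2, ξ3, η3, hy4, x4, y3, x2, y1, hx0]
      ring
    · exfalso
      have F4 : a * x 4 = a * x 3 - b := by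
        linear_combination a * ex4 - b * ey4 + b * y4 - b * y3
      have ha : 0 < a := by
        refine pos_of_mul_pos_right (a := l₃) ?_ hl₃.le
        linarith
      have := mul_pos ha x4
      linarith
  · have F2 : (1 - a) * x 2 = (1 - a) * x 1 + (1 - b) := by
      linear_combination (1 - a) * ex2 - (1 - b) * ey2 - (1 - b) * y1 + (1 - b) * y2
    obtain ⟨l₂, hl₂, ex3, ey3, ⟨x3, y3, y3', ξ3, η3⟩ | ⟨y3, x3, x3', -⟩⟩ :=
      h.next_right_down (k := 3) rfl ξ2 η2
    · have F3 : b * y 3 = b - (1 - a) * (1 - x 2) := by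
        linear_combination b * ey3 + b * y2 + (1 - a) * ex3 - (1 - a) * x3
      obtain ⟨l₃, hl₃, ex4, ey4, ⟨x4, y4, y4', ξ4, η4⟩ | ⟨y4, x4, -⟩⟩ :=
        h.next_left_down (k := 4) rfl ξ3 η3
      · have hb : b ≠ 0 := by rintro rfl; linarith
        have hy4 : y 4 = y 0 := mul_left_cancel₀ hb (by
          have F4 : b * y 4 = b * y 3 - a := by
            linear_combination b * ey4 - a * ex4 + a * x4 - a * x3
          linarith)
        refine ⟨by linarith, hy4, by linarith, by linarith, Or.inr (by linarith),
          Or.inr (Or.inl fun he => by linarith), ?_⟩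
        rw [hξ0, hη0, ξ1, η1, ξ2, η2, ξ3, η3, hy4, x4, x3, y2, y1, hx0]
        ring
      · exfalso
        have F4 : a * x 4 = a - b * y 3 := by
          linear_combination a * ex4 + a * x3 - b * ey4 + b * y4
        have ha : 0 < a := by
          refine pos_of_mul_pos_right (a := l₃) ?_ hl₃.le
          linarith
        have := mul_pos ha x4
        linarith
    · exfalso
      have F3 : (1 - a) * x 3 = (1 - a) * x 2 + b := by
        linear_combination (1 - a) * ex3 + b * ey3 - b * y3 + b * y2
      have : (1 - a) * x 3 ≤ (1 - a) * 1 := mul_le_mul_of_nonneg_left x3'.le (by linarith)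
      have : 0 < 1 - a := by
        refine pos_of_mul_pos_right (a := l₂) ?_ hl₂.le
        linarith
      have := mul_pos this x1
      linarith

theorem SqOrbit.closed_of_left_down (h : SqOrbit a b w x y ξ η) (hx0 : x 0 = 0) (hy0 : 0 < y 0)
    (hy0' : y 0 < 1) (hξ0 : ξ 0 = a + (1 - a) * w) (hη0 : η 0 = b * w) : SqClosed x y ξ η := by
  obtain ⟨l₀, hl₀, ex1, ey1, ⟨x1, -, -, ξ1, η1⟩ | ⟨y1, x1, -, ξ1, η1⟩⟩ :=
    h.next_right_down (k := 1) rfl hξ0 hη0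
  · exact h.closed_of_left_right hx0 hy0' hξ0 hη0 hl₀ ex1 ey1 x1 ξ1 η1
  · exact h.closed_of_left_bottom hx0 hy0 hξ0 hη0 ex1 ey1 y1 x1 ξ1 η1

theorem SqOrbit.closed_of_left (h : SqOrbit a b w x y ξ η) (hx0 : x 0 = 0) (hy0 : 0 < y 0)
    (hy0' : y 0 < 1) (hξ0 : ξ 0 = a + (1 - a) * w) : SqClosed x y ξ η := by
  have hw := h.w_mem
  by_cases hη : η 0 = b * w
  · exact h.closed_of_left_down hx0 hy0 hy0' hξ0 hη
  · have hη' : η 0 = 1 - (1 - b) * w := by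
      obtain ⟨l, hl, ⟨-, h2, -⟩ | ⟨-, h2, -⟩ | ⟨-, h2, -⟩ | ⟨-, h2, -⟩⟩ := h.step 0
      exacts [absurd h2 hη, h2, h2, absurd h2 hη]
    exact (SqClosed.of_flip (h.swap.flip.swap.closed_of_left_down hx0 (by linarith) (by linarith)
      (by linarith) (by linarith)).swap).swap

theorem SqOrbit.closed (h : SqOrbit a b w x y ξ η) : SqClosed x y ξ η := by
  rcases h.side 0 with ⟨h1, h2, h3, h4⟩ | ⟨h1, h2, h3, h4⟩ | ⟨h1, h2, h3, h4⟩ | ⟨h1, h2, h3, h4⟩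
  · exact SqClosed.of_flip (h.flip.closed_of_left (by linarith) h2 h3 (by linarith))
  · exact h.closed_of_left h1 h2 h3 h4
  · exact (SqClosed.of_flip (h.swap.flip.closed_of_left (by linarith) h2 h3 (by linarith))).swap
  · exact (h.swap.closed_of_left h1 h2 h3 (by linarith)).swap

end Billiard

namespace Billiard

open Set

/-! ### The square and the diamond as polygons -/

/-- The outer normals of the unit square. -/
noncomputable def squareNormal : Fin 4 → Plane := ![!₂[1, 0], !₂[-1, 0], !₂[0, 1], !₂[0, -1]]

/-- The outer normals of the diamond, one of which may vanish. -/
noncomputable def diamondNormal (a b : ℝ) : Fin 4 → Plane :=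
  ![!₂[b, -(1 - a)], !₂[1 - b, 1 - a], !₂[-(1 - b), a], !₂[-b, -a]]

theorem mem_square_iff {x : Plane} :
    x ∈ square 0 1 ↔ (0 ≤ x 0 ∧ x 0 ≤ 1) ∧ (0 ≤ x 1 ∧ x 1 ≤ 1) := by
  simp [square, Fin.forall_fin_two]

theorem isCompact_of_forall_coord {K : Set Plane} (hK : IsClosed K) (B : ℝ)
    (h : ∀ x ∈ K, ∀ i, |x i| ≤ B) : IsCompact K := by
  refine Metric.isCompact_of_isClosed_isBounded hK ?_
  rw [isBounded_iff_forall_norm_le]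
  refine ⟨|B| + |B|, fun x hx => ?_⟩
  rw [EuclideanSpace.norm_eq, Fin.sum_univ_two]
  refine Real.sqrt_le_iff.2 ⟨by positivity, ?_⟩
  have h0 := (h x hx 0).trans (le_abs_self B)
  have h1 := (h x hx 1).trans (le_abs_self B)
  simp only [Real.norm_eq_abs]
  nlinarith [abs_nonneg (x 0), abs_nonneg (x 1), abs_nonneg B]

theorem isClosed_halfplanes {ι : Type} (n : ι → Plane) (c : ι → ℝ) :
    IsClosed {x | ∀ i, inner ℝ (n i) x ≤ c i} := by
  have : {x | ∀ i, inner ℝ (n i) x ≤ c i} = ⋂ i, {x | inner ℝ (n i) x ≤ c i} := by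
    ext; simp
  rw [this]
  exact isClosed_iInter fun i => isClosed_le (by fun_prop) continuous_const

theorem mem_interior_of_forall_lt {ι : Type} [Finite ι] {n : ι → Plane} {c : ι → ℝ} {x : Plane}
    (hx : ∀ i, inner ℝ (n i) x < c i ∨ (n i = 0 ∧ 0 ≤ c i)) :
    x ∈ interior {x | ∀ i, inner ℝ (n i) x ≤ c i} := by
  rw [mem_interior_iff_mem_nhds]
  have : ∀ᶠ y in nhds x, ∀ i, inner ℝ (n i) y ≤ c i := by
    rw [Filter.eventually_all]
    intro i
    rcases hx i with hi | ⟨h0, hi⟩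
    · have hc : Continuous fun y : Plane => inner ℝ (n i) y := by fun_prop
      filter_upwards [hc.continuousAt.eventually_lt continuousAt_const hi] with y hy
      exact hy.le
    · filter_upwards with y
      simpa [h0] using hi
  exact this

theorem isPolygon_square : IsPolygon squareNormal ![1, 0, 1, 0] (square 0 1) := by
  have heq : square 0 1 = {x | ∀ i, inner ℝ (squareNormal i) x ≤ (![1, 0, 1, 0] : Fin 4 → ℝ) i} := by
    ext x
    rw [mem_square_iff]
    simp [Fin.forall_fin_succ, squareNormal, inner_plane]
    tauto
  refine ⟨heq, ?_, ?_⟩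
  · refine isCompact_of_forall_coord (heq ▸ isClosed_halfplanes _ _) 1 fun x hx i => ?_
    obtain ⟨h0, h1⟩ := mem_square_iff.1 hx
    fin_cases i
    · exact abs_le.2 ⟨by simp; linarith, h0.2⟩
    · exact abs_le.2 ⟨by simp; linarith, h1.2⟩
  · rw [heq]
    refine ⟨!₂[1 / 2, 1 / 2], mem_interior_of_forall_lt fun i => Or.inl ?_⟩
    fin_cases i <;> simp [squareNormal, inner_plane] <;> norm_num

section Diamond

variable {a b : ℝ}

/-- A point of the hull joins the vertical to the horizontal segment; for a fixed weight `w` of the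
latter, such points fill the rectangle with parameter `w`. -/
theorem mem_diamond_iff_exists {x : Plane} :
    x ∈ diamond a b ↔ ∃ w : ℝ, (0 ≤ w ∧ w ≤ 1) ∧ (a - a * w ≤ x 0 ∧ x 0 ≤ a + (1 - a) * w) ∧
      (b * w ≤ x 1 ∧ x 1 ≤ 1 - (1 - b) * w) := by
  have hc1 : Convex ℝ {x : Plane | x 0 = a ∧ x 1 ∈ Icc (0 : ℝ) 1} := by
    rintro x ⟨h0, h1, h1'⟩ y ⟨g0, g1, g1'⟩ s t hs ht hst
    refine ⟨?_, ?_, ?_⟩ <;> simp only [PiLp.add_apply, PiLp.smul_apply, smul_eq_mul]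
    · rw [h0, g0, ← add_mul, hst, one_mul]
    · positivity
    · nlinarith
  have hc2 : Convex ℝ {x : Plane | x 0 ∈ Icc (0 : ℝ) 1 ∧ x 1 = b} := by
    rintro x ⟨⟨h1, h1'⟩, h0⟩ y ⟨⟨g1, g1'⟩, g0⟩ s t hs ht hst
    refine ⟨⟨?_, ?_⟩, ?_⟩ <;> simp only [PiLp.add_apply, PiLp.smul_apply, smul_eq_mul]
    · positivity
    · nlinarith
    · rw [h0, g0, ← add_mul, hst, one_mul]
  rw [diamond, hc1.convexHull_union hc2 ⟨!₂[a, 0], by simp⟩ ⟨!₂[0, b], by simp⟩, mem_convexJoin]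
  constructor
  · rintro ⟨y, ⟨y0, y1, y1'⟩, z, ⟨⟨z0, z0'⟩, z1⟩, s, w, hs, hw, hsw, rfl⟩
    obtain rfl : s = 1 - w := by linarith
    refine ⟨w, ⟨hw, by linarith⟩, ⟨?_, ?_⟩, ?_, ?_⟩ <;>
      simp only [PiLp.add_apply, PiLp.smul_apply, smul_eq_mul, y0, z1] <;> nlinarith
  · rintro ⟨w, ⟨hw0, hw1⟩, ⟨h1, h2⟩, h3, h4⟩
    have hz : ∃ z : ℝ, 0 ≤ z ∧ z ≤ 1 ∧ x 0 = (1 - w) * a + w * z := by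
      rcases hw0.eq_or_lt with h0 | h0
      · subst h0; exact ⟨0, le_rfl, zero_le_one, by linarith⟩
      · refine ⟨(x 0 - (1 - w) * a) / w, div_nonneg (by linarith) hw0, ?_, by field_simp; ring⟩
        rw [div_le_one h0]; linarith
    have hy : ∃ y : ℝ, 0 ≤ y ∧ y ≤ 1 ∧ x 1 = (1 - w) * y + w * b := by
      rcases hw1.eq_or_lt with h0 | h0
      · subst h0; exact ⟨0, le_rfl, zero_le_one, by linarith⟩
      · have h0' : 0 < 1 - w := by linarith
        refine ⟨(x 1 - w * b) / (1 - w), div_nonneg (by linarith) h0'.le, ?_, by field_simp; ring⟩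
        rw [div_le_one h0']; linarith
    obtain ⟨z, hz0, hz1, ez⟩ := hz
    obtain ⟨y, hy0, hy1, ey⟩ := hy
    exact ⟨!₂[a, y], ⟨rfl, hy0, hy1⟩, !₂[z, b], ⟨⟨hz0, hz1⟩, rfl⟩, 1 - w, w, by linarith, hw0, by ring,
      plane_ext (by simp [ez]) (by simp [ey])⟩

theorem mem_diamond_iff (ha : a ∈ Icc (0 : ℝ) 1) (hb : b ∈ Icc (0 : ℝ) 1) {x : Plane} :
    x ∈ diamond a b ↔ b * x 0 - (1 - a) * x 1 ≤ a * b ∧ (1 - b) * x 0 + (1 - a) * x 1 ≤ 1 - a * b ∧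
      -(1 - b) * x 0 + a * x 1 ≤ a * b ∧ -b * x 0 - a * x 1 ≤ -(a * b) := by
  obtain ⟨ha0, ha1⟩ := ha
  obtain ⟨hb0, hb1⟩ := hb
  rw [mem_diamond_iff_exists]
  constructor
  · rintro ⟨w, ⟨hw0, hw1⟩, ⟨h1, h2⟩, h3, h4⟩
    refine ⟨?_, ?_, ?_, ?_⟩ <;>
      nlinarith [mul_le_mul_of_nonneg_left h1 hb0, mul_le_mul_of_nonneg_left h2 hb0,
        mul_le_mul_of_nonneg_left h1 (sub_nonneg.2 hb1), mul_le_mul_of_nonneg_left h2 (sub_nonneg.2 hb1),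
        mul_le_mul_of_nonneg_left h3 ha0, mul_le_mul_of_nonneg_left h4 ha0,
        mul_le_mul_of_nonneg_left h3 (sub_nonneg.2 ha1), mul_le_mul_of_nonneg_left h4 (sub_nonneg.2 ha1),
        mul_le_mul_of_nonneg_left hw1 ha0, mul_le_mul_of_nonneg_left hw1 (sub_nonneg.2 ha1)]
  · rintro ⟨h1, h2, h3, h4⟩
    have hx0 : 0 ≤ x 0 := by linarith
    have hx1 : x 0 ≤ 1 := by linarith
    have hy0 : 0 ≤ x 1 := by linarith
    have hy1 : x 1 ≤ 1 := by linarith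
    rcases le_total a (x 0) with hax | hax
    · rcases ha1.eq_or_lt with rfl | ha1
      · exact ⟨0, ⟨le_rfl, zero_le_one⟩, ⟨by linarith, by linarith⟩, by linarith, by linarith⟩
      · have hp : 0 < 1 - a := by linarith
        -- The witness is the smallest `w` whose rectangle reaches the abscissa of `x`; smaller `w`
        -- means a taller rectangle.
        have e : (1 - a) * ((x 0 - a) / (1 - a)) = x 0 - a := by field_simp
        have hw : 0 ≤ (x 0 - a) / (1 - a) := div_nonneg (by linarith) hp.le
        set w := (x 0 - a) / (1 - a)
        refine ⟨w, ⟨hw, ?_⟩, ⟨?_, by linarith⟩, ?_, ?_⟩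
        · nlinarith
        · nlinarith
        · refine le_of_mul_le_mul_left ?_ hp
          linear_combination h1 + b * e
        · refine le_of_mul_le_mul_left ?_ hp
          linear_combination h2 + (1 - b) * e
    · rcases ha0.eq_or_lt with h0 | ha0
      · subst h0
        exact ⟨0, ⟨le_rfl, zero_le_one⟩, ⟨by linarith, by linarith⟩, by linarith, by linarith⟩
      · have e : a * ((a - x 0) / a) = a - x 0 := by field_simp
        have hw : 0 ≤ (a - x 0) / a := div_nonneg (by linarith) ha0.le
        set w := (a - x 0) / a
        refine ⟨w, ⟨hw, ?_⟩, ⟨by linarith, ?_⟩, ?_, ?_⟩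
        · nlinarith
        · nlinarith
        · refine le_of_mul_le_mul_left ?_ ha0
          linear_combination h4 + b * e
        · refine le_of_mul_le_mul_left ?_ ha0
          linear_combination h3 + (1 - b) * e

theorem isPolygon_diamond (ha : a ∈ Icc (0 : ℝ) 1) (hb : b ∈ Icc (0 : ℝ) 1) :
    IsPolygon (diamondNormal a b) ![a * b, 1 - a * b, a * b, -(a * b)] (diamond a b) := by
  have heq : diamond a b = {x | ∀ i, inner ℝ (diamondNormal a b i) x ≤
      (![a * b, 1 - a * b, a * b, -(a * b)] : Fin 4 → ℝ) i} := by
    ext x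
    rw [mem_diamond_iff ha hb]
    constructor
    · rintro ⟨h0, h1, h2, h3⟩ i
      fin_cases i <;> simp [diamondNormal, inner_plane] <;> linarith
    · intro h
      have h0 := h 0
      have h1 := h 1
      have h2 := h 2
      have h3 := h 3
      simp [diamondNormal, inner_plane] at h0 h1 h2 h3
      exact ⟨by linarith, by linarith, by linarith, by linarith⟩
  obtain ⟨ha0, ha1⟩ := ha
  obtain ⟨hb0, hb1⟩ := hb
  refine ⟨heq, ?_, ?_⟩
  · refine isCompact_of_forall_coord (heq ▸ isClosed_halfplanes _ _) 1 fun x hx i => ?_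
    obtain ⟨h1, h2, h3, h4⟩ := (mem_diamond_iff ⟨ha0, ha1⟩ ⟨hb0, hb1⟩).1 hx
    fin_cases i
    · exact abs_le.2 ⟨by simp; linarith, by simp; linarith⟩
    · exact abs_le.2 ⟨by simp; linarith, by simp; linarith⟩
  -- The midpoint of `(a, b)` and the centre of the square. A normal vanishes precisely when `(a,
  -- b)` is the corresponding corner of the square, whence the case distinctions.
  · refine ⟨!₂[a / 2 + 1 / 4, b / 2 + 1 / 4], ?_⟩
    rw [heq]
    refine mem_interior_of_forall_lt fun i => ?_
    have hab := mul_nonneg ha0 hb0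
    have hab1 := mul_nonneg ha0 (sub_nonneg.2 hb1)
    have hab2 := mul_nonneg (sub_nonneg.2 ha1) hb0
    have hab3 := mul_nonneg (sub_nonneg.2 ha1) (sub_nonneg.2 hb1)
    fin_cases i
    · by_cases h : b = 0 ∧ a = 1
      · right; simp [diamondNormal, h.1, h.2]
      · left
        have : 0 < b + (1 - a) := by
          rcases hb0.eq_or_lt with h0 | h0
          · have : a ≠ 1 := fun h1 => h ⟨h0.symm, h1⟩
            have := lt_of_le_of_ne ha1 this
            linarith
          · linarith
        simp [diamondNormal, inner_plane]; nlinarith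
    · by_cases h : b = 1 ∧ a = 1
      · right; simp [diamondNormal, h.1, h.2]
      · left
        have : 0 < (1 - b) + (1 - a) := by
          rcases hb1.eq_or_lt with h0 | h0
          · have : a ≠ 1 := fun h1 => h ⟨h0, h1⟩
            have := lt_of_le_of_ne ha1 this
            linarith
          · linarith
        simp [diamondNormal, inner_plane]; nlinarith
    · by_cases h : b = 1 ∧ a = 0
      · right; simp [diamondNormal, h.1, h.2]
      · left
        have : 0 < (1 - b) + a := by
          rcases hb1.eq_or_lt with h0 | h0
          · have : a ≠ 0 := fun h1 => h ⟨h0, h1⟩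
            have := lt_of_le_of_ne ha0 this.symm
            linarith
          · linarith
        simp [diamondNormal, inner_plane]; nlinarith
    · by_cases h : b = 0 ∧ a = 0
      · right; simp [diamondNormal, h.1, h.2]
      · left
        have : 0 < b + a := by
          rcases hb0.eq_or_lt with h0 | h0
          · have : a ≠ 0 := fun h1 => h ⟨h0.symm, h1⟩
            have := lt_of_le_of_ne ha0 this.symm
            linarith
          · linarith
        simp [diamondNormal, inner_plane]; nlinarith

end Diamond

end Billiard

namespace Billiard

open Set

/-- What happens at a bounce of a regular trajectory in a pair of polygons, in terms of the
constraints that are active. -/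
theorem IsRegularTrajectory.bounce {ι κ : Type} [Finite κ] {n : ι → Plane}
    {c : ι → ℝ} {m : κ → Plane} {d : κ → ℝ} {K T : Set Plane} {q p : ℕ → Plane}
    (h : IsRegularTrajectory K T q p) (hK : IsPolygon n c K) (hT : IsPolygon m d T) {j : ℕ} {i : ι}
    (hi0 : n i ≠ 0) (hi : inner ℝ (n i) (q (j + 1)) = c i) :
    (∃ μ : ℝ, 0 < μ ∧ p j - p (j + 1) = μ • n i) ∧
    (∀ k, m k ≠ 0 → inner ℝ (m k) (p j) = d k → 0 < inner ℝ (n i) (m k)) ∧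
    ∃ k, inner ℝ (m k) (p (j + 1)) = d k ∧ inner ℝ (n i) (m k) < 0 := by
  have hn := hK.mem_normalCone hi
  refine ⟨h.exists_smul_dual_normal hn hi0, fun k hk0 hk => ?_, ?_⟩
  · obtain ⟨l, hl, e⟩ := h.exists_smul_normal (hT.mem_normalCone hk) hk0
    have := h.inner_normal_pos hn hi0
    rw [e, inner_smul_right] at this
    exact pos_of_mul_pos_right this hl.le
  · obtain ⟨k, hk0, hk⟩ := hT.exists_active (h.p_mem (j + 1))
    obtain ⟨l, hl, e⟩ := h.exists_smul_normal (hT.mem_normalCone hk) hk0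
    have := h.inner_normal_neg hK.isClosed hn hi0
    rw [e, inner_smul_right] at this
    exact ⟨k, hk, by nlinarith⟩

/-! ### Corners of rectangles inscribed in the diamond -/

/-- `(ξ, η)` is a corner of the rectangle with parameter `w` inscribed in the diamond, and the side
of the diamond that it lies on does not degenerate to a point. -/
def Corner (a b w ξ η : ℝ) : Prop :=
  (ξ = a + (1 - a) * w ∧ η = b * w ∧ (b ≠ 0 ∨ a ≠ 1)) ∨
  (ξ = a + (1 - a) * w ∧ η = 1 - (1 - b) * w ∧ (b ≠ 1 ∨ a ≠ 1)) ∨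
  (ξ = a - a * w ∧ η = 1 - (1 - b) * w ∧ (b ≠ 1 ∨ a ≠ 0)) ∨
  (ξ = a - a * w ∧ η = b * w ∧ (b ≠ 0 ∨ a ≠ 0))

/-- The inequalities that define the diamond. -/
def InDiamond (a b ξ η : ℝ) : Prop :=
  b * ξ - (1 - a) * η ≤ a * b ∧ (1 - b) * ξ + (1 - a) * η ≤ 1 - a * b ∧
    -(1 - b) * ξ + a * η ≤ a * b ∧ -b * ξ - a * η ≤ -(a * b)

variable {a b w ξ η ξ' η' : ℝ}

theorem one_sub_ne_iff {s t : ℝ} : 1 - s ≠ t ↔ s ≠ 1 - t := by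
  constructor <;> intro h h' <;> apply h <;> linarith

theorem Corner.of_flip (h : Corner (1 - a) b w (1 - ξ) η) : Corner a b w ξ η := by
  rcases h with ⟨h1, h2, h3⟩ | ⟨h1, h2, h3⟩ | ⟨h1, h2, h3⟩ | ⟨h1, h2, h3⟩ <;>
    rw [one_sub_ne_iff] at h3 <;> norm_num at h3
  · exact Or.inr (Or.inr (Or.inr ⟨by linarith, h2, h3⟩))
  · exact Or.inr (Or.inr (Or.inl ⟨by linarith, h2, h3⟩))
  · exact Or.inr (Or.inl ⟨by linarith, h2, h3⟩)
  · exact Or.inl ⟨by linarith, h2, h3⟩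

theorem Corner.swap (h : Corner a b w ξ η) : Corner b a (1 - w) η ξ := by
  rcases h with ⟨h1, h2, h3⟩ | ⟨h1, h2, h3⟩ | ⟨h1, h2, h3⟩ | ⟨h1, h2, h3⟩
  · exact Or.inr (Or.inr (Or.inl ⟨by linarith, by linarith, h3.symm⟩))
  · exact Or.inr (Or.inl ⟨by linarith, by linarith, h3.symm⟩)
  · exact Or.inl ⟨by linarith, by linarith, h3.symm⟩
  · exact Or.inr (Or.inr (Or.inr ⟨by linarith, by linarith, h3.symm⟩))

theorem InDiamond.flip (h : InDiamond a b ξ η) : InDiamond (1 - a) b (1 - ξ) η := by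
  obtain ⟨h1, h2, h3, h4⟩ := h
  exact ⟨by linarith, by linarith, by linarith, by linarith⟩

theorem InDiamond.swap (h : InDiamond a b ξ η) : InDiamond b a η ξ := by
  obtain ⟨h1, h2, h3, h4⟩ := h
  exact ⟨by linarith, by linarith, by linarith, by linarith⟩

theorem InDiamond.flip' (h : InDiamond a b ξ η) : InDiamond a (1 - b) ξ (1 - η) := h.swap.flip.swap

theorem Corner.of_flip' (h : Corner a (1 - b) w ξ (1 - η)) : Corner a b w ξ η := by
  simpa using h.swap.of_flip.swap

/-- In general the point lies on the side with this normal. If `a = 1` or `b = 0`, this side can be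
collinear with a neighbouring one, and the point may be a corner with the label of that neighbour.
-/
theorem exists_corner_of_active (ha : 0 ≤ a ∧ a ≤ 1) (hb : 0 ≤ b ∧ b ≤ 1) (h : InDiamond a b ξ η)
    (he : b * ξ - (1 - a) * η = a * b) (hne : b ≠ 0 ∨ a ≠ 1) :
    ∃ w : ℝ, (0 ≤ w ∧ w ≤ 1) ∧ Corner a b w ξ η := by
  obtain ⟨h1, h2, h3, h4⟩ := h
  obtain ⟨ha0, ha1⟩ := ha
  obtain ⟨hb0, hb1⟩ := hb
  rcases ha1.eq_or_lt with rfl | ha1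
  · have hb : 0 < b := lt_of_le_of_ne hb0 (Ne.symm (by simpa using hne))
    have hξ : ξ = 1 := mul_left_cancel₀ hb.ne' (by linarith)
    subst hξ
    rcases le_or_gt η b with h | h
    · refine ⟨η / b, ⟨by apply div_nonneg <;> linarith, (div_le_one hb).2 h⟩,
        Or.inl ⟨by ring, by field_simp, hne⟩⟩
    · have hb' : 0 < 1 - b := by linarith
      refine ⟨(1 - η) / (1 - b), ⟨div_nonneg (by linarith) hb'.le, (div_le_one hb').2 (by linarith)⟩,
        Or.inr (Or.inl ⟨by ring, by field_simp; ring, Or.inl (by linarith)⟩)⟩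
  · have hp : 0 < 1 - a := by linarith
    rcases le_or_gt a ξ with h | h
    · have e : (1 - a) * ((ξ - a) / (1 - a)) = ξ - a := by field_simp
      refine ⟨(ξ - a) / (1 - a), ⟨div_nonneg (by linarith) hp.le, (div_le_one hp).2 (by linarith)⟩,
        Or.inl ⟨by linarith, mul_left_cancel₀ hp.ne' ?_, Or.inr ha1.ne⟩⟩
      linear_combination -he - b * e
    -- To the left of `a` the constraint can only be active when `b = 0`, on the part of the bottom
    -- edge that belongs to the fourth label.
    · have ha : 0 < a := by linarith
      have hη : 0 ≤ (1 - a) * η := mul_nonneg hp.le (by linarith)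
      have hb : b = 0 := by nlinarith
      subst hb
      have hη : η = 0 := mul_left_cancel₀ hp.ne' (by linarith)
      have e : a * ((a - ξ) / a) = a - ξ := by field_simp
      exact ⟨(a - ξ) / a, ⟨div_nonneg (by linarith) ha.le, (div_le_one ha).2 (by linarith)⟩,
        Or.inr (Or.inr (Or.inr ⟨by linarith, by linarith, Or.inr ha.ne'⟩))⟩

/-- A bounce at the right side moves the dual point horizontally to the left boundary of the
diamond, which at this height is at `a - a * w`. If an upper constraint is active at a lower corner,
or conversely, both expressions degenerate to zero. -/
theorem eq_of_bounce_right (ha : 0 ≤ a) (hb : 0 ≤ b ∧ b ≤ 1) (hw : 0 ≤ w ∧ w ≤ 1)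
    (h : InDiamond a b ξ' η)
    (h₁ : (η = b * w ∧ 0 < b) ∨ (η = 1 - (1 - b) * w ∧ b < 1))
    (h₂ : (-(1 - b) * ξ' + a * η = a * b ∧ b < 1) ∨ (-b * ξ' - a * η = -(a * b) ∧ 0 < b)) :
    ξ' = a - a * w := by
  obtain ⟨-, -, h3, h4⟩ := h
  rcases h₁ with ⟨rfl, hb0⟩ | ⟨rfl, hb1⟩ <;> rcases h₂ with ⟨e, hb1'⟩ | ⟨e, hb0'⟩
  · have h5 : 0 ≤ ξ' := by linarith
    have h6 : 0 ≤ a * b * (1 - w) := mul_nonneg (mul_nonneg ha hb.1) (by linarith)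
    have h7 : 0 ≤ (1 - b) * ξ' := mul_nonneg (by linarith) h5
    have h8 : (1 - b) * ξ' = 0 := by linarith
    have h9 : ξ' = 0 := (mul_eq_zero.1 h8).resolve_left (by linarith)
    rw [h9]
    apply mul_left_cancel₀ hb0.ne'
    linarith
  · apply mul_left_cancel₀ hb0.ne'
    linarith
  · apply mul_left_cancel₀ (sub_pos.2 hb1).ne'
    linarith
  · have h5 : 0 ≤ ξ' := by linarith
    have h6 : 0 ≤ a * (1 - b) * (1 - w) := mul_nonneg (mul_nonneg ha (by linarith)) (by linarith)
    have h7 : 0 ≤ b * ξ' := mul_nonneg (by linarith) h5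
    have h8 : b * ξ' = 0 := by linarith
    have h9 : ξ' = 0 := (mul_eq_zero.1 h8).resolve_left (by linarith)
    rw [h9]
    apply mul_left_cancel₀ (sub_pos.2 hb1).ne'
    linarith

end Billiard

/-! ### Bounces of regular trajectories in the square with a diamond. -/

namespace Billiard

open Set

theorem square_side {x : Plane} (hx : IsSmoothPoint (square 0 1) x) :
    (x 0 = 1 ∧ 0 < x 1 ∧ x 1 < 1) ∨ (x 0 = 0 ∧ 0 < x 1 ∧ x 1 < 1) ∨
      (x 1 = 1 ∧ 0 < x 0 ∧ x 0 < 1) ∨ (x 1 = 0 ∧ 0 < x 0 ∧ x 0 < 1) := by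
  have hP := isPolygon_square
  have hxK := hP.isClosed.frontier_subset hx.1
  obtain ⟨i, -, hi⟩ := hP.exists_active hx.1
  have key := fun k => hP.lt_of_det_ne_zero (k := k) hx hxK hi
  have k0 := key 0
  have k1 := key 1
  have k2 := key 2
  have k3 := key 3
  fin_cases i <;> simp [squareNormal, inner_plane] at hi k0 k1 k2 k3 <;>
    simp [hi, k0, k1, k2, k3]

section

variable {a b w : ℝ}

/-- The two reflections carry each of the four constraints to the first one. -/
theorem exists_corner (ha : a ∈ Icc (0 : ℝ) 1) (hb : b ∈ Icc (0 : ℝ) 1) {x : Plane}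
    (hx : x ∈ frontier (diamond a b)) : ∃ w : ℝ, (0 ≤ w ∧ w ≤ 1) ∧ Corner a b w (x 0) (x 1) := by
  have hP := isPolygon_diamond ha hb
  have hin : InDiamond a b (x 0) (x 1) := (mem_diamond_iff ha hb).1 (hP.isClosed.frontier_subset hx)
  have ha' : 0 ≤ 1 - a ∧ 1 - a ≤ 1 := ⟨by linarith [ha.2], by linarith [ha.1]⟩
  have hb' : 0 ≤ 1 - b ∧ 1 - b ≤ 1 := ⟨by linarith [hb.2], by linarith [hb.1]⟩
  have hz : ∀ s t : ℝ, (!₂[s, t] : Plane) ≠ 0 → s ≠ 0 ∨ t ≠ 0 := by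
    intro s t h
    by_contra! hc
    exact h (by rw [hc.1, hc.2]; exact plane_ext rfl rfl)
  obtain ⟨i, hi0, hi⟩ := hP.exists_active hx
  fin_cases i <;> replace hi0 := hz _ _ hi0 <;> simp [inner_plane, diamondNormal] at hi
  · refine exists_corner_of_active ha hb hin (by linarith) (hi0.imp_right fun h h' => h ?_)
    rw [h']; ring
  · obtain ⟨w, hw, h⟩ := exists_corner_of_active ha hb' hin.flip' (by linarith)
      (hi0.imp_right fun h h' => h (by rw [h']; ring))
    exact ⟨w, hw, h.of_flip'⟩
  · obtain ⟨w, hw, h⟩ := exists_corner_of_active ha' hb' hin.flip.flip' (by linarith)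
      (hi0.imp (fun h h' => h (by rw [h']; ring)) fun h h' => h (by linarith))
    exact ⟨w, hw, h.of_flip'.of_flip⟩
  · obtain ⟨w, hw, h⟩ := exists_corner_of_active ha' hb hin.flip (by linarith)
      (hi0.imp (fun h h' => h (by rw [h']; ring)) fun h h' => h (by linarith))
    exact ⟨w, hw, h.of_flip⟩

variable {q p : ℕ → Plane}

theorem Corner.step (ha : a ∈ Icc (0 : ℝ) 1) (hb : b ∈ Icc (0 : ℝ) 1)
    (h : IsRegularTrajectory (square 0 1) (diamond a b) q p) {j : ℕ}
    (hc : Corner a b w (p j 0) (p j 1)) : ∃ l : ℝ, 0 < l ∧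
    ((p j 0 = a + (1 - a) * w ∧ p j 1 = b * w ∧
        q (j + 1) 0 = q j 0 + l * b ∧ q (j + 1) 1 = q j 1 - l * (1 - a)) ∨
      (p j 0 = a + (1 - a) * w ∧ p j 1 = 1 - (1 - b) * w ∧
        q (j + 1) 0 = q j 0 + l * (1 - b) ∧ q (j + 1) 1 = q j 1 + l * (1 - a)) ∨
      (p j 0 = a - a * w ∧ p j 1 = 1 - (1 - b) * w ∧
        q (j + 1) 0 = q j 0 - l * (1 - b) ∧ q (j + 1) 1 = q j 1 + l * a) ∨
      (p j 0 = a - a * w ∧ p j 1 = b * w ∧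
        q (j + 1) 0 = q j 0 - l * b ∧ q (j + 1) 1 = q j 1 - l * a)) := by
  have hP := isPolygon_diamond ha hb
  have key : ∀ k, diamondNormal a b k ≠ 0 → inner ℝ (diamondNormal a b k) (p j) =
      (![a * b, 1 - a * b, a * b, -(a * b)] : Fin 4 → ℝ) k → ∃ l : ℝ, 0 < l ∧
      q (j + 1) 0 = q j 0 + l * diamondNormal a b k 0 ∧
      q (j + 1) 1 = q j 1 + l * diamondNormal a b k 1 := by
    intro k hk0 hk
    obtain ⟨l, hl, e⟩ := h.exists_smul_normal (hP.mem_normalCone hk) hk0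
    rw [sub_eq_iff_eq_add'] at e
    exact ⟨l, hl, by rw [e]; simp, by rw [e]; simp⟩
  have hz : ∀ z : Plane, z 0 ≠ 0 ∨ z 1 ≠ 0 → z ≠ 0 := by
    rintro z h rfl
    simp at h
  rcases hc with ⟨h1, h2, h3⟩ | ⟨h1, h2, h3⟩ | ⟨h1, h2, h3⟩ | ⟨h1, h2, h3⟩
  · obtain ⟨l, hl, e0, e1⟩ := key 0 (hz _ (h3.imp_right fun h h' => h (by simp [diamondNormal] at h'; linarith)))
      (by simp [diamondNormal, inner_plane, h1, h2]; ring)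
    refine ⟨l, hl, Or.inl ⟨h1, h2, e0, ?_⟩⟩
    rw [e1]; simp [diamondNormal]; ring
  · obtain ⟨l, hl, e0, e1⟩ := key 1 (hz _ (h3.imp (fun h h' => h (by simp [diamondNormal] at h'; linarith))
        fun h h' => h (by simp [diamondNormal] at h'; linarith)))
      (by simp [diamondNormal, inner_plane, h1, h2]; ring)
    exact ⟨l, hl, Or.inr (Or.inl ⟨h1, h2, e0, e1⟩)⟩
  · obtain ⟨l, hl, e0, e1⟩ := key 2 (hz _ (h3.imp_left (fun h h' => h (by simp [diamondNormal] at h'; linarith))))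
      (by simp [diamondNormal, inner_plane, h1, h2]; ring)
    refine ⟨l, hl, Or.inr (Or.inr (Or.inl ⟨h1, h2, ?_, e1⟩))⟩
    rw [e0]; simp [diamondNormal]; ring
  · obtain ⟨l, hl, e0, e1⟩ := key 3 (hz _ (h3.imp (fun h h' => h (by simp [diamondNormal] at h'; linarith))
        fun h h' => h (by simp [diamondNormal] at h'; linarith)))
      (by simp [diamondNormal, inner_plane, h1, h2]; ring)
    refine ⟨l, hl, Or.inr (Or.inr (Or.inr ⟨h1, h2, ?_, ?_⟩))⟩
    · rw [e0]; simp [diamondNormal]; ring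
    · rw [e1]; simp [diamondNormal]; ring

/-- The next dual point, and the sign of the components of the outer normals before and after a
bounce, for each side of the square. -/
theorem square_bounce (ha : a ∈ Icc (0 : ℝ) 1) (hb : b ∈ Icc (0 : ℝ) 1)
    (h : IsRegularTrajectory (square 0 1) (diamond a b) q p) (j : ℕ) :
    (q (j + 1) 0 = 1 → p (j + 1) 1 = p j 1 ∧
      ((-(1 - b) * p (j + 1) 0 + a * p (j + 1) 1 = a * b ∧ b < 1) ∨
        (-b * p (j + 1) 0 - a * p (j + 1) 1 = -(a * b) ∧ 0 < b))) ∧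
    (q (j + 1) 0 = 0 → p (j + 1) 1 = p j 1 ∧
      ((b * p (j + 1) 0 - (1 - a) * p (j + 1) 1 = a * b ∧ 0 < b) ∨
        ((1 - b) * p (j + 1) 0 + (1 - a) * p (j + 1) 1 = 1 - a * b ∧ b < 1))) ∧
    (q (j + 1) 1 = 1 → p (j + 1) 0 = p j 0 ∧
      ((b * p (j + 1) 0 - (1 - a) * p (j + 1) 1 = a * b ∧ a < 1) ∨
        (-b * p (j + 1) 0 - a * p (j + 1) 1 = -(a * b) ∧ 0 < a))) ∧
    (q (j + 1) 1 = 0 → p (j + 1) 0 = p j 0 ∧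
      (((1 - b) * p (j + 1) 0 + (1 - a) * p (j + 1) 1 = 1 - a * b ∧ a < 1) ∨
        (-(1 - b) * p (j + 1) 0 + a * p (j + 1) 1 = a * b ∧ 0 < a))) := by
  obtain ⟨ha0, ha1⟩ := ha
  obtain ⟨hb0, hb1⟩ := hb
  have hne : ∀ i, squareNormal i ≠ 0 := by
    intro i hi
    have h0 := congrArg (fun z : Plane => z 0) hi
    have h1 := congrArg (fun z : Plane => z 1) hi
    fin_cases i <;> simp [squareNormal] at h0 h1
  have key := fun i => h.bounce isPolygon_square (isPolygon_diamond ⟨ha0, ha1⟩ ⟨hb0, hb1⟩)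
    (j := j) (hne i)
  refine ⟨fun hq => ?_, fun hq => ?_, fun hq => ?_, fun hq => ?_⟩
  · obtain ⟨⟨μ, -, e⟩, -, k, hk, hs⟩ := key 0 (by simp [squareNormal, inner_plane, hq])
    have e1 := congrArg (fun z : Plane => z 1) e
    simp [squareNormal] at e1
    refine ⟨by linarith, ?_⟩
    fin_cases k <;> simp [squareNormal, diamondNormal, inner_plane] at hk hs
    · linarith
    · linarith
    · exact Or.inl ⟨by linarith, hs⟩
    · exact Or.inr ⟨by linarith, hs⟩
  · obtain ⟨⟨μ, -, e⟩, -, k, hk, hs⟩ := key 1 (by simp [squareNormal, inner_plane, hq])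
    have e1 := congrArg (fun z : Plane => z 1) e
    simp [squareNormal] at e1
    refine ⟨by linarith, ?_⟩
    fin_cases k <;> simp [squareNormal, diamondNormal, inner_plane] at hk hs
    · exact Or.inl ⟨by linarith, hs⟩
    · exact Or.inr ⟨by linarith, hs⟩
    · linarith
    · linarith
  · obtain ⟨⟨μ, -, e⟩, -, k, hk, hs⟩ := key 2 (by simp [squareNormal, inner_plane, hq])
    have e1 := congrArg (fun z : Plane => z 0) e
    simp [squareNormal] at e1
    refine ⟨by linarith, ?_⟩
    fin_cases k <;> simp [squareNormal, diamondNormal, inner_plane] at hk hs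
    · exact Or.inl ⟨by linarith, hs⟩
    · linarith
    · linarith
    · exact Or.inr ⟨by linarith, hs⟩
  · obtain ⟨⟨μ, -, e⟩, -, k, hk, hs⟩ := key 3 (by simp [squareNormal, inner_plane, hq])
    have e1 := congrArg (fun z : Plane => z 0) e
    simp [squareNormal] at e1
    refine ⟨by linarith, ?_⟩
    fin_cases k <;> simp [squareNormal, diamondNormal, inner_plane] at hk hs
    · linarith
    · exact Or.inl ⟨by linarith, hs⟩
    · exact Or.inr ⟨by linarith, hs⟩
    · linarith

end

end Billiard

/-! ### The conserved rectangle, and the Zoll property of the square with a diamond. -/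

namespace Billiard

open Set

section

variable {a b w : ℝ} {q p : ℕ → Plane}

theorem square_incoming {T : Set Plane}
    (h : IsRegularTrajectory (square 0 1) T q p) (j : ℕ) :
    (q (j + 1) 0 = 1 → q j 0 < 1) ∧ (q (j + 1) 0 = 0 → 0 < q j 0) ∧
    (q (j + 1) 1 = 1 → q j 1 < 1) ∧ (q (j + 1) 1 = 0 → 0 < q j 1) := by
  have hne : ∀ i, squareNormal i ≠ 0 := by
    intro i hi
    have h0 := congrArg (fun z : Plane => z 0) hi
    have h1 := congrArg (fun z : Plane => z 1) hi
    fin_cases i <;> simp [squareNormal] at h0 h1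
  have key : ∀ i, inner ℝ (squareNormal i) (q (j + 1)) = (![1, 0, 1, 0] : Fin 4 → ℝ) i →
      0 < inner ℝ (squareNormal i) (q (j + 1) - q j) :=
    fun i hi => h.inner_normal_pos (isPolygon_square.mem_normalCone hi) (hne i)
  have k0 := key 0
  have k1 := key 1
  have k2 := key 2
  have k3 := key 3
  simp [squareNormal, inner_plane] at k0 k1 k2 k3
  refine ⟨fun hq => ?_, fun hq => ?_, fun hq => ?_, fun hq => ?_⟩
  · linarith [k0 hq]
  · linarith [k1 hq]
  · linarith [k2 hq]
  · linarith [k3 hq]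

theorem square_outgoing {T : Set Plane}
    (h : IsRegularTrajectory (square 0 1) T q p) (j : ℕ) :
    (q j 0 = 1 → q (j + 1) 0 < 1) ∧ (q j 0 = 0 → 0 < q (j + 1) 0) ∧
    (q j 1 = 1 → q (j + 1) 1 < 1) ∧ (q j 1 = 0 → 0 < q (j + 1) 1) := by
  have hne : ∀ i, squareNormal i ≠ 0 := by
    intro i hi
    have h0 := congrArg (fun z : Plane => z 0) hi
    have h1 := congrArg (fun z : Plane => z 1) hi
    fin_cases i <;> simp [squareNormal] at h0 h1
  have key : ∀ i, inner ℝ (squareNormal i) (q j) = (![1, 0, 1, 0] : Fin 4 → ℝ) i →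
      inner ℝ (squareNormal i) (q (j + 1) - q j) < 0 :=
    fun i hi => h.inner_normal_neg isPolygon_square.isClosed (isPolygon_square.mem_normalCone hi) (hne i)
  have k0 := key 0
  have k1 := key 1
  have k2 := key 2
  have k3 := key 3
  simp [squareNormal, inner_plane] at k0 k1 k2 k3
  refine ⟨fun hq => ?_, fun hq => ?_, fun hq => ?_, fun hq => ?_⟩
  · linarith [k0 hq]
  · linarith [k1 hq]
  · linarith [k2 hq]
  · linarith [k3 hq]

theorem pos_of_lt_add_mul {s l t : ℝ} (hl : 0 < l) (h : s < s + l * t) : 0 < t :=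
  pos_of_mul_pos_right (by linarith) hl.le

/-- The parameter `w` survives the bounce. Since the side is hit from within, the direction has a
positive horizontal component; this selects a right-hand corner and excludes the degenerate sides
for `eq_of_bounce_right`. -/
theorem Corner.right (ha : a ∈ Icc (0 : ℝ) 1) (hb : b ∈ Icc (0 : ℝ) 1) (hw : 0 ≤ w ∧ w ≤ 1)
    (h : IsRegularTrajectory (square 0 1) (diamond a b) q p) {j : ℕ}
    (hc : Corner a b w (p j 0) (p j 1)) (hq : q (j + 1) 0 = 1) :
    p j 0 = a + (1 - a) * w ∧ p (j + 1) 1 = p j 1 ∧ Corner a b w (p (j + 1) 0) (p (j + 1) 1) := by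
  have hin : InDiamond a b (p (j + 1) 0) (p (j + 1) 1) := (mem_diamond_iff ha hb).1
    ((isPolygon_diamond ha hb).isClosed.frontier_subset (h.p_mem _))
  have hlt := (square_incoming h j).1 hq
  obtain ⟨hη, h₂⟩ := (square_bounce ha hb h j).1 hq
  obtain ⟨l, hl, h⟩ := hc.step ha hb h
  have key := eq_of_bounce_right ha.1 hb hw hin
  rcases h with ⟨h1, h2, e, -⟩ | ⟨h1, h2, e, -⟩ | ⟨h1, h2, e, -⟩ | ⟨h1, h2, e, -⟩
  · have hs : 0 < b := pos_of_lt_add_mul hl (s := q j 0) (by linarith)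
    exact ⟨h1, hη, Or.inr (Or.inr (Or.inr ⟨key (Or.inl ⟨by linarith, hs⟩) h₂, by linarith, Or.inl hs.ne'⟩))⟩
  · have hs : 0 < 1 - b := pos_of_lt_add_mul hl (s := q j 0) (by linarith)
    exact ⟨h1, hη, Or.inr (Or.inr (Or.inl ⟨key (Or.inr ⟨by linarith, by linarith⟩) h₂, by linarith,
      Or.inl (by linarith)⟩))⟩
  · exfalso; nlinarith [hb.2]
  · exfalso; nlinarith [hb.1]

theorem Corner.left (ha : a ∈ Icc (0 : ℝ) 1) (hb : b ∈ Icc (0 : ℝ) 1) (hw : 0 ≤ w ∧ w ≤ 1)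
    (h : IsRegularTrajectory (square 0 1) (diamond a b) q p) {j : ℕ}
    (hc : Corner a b w (p j 0) (p j 1)) (hq : q (j + 1) 0 = 0) :
    p j 0 = a - a * w ∧ p (j + 1) 1 = p j 1 ∧ Corner a b w (p (j + 1) 0) (p (j + 1) 1) := by
  have hin : InDiamond a b (p (j + 1) 0) (p (j + 1) 1) := (mem_diamond_iff ha hb).1
    ((isPolygon_diamond ha hb).isClosed.frontier_subset (h.p_mem _))
  have hlt := (square_incoming h j).2.1 hq
  obtain ⟨hη, h₂⟩ := (square_bounce ha hb h j).2.1 hq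
  obtain ⟨l, hl, h⟩ := hc.step ha hb h
  have h₂' : (-(1 - b) * (1 - p (j + 1) 0) + (1 - a) * p (j + 1) 1 = (1 - a) * b ∧ b < 1) ∨
      (-b * (1 - p (j + 1) 0) - (1 - a) * p (j + 1) 1 = -((1 - a) * b) ∧ 0 < b) :=
    h₂.symm.imp (And.imp_left fun h => by linarith) (And.imp_left fun h => by linarith)
  have key := eq_of_bounce_right (sub_nonneg.2 ha.2) hb hw hin.flip
  rcases h with ⟨h1, h2, e, -⟩ | ⟨h1, h2, e, -⟩ | ⟨h1, h2, e, -⟩ | ⟨h1, h2, e, -⟩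
  · exfalso; nlinarith [hb.1]
  · exfalso; nlinarith [hb.2]
  · have hs : 0 < 1 - b := pos_of_lt_add_mul hl (s := q (j + 1) 0) (by linarith)
    have := key (Or.inr ⟨by linarith, by linarith⟩) h₂'
    exact ⟨h1, hη, Or.inr (Or.inl ⟨by linarith, by linarith, Or.inl (by linarith)⟩)⟩
  · have hs : 0 < b := pos_of_lt_add_mul hl (s := q (j + 1) 0) (by linarith)
    have := key (Or.inl ⟨by linarith, hs⟩) h₂'
    exact ⟨h1, hη, Or.inl ⟨by linarith, by linarith, Or.inl hs.ne'⟩⟩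

theorem Corner.top (ha : a ∈ Icc (0 : ℝ) 1) (hb : b ∈ Icc (0 : ℝ) 1) (hw : 0 ≤ w ∧ w ≤ 1)
    (h : IsRegularTrajectory (square 0 1) (diamond a b) q p) {j : ℕ}
    (hc : Corner a b w (p j 0) (p j 1)) (hq : q (j + 1) 1 = 1) :
    p j 1 = 1 - (1 - b) * w ∧ p (j + 1) 0 = p j 0 ∧ Corner a b w (p (j + 1) 0) (p (j + 1) 1) := by
  have hin : InDiamond a b (p (j + 1) 0) (p (j + 1) 1) := (mem_diamond_iff ha hb).1
    ((isPolygon_diamond ha hb).isClosed.frontier_subset (h.p_mem _))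
  have hlt := (square_incoming h j).2.2.1 hq
  obtain ⟨hη, h₂⟩ := (square_bounce ha hb h j).2.2.1 hq
  obtain ⟨l, hl, h⟩ := hc.step ha hb h
  have h₂' : (-(1 - a) * p (j + 1) 1 + b * p (j + 1) 0 = b * a ∧ a < 1) ∨
      (-a * p (j + 1) 1 - b * p (j + 1) 0 = -(b * a) ∧ 0 < a) :=
    h₂.imp (And.imp_left fun h => by linarith) (And.imp_left fun h => by linarith)
  have key := eq_of_bounce_right hb.1 ha (w := 1 - w) ⟨by linarith, by linarith⟩ hin.swap
  rcases h with ⟨h1, h2, -, e⟩ | ⟨h1, h2, -, e⟩ | ⟨h1, h2, -, e⟩ | ⟨h1, h2, -, e⟩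
  · exfalso; nlinarith [ha.2]
  · have hs : 0 < 1 - a := pos_of_lt_add_mul hl (s := q j 1) (by linarith)
    have := key (Or.inr ⟨by linarith, by linarith⟩) h₂'
    exact ⟨h2, hη, Or.inl ⟨by linarith, by linarith, Or.inr (by linarith)⟩⟩
  · have hs : 0 < a := pos_of_lt_add_mul hl (s := q j 1) (by linarith)
    have := key (Or.inl ⟨by linarith, hs⟩) h₂'
    exact ⟨h2, hη, Or.inr (Or.inr (Or.inr ⟨by linarith, by linarith, Or.inr hs.ne'⟩))⟩
  · exfalso; nlinarith [ha.1]

theorem Corner.bottom (ha : a ∈ Icc (0 : ℝ) 1) (hb : b ∈ Icc (0 : ℝ) 1) (hw : 0 ≤ w ∧ w ≤ 1)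
    (h : IsRegularTrajectory (square 0 1) (diamond a b) q p) {j : ℕ}
    (hc : Corner a b w (p j 0) (p j 1)) (hq : q (j + 1) 1 = 0) :
    p j 1 = b * w ∧ p (j + 1) 0 = p j 0 ∧ Corner a b w (p (j + 1) 0) (p (j + 1) 1) := by
  have hin : InDiamond a b (p (j + 1) 0) (p (j + 1) 1) := (mem_diamond_iff ha hb).1
    ((isPolygon_diamond ha hb).isClosed.frontier_subset (h.p_mem _))
  have hlt := (square_incoming h j).2.2.2 hq
  obtain ⟨hη, h₂⟩ := (square_bounce ha hb h j).2.2.2 hq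
  obtain ⟨l, hl, h⟩ := hc.step ha hb h
  have h₂' : (-(1 - a) * (1 - p (j + 1) 1) + (1 - b) * p (j + 1) 0 = (1 - b) * a ∧ a < 1) ∨
      (-a * (1 - p (j + 1) 1) - (1 - b) * p (j + 1) 0 = -((1 - b) * a) ∧ 0 < a) :=
    h₂.imp (And.imp_left fun h => by linarith) (And.imp_left fun h => by linarith)
  have key := eq_of_bounce_right (sub_nonneg.2 hb.2) ha (w := 1 - w) ⟨by linarith, by linarith⟩
    hin.swap.flip
  rcases h with ⟨h1, h2, -, e⟩ | ⟨h1, h2, -, e⟩ | ⟨h1, h2, -, e⟩ | ⟨h1, h2, -, e⟩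
  · have hs : 0 < 1 - a := pos_of_lt_add_mul hl (s := q (j + 1) 1) (by linarith)
    have := key (Or.inr ⟨by linarith, by linarith⟩) h₂'
    exact ⟨h2, hη, Or.inr (Or.inl ⟨by linarith, by linarith, Or.inr (by linarith)⟩)⟩
  · exfalso; nlinarith [ha.2]
  · exfalso; nlinarith [ha.1]
  · have hs : 0 < a := pos_of_lt_add_mul hl (s := q (j + 1) 1) (by linarith)
    have := key (Or.inl ⟨by linarith, hs⟩) h₂'
    exact ⟨h2, hη, Or.inr (Or.inr (Or.inl ⟨by linarith, by linarith, Or.inr hs.ne'⟩))⟩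

/-- The conservation law: the whole dual trajectory stays on the corners of one inscribed rectangle.
-/
theorem exists_forall_corner (ha : a ∈ Icc (0 : ℝ) 1) (hb : b ∈ Icc (0 : ℝ) 1)
    (h : IsRegularTrajectory (square 0 1) (diamond a b) q p) :
    ∃ w : ℝ, (0 ≤ w ∧ w ≤ 1) ∧ ∀ j, Corner a b w (p j 0) (p j 1) := by
  obtain ⟨w, hw, h0⟩ := exists_corner ha hb (h.p_mem 0)
  refine ⟨w, hw, fun j => ?_⟩
  induction j with
  | zero => exact h0
  | succ j ih =>
    rcases square_side (h.q_smooth (j + 1)) with hq | hq | hq | hq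
    · exact (ih.right ha hb hw h hq.1).2.2
    · exact (ih.left ha hb hw h hq.1).2.2
    · exact (ih.top ha hb hw h hq.1).2.2
    · exact (ih.bottom ha hb hw h hq.1).2.2

theorem IsPolygon.det_eq_zero {ι : Type} {n : ι → Plane} {c : ι → ℝ} {K : Set Plane}
    (h : IsPolygon n c K) {x : Plane} (hx : IsSmoothPoint K x) {i k : ι}
    (hi : inner ℝ (n i) x = c i) (hk : inner ℝ (n k) x = c k) :
    n i 0 * n k 1 - n i 1 * n k 0 = 0 := by
  by_contra hd
  exact (h.lt_of_det_ne_zero hx (h.isClosed.frontier_subset hx.1) hi hd).ne hk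

/-- The extreme points of the diamond in horizontal direction are not both smooth. -/
theorem smooth_left_right_false (ha : a ∈ Icc (0 : ℝ) 1) (hb : b ∈ Icc (0 : ℝ) 1) {x y : Plane}
    (hx : IsSmoothPoint (diamond a b) x) (hy : IsSmoothPoint (diamond a b) y)
    (hx0 : x 0 = 0) (hx1 : x 1 = b) (hy0 : y 0 = 1) (hy1 : y 1 = b) : False := by
  have hP := isPolygon_diamond ha hb
  have h1 := hP.det_eq_zero hx (i := 2) (k := 3)
    (by simp [diamondNormal, inner_plane, hx0, hx1])
    (by simp [diamondNormal, inner_plane, hx0, hx1])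
  have h2 := hP.det_eq_zero hy (i := 0) (k := 1)
    (by simp [diamondNormal, inner_plane, hy0, hy1]; ring)
    (by simp [diamondNormal, inner_plane, hy0, hy1]; ring)
  simp [diamondNormal] at h1 h2
  linarith

/-- The extreme points of the diamond in vertical direction are not both smooth. -/
theorem smooth_bottom_top_false (ha : a ∈ Icc (0 : ℝ) 1) (hb : b ∈ Icc (0 : ℝ) 1) {x y : Plane}
    (hx : IsSmoothPoint (diamond a b) x) (hy : IsSmoothPoint (diamond a b) y)
    (hx0 : x 0 = a) (hx1 : x 1 = 0) (hy0 : y 0 = a) (hy1 : y 1 = 1) : False := by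
  have hP := isPolygon_diamond ha hb
  have h1 := hP.det_eq_zero hx (i := 0) (k := 3)
    (by simp [diamondNormal, inner_plane, hx0, hx1]; ring)
    (by simp [diamondNormal, inner_plane, hx0, hx1]; ring)
  have h2 := hP.det_eq_zero hy (i := 1) (k := 2)
    (by simp [diamondNormal, inner_plane, hy0, hy1]; ring)
    (by simp [diamondNormal, inner_plane, hy0, hy1]; ring)
  simp [diamondNormal] at h1 h2
  linarith

theorem exists_sqOrbit (ha : a ∈ Icc (0 : ℝ) 1) (hb : b ∈ Icc (0 : ℝ) 1)
    (h : IsRegularTrajectory (square 0 1) (diamond a b) q p) :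
    ∃ w : ℝ, SqOrbit a b w (fun j => q j 0) (fun j => q j 1) (fun j => p j 0) (fun j => p j 1) := by
  obtain ⟨w, hw, hc⟩ := exists_forall_corner ha hb h
  have hne : p 0 0 ≠ p 1 0 ∨ p 0 1 ≠ p 1 1 := by
    by_contra! he
    exact h.dual_step_ne_zero 0 (sub_eq_zero.2 (plane_ext he.1 he.2))
  -- For `w = 0` the rectangle is the vertical segment of the diamond; consecutive dual points would
  -- be its two ends, which are not both smooth. The case `w = 1` is the same with the horizontal
  -- segment.
  have hw0 : w ≠ 0 := by
    rintro rfl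
    have key : ∀ j, p j 0 = a ∧ (p j 1 = 0 ∨ p j 1 = 1) := by
      intro j
      rcases hc j with ⟨h1, h2, -⟩ | ⟨h1, h2, -⟩ | ⟨h1, h2, -⟩ | ⟨h1, h2, -⟩ <;>
        simp at h1 h2 <;> simp [h1, h2]
    obtain ⟨e0, h0⟩ := key 0
    obtain ⟨e1, h1⟩ := key 1
    have hne' : p 0 1 ≠ p 1 1 := hne.resolve_left (by simp [e0, e1])
    rcases h0 with h0 | h0 <;> rcases h1 with h1 | h1
    · exact hne' (h0.trans h1.symm)
    · exact smooth_bottom_top_false ha hb (h.p_smooth 0) (h.p_smooth 1) e0 h0 e1 h1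
    · exact smooth_bottom_top_false ha hb (h.p_smooth 1) (h.p_smooth 0) e1 h1 e0 h0
    · exact hne' (h0.trans h1.symm)
  have hw1 : w ≠ 1 := by
    rintro rfl
    have key : ∀ j, p j 1 = b ∧ (p j 0 = 0 ∨ p j 0 = 1) := by
      intro j
      rcases hc j with ⟨h1, h2, -⟩ | ⟨h1, h2, -⟩ | ⟨h1, h2, -⟩ | ⟨h1, h2, -⟩ <;>
        simp at h1 h2 <;> simp [h1, h2]
    obtain ⟨e0, h0⟩ := key 0
    obtain ⟨e1, h1⟩ := key 1
    have hne' : p 0 0 ≠ p 1 0 := hne.resolve_right (by simp [e0, e1])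
    rcases h0 with h0 | h0 <;> rcases h1 with h1 | h1
    · exact hne' (h0.trans h1.symm)
    · exact smooth_left_right_false ha hb (h.p_smooth 0) (h.p_smooth 1) h0 e0 h1 e1
    · exact smooth_left_right_false ha hb (h.p_smooth 1) (h.p_smooth 0) h1 e1 h0 e0
    · exact hne' (h0.trans h1.symm)
  refine ⟨w, ha, hb, ⟨lt_of_le_of_ne hw.1 hw0.symm, lt_of_le_of_ne hw.2 hw1⟩, fun j => ?_,
    fun j => (hc j).step ha hb h, fun j hq => ?_, fun j hq => ?_, fun j hq => ?_, fun j hq => ?_⟩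
  -- Leaving a side fixes the sign of one component of the direction and so leaves two of the four
  -- corners.
  · obtain ⟨o1, o2, o3, o4⟩ := square_outgoing h j
    obtain ⟨l, hl, hs⟩ := (hc j).step ha hb h
    have hla := mul_nonneg hl.le ha.1
    have hla' := mul_nonneg hl.le (sub_nonneg.2 ha.2)
    have hlb := mul_nonneg hl.le hb.1
    have hlb' := mul_nonneg hl.le (sub_nonneg.2 hb.2)
    rcases square_side (h.q_smooth j) with ⟨g1, g2, g3⟩ | ⟨g1, g2, g3⟩ | ⟨g1, g2, g3⟩ | ⟨g1, g2, g3⟩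
    · refine Or.inl ⟨g1, g2, g3, ?_⟩
      have := o1 g1
      rcases hs with ⟨h1, h2, e, -⟩ | ⟨h1, h2, e, -⟩ | ⟨h1, h2, e, -⟩ | ⟨h1, h2, e, -⟩
      exacts [by linarith, by linarith, h1, h1]
    · refine Or.inr (Or.inl ⟨g1, g2, g3, ?_⟩)
      have := o2 g1
      rcases hs with ⟨h1, h2, e, -⟩ | ⟨h1, h2, e, -⟩ | ⟨h1, h2, e, -⟩ | ⟨h1, h2, e, -⟩
      exacts [h1, h1, by linarith, by linarith]
    · refine Or.inr (Or.inr (Or.inl ⟨g1, g2, g3, ?_⟩))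
      have := o3 g1
      rcases hs with ⟨h1, h2, -, e⟩ | ⟨h1, h2, -, e⟩ | ⟨h1, h2, -, e⟩ | ⟨h1, h2, -, e⟩
      exacts [h2, by linarith, by linarith, h2]
    · refine Or.inr (Or.inr (Or.inr ⟨g1, g2, g3, ?_⟩))
      have := o4 g1
      rcases hs with ⟨h1, h2, -, e⟩ | ⟨h1, h2, -, e⟩ | ⟨h1, h2, -, e⟩ | ⟨h1, h2, -, e⟩
      exacts [by linarith, h2, h2, by linarith]
  · exact ⟨((hc j).right ha hb hw h hq).1, ((hc j).right ha hb hw h hq).2.1⟩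
  · exact ⟨((hc j).left ha hb hw h hq).1, ((hc j).left ha hb hw h hq).2.1⟩
  · exact ⟨((hc j).top ha hb hw h hq).1, ((hc j).top ha hb hw h hq).2.1⟩
  · exact ⟨((hc j).bottom ha hb hw h hq).1, ((hc j).bottom ha hb hw h hq).2.1⟩

/-! ### The lower bound for cycles in the square -/

theorem exists_forall_le_of_periodic {m : ℕ} (hm : 0 < m) {f : ℕ → ℝ} (hf : ∀ j, f (j + m) = f j) :
    ∃ i, ∀ j, f i ≤ f j := by
  obtain ⟨i, -, hi⟩ := (Finset.range m).exists_min_image f ⟨0, Finset.mem_range.2 hm⟩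
  refine ⟨i, fun j => ?_⟩
  have hper : Function.Periodic f m := hf
  rw [← hper.map_mod_nat j]
  exact hi _ (Finset.mem_range.2 (Nat.mod_lt _ hm))

theorem exists_add_eq_of_periodic {m : ℕ} (hm : 0 < m) {q : ℕ → Plane}
    (hq : ∀ j, q (j + m) = q j) (i k : ℕ) : ∃ k' ≤ m, q (k' + i) = q k := by
  have hper : Function.Periodic q m := hq
  refine ⟨(k + (m - i % m)) % m, (Nat.mod_lt _ hm).le, ?_⟩
  rw [← hper.map_mod_nat ((k + (m - i % m)) % m + i), ← hper.map_mod_nat k]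
  congr 1
  have h1 := Nat.mod_lt i hm
  have h2 := Nat.mod_add_div i m
  rw [Nat.mod_add_mod, show k + (m - i % m) + i = k + m * (1 + i / m) by
    rw [mul_add, mul_one]; omega]
  exact Nat.add_mul_mod_self_left _ _ _

/-- The two points cut the cycle into two arcs; one is compared with its chord paired with `v₁`, the
other with `v₂`. -/
theorem IsCycle.inner_add_le_action {K T : Set Plane} {m : ℕ} (h : IsCycle K T m q p)
    {v₁ v₂ : Plane} (h₁ : v₁ ∈ T) (h₂ : v₂ ∈ T) (i k : ℕ) :
    inner ℝ (q k - q i) (v₁ - v₂) ≤ action m q p := by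
  have hs := h.shift i
  rw [← h.action_shift i]
  obtain ⟨k', hk', e⟩ := exists_add_eq_of_periodic h.pos h.q_periodic i k
  have e₁ := hs.inner_le_sum_Ico h₁ (Nat.zero_le k')
  have e₂ := hs.inner_le_sum_Ico h₂ hk'
  have e₃ : q (m + i) = q i := by rw [add_comm]; exact h.q_periodic i
  rw [action, Finset.range_eq_Ico, ← Finset.sum_Ico_consecutive _ (Nat.zero_le k') hk']
  refine le_trans (le_of_eq ?_) (add_le_add e₁ e₂)
  simp only [e, e₃, zero_add, inner_sub_right, inner_sub_left]
  ring

/-- Both unit vectors are differences of points of the diamond. A cycle of action below one is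
therefore narrower than the square in both coordinates and could be moved into its interior. -/
theorem IsCycle.one_le_action (ha : a ∈ Icc (0 : ℝ) 1) (hb : b ∈ Icc (0 : ℝ) 1) {m : ℕ}
    (h : IsCycle (square 0 1) (diamond a b) m q p) : 1 ≤ action m q p := by
  by_contra! hlt
  have mem : ∀ v : Plane, (v 0 = a ∧ 0 ≤ v 1 ∧ v 1 ≤ 1) ∨ ((0 ≤ v 0 ∧ v 0 ≤ 1) ∧ v 1 = b) →
      v ∈ diamond a b := fun v hv => subset_convexHull ℝ _ hv
  have hx : ∀ i k, q k 0 - q i 0 < 1 := by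
    intro i k
    have := h.inner_add_le_action (v₁ := !₂[1, b]) (v₂ := !₂[0, b]) (mem _ (by simp))
      (mem _ (by simp)) i k
    simp [inner_plane] at this
    linarith
  have hy : ∀ i k, q k 1 - q i 1 < 1 := by
    intro i k
    have := h.inner_add_le_action (v₁ := !₂[a, 1]) (v₂ := !₂[a, 0]) (mem _ (by simp))
      (mem _ (by simp)) i k
    simp [inner_plane] at this
    linarith
  obtain ⟨i₀, hi₀⟩ := exists_forall_le_of_periodic h.pos (f := fun j => q j 0) fun j => by
    simp only [h.q_periodic]
  obtain ⟨k₀, hk₀⟩ := exists_forall_le_of_periodic h.pos (f := fun j => -q j 0) fun j => by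
    simp only [h.q_periodic]
  obtain ⟨i₁, hi₁⟩ := exists_forall_le_of_periodic h.pos (f := fun j => q j 1) fun j => by
    simp only [h.q_periodic]
  obtain ⟨k₁, hk₁⟩ := exists_forall_le_of_periodic h.pos (f := fun j => -q j 1) fun j => by
    simp only [h.q_periodic]
  -- The translation centres the bounding box of the cycle in the unit square.
  obtain ⟨j, hj⟩ := h.exists_notMem_interior (isPolygon_diamond ha hb).nonempty
    !₂[1 / 2 - (q i₀ 0 + q k₀ 0) / 2, 1 / 2 - (q i₁ 1 + q k₁ 1) / 2]
  apply hj
  have h1 := hi₀ j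
  have h2 := hk₀ j
  have h3 := hi₁ j
  have h4 := hk₁ j
  have h5 := hx i₀ k₀
  have h6 := hy i₁ k₁
  rw [isPolygon_square.eq]
  refine mem_interior_of_forall_lt fun i => Or.inl ?_
  fin_cases i <;> simp [squareNormal, inner_plane] <;> linarith

/-- The unit square and the diamond. -/
theorem isZoll_square_diamond (ha : a ∈ Icc (0 : ℝ) 1) (hb : b ∈ Icc (0 : ℝ) 1) :
    IsZoll (square 0 1) (diamond a b) 1 := by
  have key : ∀ q p, IsRegularTrajectory (square 0 1) (diamond a b) q p →
      SqClosed (fun j => q j 0) (fun j => q j 1) (fun j => p j 0) (fun j => p j 1) := by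
    intro q p h
    obtain ⟨w, hw⟩ := exists_sqOrbit ha hb h
    exact hw.closed
  refine ⟨fun q p h j => ?_, fun q p h j => ?_, fun q p h => ⟨0, ?_⟩, fun q p h => ?_,
    fun q p h => ?_, fun m q p h => h.one_le_action ha hb⟩
  · have := key _ _ (h.shift j)
    rw [add_comm j]
    refine plane_ext ?_ ?_
    · simpa using this.x_eq
    · simpa using this.y_eq
  · have := key _ _ (h.shift j)
    rw [add_comm j]
    refine plane_ext ?_ ?_
    · simpa using this.ξ_eq
    · simpa using this.η_eq
  · intro he
    have := (key _ _ h).q_ne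
    simp only [zero_add] at he
    simp [he] at this
  · by_contra! he
    have h0 := he 0
    have h1 := he 1
    have := (key _ _ h).p_ne
    simp only [zero_add, Nat.reduceAdd] at h0 h1
    simp [h0, h1] at this
  · have := (key _ _ h).action_eq
    simp only [action, Finset.sum_range_succ, Finset.sum_range_zero, inner_plane]
    simpa using this

end

end Billiard

namespace Billiard

open Set

/-! ### Orbits in a triangle, in coordinates -/

/-- The barycentric coordinates `α` of a trajectory in a triangle. The step at time `j` has the
direction of the vector from the point with barycentric coordinates `s` to the vertex `k j`, or the
opposite direction, according to `e j`. -/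
structure TriOrbit (s : Fin 3 → ℝ) (α : ℕ → Fin 3 → ℝ) (k : ℕ → Fin 3) (e : ℕ → Bool)
    (l : ℕ → ℝ) : Prop where
  s_nonneg : ∀ i, 0 ≤ s i
  side : ∀ j, ∃ i, α j i = 0 ∧ ∀ i', i' ≠ i → 0 < α j i'
  sum_eq : ∀ j, ∑ i, α j i = 1
  step : ∀ j i, α (j + 1) i = α j i +
    (bif e j then l j else -l j) * ((if i = k j then 1 else 0) - s i)
  start : ∀ j i, α j i = 0 → (k j = i ∧ e j = true) ∨ (k j ≠ i ∧ e j = false)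
  bounce : ∀ j i, α (j + 1) i = 0 →
    (k j = i ∧ e j = false ∧ k (j + 1) = i ∧ e (j + 1) = true) ∨
    (k j ≠ i ∧ e j = true ∧ k (j + 1) ≠ i ∧ k (j + 1) ≠ k j ∧ e (j + 1) = false)

namespace TriOrbit

variable {s : Fin 3 → ℝ} {α : ℕ → Fin 3 → ℝ} {k : ℕ → Fin 3} {e : ℕ → Bool} {l : ℕ → ℝ}

theorem shift (h : TriOrbit s α k e l) (m : ℕ) : TriOrbit s (fun j => α (j + m))
    (fun j => k (j + m)) (fun j => e (j + m)) (fun j => l (j + m)) where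
  s_nonneg := h.s_nonneg
  side j := h.side _
  sum_eq j := h.sum_eq _
  step j i := by simpa only [add_right_comm] using h.step (j + m) i
  start j i := h.start _ i
  bounce j i := by simpa only [add_right_comm] using h.bounce (j + m) i

/-- A step away from a vertex is followed by the reversed step. -/
theorem reverse (h : TriOrbit s α k e l) {i : Fin 3} (hi : α 0 i = 0) (he : e 0 = false) :
    k 0 ≠ i ∧ α 1 (k 0) = 0 ∧ k 1 = k 0 ∧ e 1 = true ∧ α 2 = α 0 ∧ l 1 = l 0 ∧
      l 0 * (1 - s (k 0)) = α 0 (k 0) ∧ k 2 ≠ i ∧ k 2 ≠ k 0 ∧ e 2 = false := by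
  have hki : k 0 ≠ i := by
    rcases h.start 0 i hi with h1 | h1
    · rw [he] at h1; simp at h1
    · exact h1.1
  obtain ⟨i₁, hi₁, hpos₁⟩ := h.side 1
  rcases h.bounce 0 i₁ hi₁ with ⟨h1, -, h3, h4⟩ | ⟨-, h2, -⟩
  swap
  · rw [he] at h2; simp at h2
  rw [zero_add] at h3 h4
  subst h1
  have e1 := fun i => h.step 0 i
  have e2 := fun i => h.step 1 i
  simp only [he, h4, h3, zero_add, Nat.reduceAdd, cond_false, cond_true] at e1 e2
  have hs : 0 < l 0 * s i := by
    have := hpos₁ i hki.symm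
    rw [e1 i, hi] at this
    simp [hki.symm] at this
    exact this
  have hl : 0 < s i := lt_of_le_of_ne (h.s_nonneg i) fun h0 => by rw [← h0] at hs; simp at hs
  obtain ⟨i₂, hi₂, hpos₂⟩ := h.side 2
  rcases h.bounce 1 i₂ hi₂ with ⟨-, h5, -⟩ | ⟨h5, -, h6, h7, h8⟩
  · rw [h4] at h5; simp at h5
  rw [h3] at h5 h7
  norm_num at h6 h7 h8
  -- The two steps are opposite, so the coordinates other than `k 0` change in proportion to `l 0 -
  -- l 1`. It is non-negative, hence only coordinate `i` can vanish at time two, and that forces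
  -- equal lengths.
  have e3 : ∀ i', i' ≠ k 0 → α 2 i' = α 0 i' + (l 0 - l 1) * s i' := by
    intro i' hi'
    rw [e2, e1]
    simp only [hi', if_false]
    ring
  have h2i := e3 i hki.symm
  rw [hi, zero_add] at h2i
  have hl01 : 0 ≤ l 0 - l 1 := by
    have : 0 ≤ α 2 i := by
      by_cases hii : i = i₂
      · rw [hii, hi₂]
      · exact (hpos₂ i hii).le
    rw [h2i] at this
    exact nonneg_of_mul_nonneg_left this hl
  have hi₂i : i₂ = i := by
    by_contra hne
    have h1 := e3 i₂ (Ne.symm h5)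
    rw [hi₂] at h1
    have h2 : 0 < α 0 i₂ := by
      obtain ⟨i₀, hi₀, hpos₀⟩ := h.side 0
      apply hpos₀
      rintro rfl
      by_cases hi : i = i₂
      · exact hne hi.symm
      · exact (hpos₀ i hi).ne' ‹_›
    have := mul_nonneg hl01 (h.s_nonneg i₂)
    linarith
  subst hi₂i
  have hll : l 0 - l 1 = 0 := by
    rw [hi₂] at h2i
    exact (mul_eq_zero.1 h2i.symm).resolve_right hl.ne'
  refine ⟨hki, hi₁, h3, h4, ?_, by linarith, ?_, h6, h7, h8⟩
  · ext i'
    rw [e2, e1, show l 1 = l 0 by linarith]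
    ring
  · have := e1 (k 0)
    rw [hi₁] at this
    simp at this
    linarith

theorem eq_of_ne {i j₁ j₂ a : Fin 3} (h : i ≠ j₁) (h1 : j₂ ≠ i) (h2 : j₂ ≠ j₁) (h3 : a ≠ i)
    (h4 : a ≠ j₂) : a = j₁ := by
  revert i j₁ j₂ a; decide

theorem sum_eq_of_ne (f : Fin 3 → ℝ) {i j₁ j₂ : Fin 3} (h : i ≠ j₁) (h1 : j₂ ≠ i) (h2 : j₂ ≠ j₁) :
    ∑ x, f x = f i + f j₁ + f j₂ := by
  fin_cases i <;> fin_cases j₁ <;> fin_cases j₂ <;> simp_all [Fin.sum_univ_three] <;> ring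

/-- The orbit is closed after four steps but not after two, and its length is normalized. -/
structure Closed (s : Fin 3 → ℝ) (α : ℕ → Fin 3 → ℝ) (k : ℕ → Fin 3) (e : ℕ → Bool)
    (l : ℕ → ℝ) : Prop where
  α_eq : α 4 = α 0
  k_eq : k 4 = k 0
  e_eq : e 4 = e 0
  ne : ∃ j, α (j + 2) ≠ α j ∧ k (j + 2) ≠ k j ∧ e (j + 2) = true ∧ e j = true
  length : l 0 * (1 - s (k 0)) + l 1 * (1 - s (k 1)) + l 2 * (1 - s (k 2)) +
    l 3 * (1 - s (k 3)) = 2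

/-- The orbit runs along two chords that meet in `α 1`, and back: `reverse` at time one gives `α 3 =
α 1`, and the last step undoes the first. The coordinates of `α 1` add up to one and are each
covered twice, hence the length two. -/
theorem closed_of_true (h : TriOrbit s α k e l) (he : e 0 = true) : Closed s α k e l := by
  obtain ⟨i, hi, hpos⟩ := h.side 0
  have hki : k 0 = i := by
    rcases h.start 0 i hi with h1 | h1
    · exact h1.1
    · rw [he] at h1; simp at h1
  obtain ⟨i₁, hi₁, hpos₁⟩ := h.side 1
  rcases h.bounce 0 i₁ hi₁ with ⟨-, h2, -⟩ | ⟨h1, -, h3, h4, h5⟩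
  · rw [he] at h2; simp at h2
  rw [zero_add] at h3 h4 h5
  obtain ⟨-, g1, g2, g3, g4, g5, g6, g7, g8, g9⟩ := (h.shift 1).reverse hi₁ h5
  norm_num at g1 g2 g3 g4 g5 g6 g7 g8 g9
  have hk3 : k 3 = k 0 := eq_of_ne h1.symm h3 h4 g7 g8
  obtain ⟨i₄, hi₄, -⟩ := h.side 4
  rcases h.bounce 3 i₄ hi₄ with ⟨f1, -, f3, f4⟩ | ⟨-, f2, -⟩
  swap
  · rw [g9] at f2; simp at f2
  norm_num at f3 f4
  have hi4 : i₄ = i := by rw [← f1, hk3, hki]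
  subst hi4
  have e1 := fun i => h.step 0 i
  have e4 := fun i => h.step 3 i
  simp only [he, g9, hk3, zero_add, Nat.reduceAdd, cond_false, cond_true, g4] at e1 e4
  have p1 : 0 < α 1 i₄ := hpos₁ i₄ (by rw [← hki]; exact h1)
  have e1i := e1 i₄
  have e4i := e4 i₄
  rw [hi] at e1i
  rw [hi₄] at e4i
  simp [hki] at e1i e4i
  have hs : 1 - s i₄ ≠ 0 := by
    intro h0; rw [h0, mul_zero] at e1i; linarith
  have hl : l 3 = l 0 := mul_right_cancel₀ hs (by linarith)
  refine ⟨?_, by rw [f3, hki], by rw [f4, he], ⟨0, ?_, ?_, ?_, he⟩, ?_⟩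
  · ext i
    rw [e4, e1, hl]
    ring
  · intro h0
    have := hpos (k 1) (by rw [← hki]; exact h4)
    rw [← h0] at this
    exact this.ne' g1
  · rw [zero_add, g2]; exact h4
  · rw [zero_add]; exact g3
  · have hsum := h.sum_eq 1
    rw [sum_eq_of_ne (α 1) h1.symm h3 h4, hi₁, hki] at hsum
    rw [g2, g5, g6, hk3, hl, hki]
    linarith

/-- Here the orbit starts at the common point of the two chords, so `reverse` applies at times zero
and two. -/
theorem closed_of_false (h : TriOrbit s α k e l) (he : e 0 = false) : Closed s α k e l := by
  obtain ⟨i, hi, hpos⟩ := h.side 0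
  obtain ⟨g0, g1, g2, g3, g4, g5, g6, g7, g8, g9⟩ := h.reverse hi he
  obtain ⟨f0, f1, f2, f3, f4, f5, f6, f7, f8, f9⟩ := (h.shift 2).reverse (i := i)
    (by simp [g4, hi]) (by simpa using g9)
  norm_num at f0 f1 f2 f3 f4 f5 f6 f7 f8 f9
  obtain ⟨j, hj⟩ := ((h.shift 1).closed_of_true g3).ne
  refine ⟨by rw [f4, g4], eq_of_ne g0.symm g7 g8 f7 f8, by rw [f9, he], ⟨j + 1, hj⟩, ?_⟩
  have hsum := h.sum_eq 0
  rw [sum_eq_of_ne (α 0) g0.symm g7 g8, hi] at hsum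
  rw [g4] at f6
  rw [g2, f2, g5, f5, g6, f6]
  linarith

theorem closed (h : TriOrbit s α k e l) : Closed s α k e l := by
  cases he : e 0
  · exact h.closed_of_false he
  · exact h.closed_of_true he

end TriOrbit

end Billiard

namespace Billiard

open Set

/-! ### Corners of triangles inscribed in the hexagon -/

theorem fin_three_add (i : Fin 3) : i + 1 + 1 = i + 2 ∧ i + 1 + 2 = i ∧ i + 2 + 1 = i ∧
    i + 2 + 2 = i + 1 := by
  revert i; decide

theorem fin_three_cases (i k : Fin 3) : k = i ∨ k = i + 1 ∨ k = i + 2 := by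
  revert i k; decide

theorem fin_three_ne (i : Fin 3) : i + 1 ≠ i ∧ i + 2 ≠ i ∧ i + 1 ≠ i + 2 ∧ i + 2 ≠ i + 1 := by
  revert i; decide

theorem sum_fin_three (f : Fin 3 → ℝ) (i : Fin 3) : ∑ k, f k = f i + f (i + 1) + f (i + 2) := by
  rw [Fin.sum_univ_three]
  fin_cases i
  · simp
  · have h : (1 : Fin 3) + 1 = 2 ∧ (1 : Fin 3) + 2 = 0 := by decide
    simp only [Fin.mk_one, h]
    ring
  · have h : (2 : Fin 3) + 1 = 0 ∧ (2 : Fin 3) + 2 = 1 := by decide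
    simp only [Fin.reduceFinMk, h]
    ring

/-- The slack in the constraint with label `(i, e)` of the hexagon with parameters `s`, at the point
with barycentric coordinates `β`. -/
def hexSlack (s β : Fin 3 → ℝ) (i : Fin 3) (e : Bool) : ℝ :=
  bif e then s (i + 2) * β i + (1 - s i) * β (i + 2) else s (i + 1) * β i + (1 - s i) * β (i + 1)

/-- `β` are the barycentric coordinates of the point with parameter `w` on the side of the hexagon
with label `(i, e)`. -/
def HexCorner (s : Fin 3 → ℝ) (w : ℝ) (β : Fin 3 → ℝ) (i : Fin 3) (e : Bool) : Prop :=
  β i = w * (1 - s i) ∧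
    bif e then β (i + 1) = 1 - w * s (i + 1) ∧ β (i + 2) = -(w * s (i + 2))
    else β (i + 2) = 1 - w * s (i + 2) ∧ β (i + 1) = -(w * s (i + 1))

section

variable {s β β' : Fin 3 → ℝ} {w μ : ℝ} {i : Fin 3}

theorem HexCorner.hexSlack_eq {e : Bool} (h : HexCorner s w β i e) : hexSlack s β i e = 0 := by
  obtain ⟨h1, h2⟩ := h
  cases e
  · simp only [cond_false] at h2
    simp only [hexSlack, cond_false, h1, h2]
    ring
  · simp only [cond_true] at h2
    simp only [hexSlack, cond_true, h1, h2]
    ring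

theorem hexSlack_reflect (s β : Fin 3 → ℝ) (i : Fin 3) (e : Bool) :
    hexSlack (fun k => s (-k)) (fun k => β (-k)) i e = hexSlack s β (-i) (!e) := by
  have h : -(i + 2) = -i + 1 ∧ -(i + 1) = -i + 2 := by revert i; decide
  cases e <;> simp [hexSlack, h]

theorem HexCorner.of_reflect {e : Bool}
    (h : HexCorner (fun k => s (-k)) w (fun k => β (-k)) i e) : HexCorner s w β (-i) (!e) := by
  have h' : -(i + 2) = -i + 1 ∧ -(i + 1) = -i + 2 := by clear h; revert i; decide
  cases e <;> simpa [HexCorner, h'] using h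

/-- This shows that the dual trajectory does not already have period two. -/
theorem HexCorner.ne {i' : Fin 3} {e : Bool} (h : HexCorner s w β i e) (h' : HexCorner s w β' i' e)
    (hi : i ≠ i') : β ≠ β' := by
  rintro rfl
  obtain ⟨h1, h2⟩ := h
  obtain ⟨h3, h4⟩ := h'
  have a := fin_three_add i
  rcases fin_three_cases i i' with rfl | rfl | rfl
  · exact hi rfl
  all_goals cases e <;> simp only [a, cond_false, cond_true] at h2 h3 h4 <;> linarith [h2.1, h2.2, h4.1, h4.2]

/-- The active constraint gives a parameter on the line of the side. Outside `[0, 1]` the side is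
collinear with a neighbour: a negative parameter forces `s (i + 1) = 0` and side `(i + 2, false)`,
one above one forces `s (i + 2) = 0` and side `(i + 1, false)`. -/
theorem exists_hexCorner_pos (hs : ∀ k, 0 ≤ s k) (hs1 : ∑ k, s k = 1) (hβ1 : ∑ k, β k = 1)
    (hin : ∀ k e, 0 ≤ hexSlack s β k e) (hi : s i < 1) (he : hexSlack s β i true = 0) :
    ∃ w : ℝ, (0 ≤ w ∧ w ≤ 1) ∧ ∃ k e, s k < 1 ∧ HexCorner s w β k e := by
  rw [sum_fin_three _ i] at hs1 hβ1
  have a := fin_three_add i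
  have g1 := hin (i + 1) true
  have g2 := hin (i + 1) false
  have g3 := hin (i + 2) true
  have g4 := hin (i + 2) false
  have s0 := hs i
  have s1 := hs (i + 1)
  have s2 := hs (i + 2)
  simp only [hexSlack, cond_true, cond_false, a] at he g1 g2 g3 g4
  have hp : 0 < 1 - s i := by linarith
  obtain ⟨w, hw⟩ : ∃ w, β i = w * (1 - s i) := ⟨β i / (1 - s i), by field_simp⟩
  have h2 : β (i + 2) = -(w * s (i + 2)) := by
    apply mul_left_cancel₀ hp.ne'
    rw [hw] at he
    linear_combination he
  have h1 : β (i + 1) = 1 - w * s (i + 1) := by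
    linear_combination hβ1 - hw - h2 + w * hs1
  rw [h1, h2] at g2 g3
  rw [hw, h1] at g1
  rw [hw, h2] at g4
  have k2 : 0 ≤ s (i + 2) * (1 - w) := by linear_combination g2
  have k4 : 0 ≤ w * s (i + 1) := by
    have : s i = 1 - s (i + 1) - s (i + 2) := by linarith
    rw [this] at g4
    linear_combination g4
  by_cases hw1 : w ≤ 1
  · by_cases hw0 : 0 ≤ w
    · exact ⟨w, ⟨hw0, hw1⟩, i, true, hi, hw, h1, h2⟩
    · have z1 : s (i + 1) = 0 := by nlinarith
      have hp2 : 0 < 1 - s (i + 2) := by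
        by_contra hc
        have : s i = 0 := by linarith
        rw [this, z1] at g1
        linarith
      obtain ⟨w', hw'⟩ : ∃ w', β (i + 2) = w' * (1 - s (i + 2)) :=
        ⟨β (i + 2) / (1 - s (i + 2)), by field_simp⟩
      have e0 : 0 ≤ w' * (1 - s (i + 2)) := by rw [← hw', h2]; nlinarith
      refine ⟨w', ⟨nonneg_of_mul_nonneg_left e0 hp2, ?_⟩, i + 2, false, by linarith, ?_⟩
      · rw [z1] at g1 hs1
        by_contra! hc
        have : 1 - s (i + 2) < w' * (1 - s (i + 2)) := by nlinarith
        rw [← hw', h2] at this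
        have : s i = 1 - s (i + 2) := by linarith
        rw [this] at g1
        linarith
      · have e1 : s i = 1 - s (i + 2) := by linarith
        refine ⟨hw', ?_⟩
        simp only [a, cond_false, h1, z1]
        refine ⟨by ring, ?_⟩
        rw [e1, ← hw', h2, hw, e1]
        ring
  · have z2 : s (i + 2) = 0 := by nlinarith
    have g3' : 0 ≤ 1 - w * s (i + 1) := by rw [z2] at g3; linarith
    have hp1 : 0 < 1 - s (i + 1) := by
      by_contra hc
      have : 1 * 1 < w * s (i + 1) := by
        have := mul_le_mul_of_nonneg_left (not_lt.1 hc) (show 0 ≤ w by linarith)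
        linarith
      linarith
    obtain ⟨w', hw'⟩ : ∃ w', β (i + 1) = w' * (1 - s (i + 1)) :=
      ⟨β (i + 1) / (1 - s (i + 1)), by field_simp⟩
    have e0 : 0 ≤ w' * (1 - s (i + 1)) := by rw [← hw', h1]; exact g3'
    have e1 : s i = 1 - s (i + 1) := by linarith
    refine ⟨w', ⟨nonneg_of_mul_nonneg_left e0 hp1, ?_⟩, i + 1, false, by linarith, hw', ?_⟩
    · by_contra! hc
      have : 1 - s (i + 1) < w' * (1 - s (i + 1)) := by nlinarith
      rw [← hw', h1] at this
      have := mul_nonneg s1 (show 0 ≤ w - 1 by linarith)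
      linarith
    · simp only [a, cond_false, h2, z2]
      refine ⟨?_, by ring⟩
      rw [e1, ← hw', h1, hw, e1]
      ring

/-- The reflection `k ↦ -k` of the labels exchanges the two values of `e`. -/
theorem exists_hexCorner (hs : ∀ k, 0 ≤ s k) (hs1 : ∑ k, s k = 1) (hβ1 : ∑ k, β k = 1)
    (hin : ∀ k e, 0 ≤ hexSlack s β k e) (hi : s i < 1) {e : Bool} (he : hexSlack s β i e = 0) :
    ∃ w : ℝ, (0 ≤ w ∧ w ≤ 1) ∧ ∃ k e, s k < 1 ∧ HexCorner s w β k e := by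
  cases e
  · obtain ⟨w, hw, k, e, hk, h⟩ := exists_hexCorner_pos (s := fun k => s (-k))
      (β := fun k => β (-k)) (i := -i) (fun k => hs _)
      (by rw [← hs1]; exact Equiv.sum_comp (Equiv.neg (Fin 3)) s)
      (by rw [← hβ1]; exact Equiv.sum_comp (Equiv.neg (Fin 3)) β)
      (fun k e => by rw [hexSlack_reflect]; exact hin _ _) (by simpa using hi)
      (by rw [hexSlack_reflect]; simpa using he)
    exact ⟨w, hw, -k, !e, hk, h.of_reflect⟩
  · exact exists_hexCorner_pos hs hs1 hβ1 hin hi he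

/-- `β'` is obtained from `β` by moving by `-μ` times the normal of side `i`, and is a point where the
outgoing direction can point away from side `i`. -/
structure HexBounce (s β β' : Fin 3 → ℝ) (i : Fin 3) (μ : ℝ) : Prop where
  mem : ∀ k e, 0 ≤ hexSlack s β' k e
  eq₀ : β' i = β i
  eq₁ : β' (i + 1) = β (i + 1) + μ
  eq₂ : β' (i + 2) = β (i + 2) - μ
  active : (hexSlack s β' i true = 0 ∧ s i < 1) ∨
    ((hexSlack s β' (i + 1) false = 0 ∨ hexSlack s β' (i + 2) false = 0) ∧ 0 < s i)

/-- The new point is known up to `μ`. The constraint of the target side bounds `μ` from above, and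
whichever constraint is active bounds it from below by the same value, here `1 - w`. The two lemmas
below use the same scheme with the values `w` and `1`. -/
theorem HexCorner.bounce_succ (hs : ∀ k, 0 ≤ s k) (hs1 : ∑ k, s k = 1) (hw : 0 ≤ w ∧ w ≤ 1)
    (h : HexCorner s w β (i + 1) true) (hb : HexBounce s β β' i μ) (hi : 0 < s i) :
    HexCorner s w β' (i + 2) false := by
  rw [sum_fin_three _ i] at hs1
  have a := fin_three_add i
  have s1 := hs (i + 1)
  have s2 := hs (i + 2)
  obtain ⟨h1, h2, h0⟩ := h
  obtain ⟨hin, e0, e1, e2, hact⟩ := hb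
  have g := hin (i + 2) false
  simp only [a] at h2 h0
  simp only [hexSlack, cond_true, cond_false, a, e0, e1, e2, h0, h1, h2] at g hact
  have hμ : μ ≤ 1 - w := by
    have : 0 ≤ s i * (1 - w - μ) := by linear_combination g
    have := nonneg_of_mul_nonneg_right this hi
    linarith
  have key : μ = 1 - w := by
    refine le_antisymm hμ ?_
    rcases hact with ⟨hact, hi1⟩ | ⟨hact | hact, -⟩
    · have e3 : (1 - s i) * (1 - w - μ) = -(w * s (i + 1)) := by
        linear_combination hact + w * hs1
      have : 0 ≤ w * s (i + 1) := mul_nonneg hw.1 s1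
      by_contra! hc
      have := mul_pos (sub_pos.2 hi1) (sub_pos.2 hc)
      linarith
    · have e3 : s i * (μ - 1) = s (i + 2) := by
        linear_combination -hact + (μ - 1) * hs1
      have : 0 ≤ μ - 1 := nonneg_of_mul_nonneg_right (by rw [e3]; exact s2) hi
      linarith
    · have : s i * (1 - w - μ) = 0 := by linear_combination hact
      have := (mul_eq_zero.1 this).resolve_left hi.ne'
      linarith
  refine ⟨?_, ?_⟩
  · rw [e2, h2, key]; ring
  · simp only [a, cond_false]
    exact ⟨by rw [e1, h1, key]; ring, by rw [e0, h0]⟩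

theorem HexCorner.bounce_add_two (hs : ∀ k, 0 ≤ s k) (hs1 : ∑ k, s k = 1) (hw : 0 ≤ w ∧ w ≤ 1)
    (h : HexCorner s w β (i + 2) true) (hb : HexBounce s β β' i μ) (hi : 0 < s i) :
    HexCorner s w β' (i + 1) false := by
  rw [sum_fin_three _ i] at hs1
  have a := fin_three_add i
  have s1 := hs (i + 1)
  have s2 := hs (i + 2)
  obtain ⟨h2, h0, h1⟩ := h
  obtain ⟨hin, e0, e1, e2, hact⟩ := hb
  have g := hin (i + 1) false
  simp only [a] at h1 h0
  simp only [hexSlack, cond_true, cond_false, a, e0, e1, e2, h0, h1, h2] at g hact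
  have hμ : μ ≤ w := by
    have : 0 ≤ s i * (w - μ) := by linear_combination g + (μ - w) * hs1
    have := nonneg_of_mul_nonneg_right this hi
    linarith
  have key : μ = w := by
    refine le_antisymm hμ ?_
    rcases hact with ⟨hact, hi1⟩ | ⟨hact | hact, -⟩
    · have e3 : (1 - s i) * (w - μ) = -(s (i + 2) * (1 - w)) := by
        linear_combination hact
      have : 0 ≤ s (i + 2) * (1 - w) := mul_nonneg s2 (by linarith)
      by_contra! hc
      have := mul_pos (sub_pos.2 hi1) (sub_pos.2 hc)
      linarith
    · have : s i * (w - μ) = 0 := by linear_combination hact + (w - μ) * hs1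
      have := (mul_eq_zero.1 this).resolve_left hi.ne'
      linarith
    · have e3 : s i * (μ - 1) = s (i + 1) := by
        linear_combination -hact - hs1
      have : 0 ≤ μ - 1 := nonneg_of_mul_nonneg_right (by rw [e3]; exact s1) hi
      linarith
  refine ⟨?_, ?_⟩
  · rw [e1, h1, key]; ring
  · simp only [a, cond_false]
    exact ⟨by rw [e0, h0], by rw [e2, h2, key]; ring⟩

theorem HexCorner.bounce_self (hs : ∀ k, 0 ≤ s k) (hs1 : ∑ k, s k = 1) (hw : 0 ≤ w ∧ w ≤ 1)
    (h : HexCorner s w β i false) (hb : HexBounce s β β' i μ) (hi : s i < 1) :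
    HexCorner s w β' i true := by
  rw [sum_fin_three _ i] at hs1
  have a := fin_three_add i
  have s1 := hs (i + 1)
  have s2 := hs (i + 2)
  obtain ⟨h0, h2, h1⟩ := h
  obtain ⟨hin, e0, e1, e2, hact⟩ := hb
  have g := hin i true
  simp only [hexSlack, cond_true, cond_false, a, e0, e1, e2, h0, h1, h2] at g hact
  have hp : 0 < 1 - s i := by linarith
  have hμ : μ ≤ 1 := by
    have : 0 ≤ (1 - s i) * (1 - μ) := by linear_combination g
    have := nonneg_of_mul_nonneg_right this hp
    linarith
  have key : μ = 1 := by
    refine le_antisymm hμ ?_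
    rcases hact with ⟨hact, -⟩ | ⟨hact | hact, hi0⟩
    · have : (1 - s i) * (1 - μ) = 0 := by linear_combination hact
      have := (mul_eq_zero.1 this).resolve_left hp.ne'
      linarith
    · have e3 : s i * (μ - 1) = s (i + 2) * (1 - w) := by
        linear_combination -hact + (μ - 1) * hs1
      have : 0 ≤ s (i + 2) * (1 - w) := mul_nonneg s2 (by linarith)
      have : 0 ≤ μ - 1 := nonneg_of_mul_nonneg_right (by rw [e3]; exact this) hi0
      linarith
    · have e3 : s i * (μ - 1) = w * s (i + 1) := by
        linear_combination -hact - w * hs1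
      have : 0 ≤ w * s (i + 1) := mul_nonneg hw.1 s1
      have : 0 ≤ μ - 1 := nonneg_of_mul_nonneg_right (by rw [e3]; exact this) hi0
      linarith
  refine ⟨?_, ?_⟩
  · rw [e0, h0]
  · simp only [cond_true]
    exact ⟨by rw [e1, h1, key]; ring, by rw [e2, h2, key]; ring⟩

end

end Billiard

namespace Billiard

open Set

/-! ### The standard triangle and the hexagon -/

/-- The outer normals of the standard triangle. -/
noncomputable def triNormal : Fin 3 → Plane := ![!₂[1, 1], !₂[-1, 0], !₂[0, -1]]

/-- The barycentric coordinates with respect to the standard triangle. -/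
def bary (x : Plane) : Fin 3 → ℝ := ![1 - x 0 - x 1, x 0, x 1]

/-- The barycentric coordinates with respect to the rotated standard triangle. -/
def cobary (p : Plane) : Fin 3 → ℝ := ![1 + p 1 - p 0, -p 1, p 0]

/-- The triangle with vertices `0`, `e₁`, `e₂`. -/
def stdTriangle : Set Plane := {x | ∀ i, 0 ≤ bary x i}

/-- The vector from the point with barycentric coordinates `s` to the `k`-th vertex of the standard
triangle. -/
noncomputable def hexVec (s : Fin 3 → ℝ) : Fin 3 → Plane :=
  ![!₂[-s 1, -s 2], !₂[1 - s 1, -s 2], !₂[-s 1, 1 - s 2]]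

/-- The outer normals of the hexagon. -/
noncomputable def hexNormal (s : Fin 3 → ℝ) (a : Fin 3 × Bool) : Plane :=
  bif a.2 then hexVec s a.1 else -hexVec s a.1

/-- The values of the support function of the hexagon at its normals. -/
def hexBound (s : Fin 3 → ℝ) (a : Fin 3 × Bool) : ℝ :=
  bif a.2 then (![s 2, 1 - s 1, 0] : Fin 3 → ℝ) a.1 else (![s 1, 0, 1 - s 2] : Fin 3 → ℝ) a.1

/-- The hexagon with parameters `s`. -/
def hexagon (s : Fin 3 → ℝ) : Set Plane := {p | ∀ k e, 0 ≤ hexSlack s (cobary p) k e}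

theorem inner_triNormal (x : Plane) (i : Fin 3) :
    inner ℝ (triNormal i) x = (![1, 0, 0] : Fin 3 → ℝ) i - bary x i := by
  fin_cases i <;> simp [triNormal, bary, inner_plane]
  ring

theorem sum_bary (x : Plane) : ∑ i, bary x i = 1 := by
  simp [Fin.sum_univ_three, bary]
  ring

theorem sum_cobary (x : Plane) : ∑ i, cobary x i = 1 := by
  simp [Fin.sum_univ_three, cobary]
  ring

theorem bary_injective : Function.Injective bary := fun x y h =>
  plane_ext (by simpa [bary] using congrFun h 1) (by simpa [bary] using congrFun h 2)

theorem cobary_injective : Function.Injective cobary := fun x y h =>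
  plane_ext (by simpa [cobary] using congrFun h 2) (by simpa [cobary] using congrFun h 1)

theorem triNormal_ne_zero (i : Fin 3) : triNormal i ≠ 0 := by
  intro h
  have h0 := congrArg (fun z : Plane => z 0) h
  have h1 := congrArg (fun z : Plane => z 1) h
  fin_cases i <;> simp [triNormal] at h0 h1

theorem isPolygon_stdTriangle : IsPolygon triNormal ![1, 0, 0] stdTriangle := by
  have heq : stdTriangle = {x | ∀ i, inner ℝ (triNormal i) x ≤ (![1, 0, 0] : Fin 3 → ℝ) i} := by
    ext x
    exact forall_congr' fun i => by rw [inner_triNormal, sub_le_self_iff]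
  refine ⟨heq, ?_, ?_⟩
  · refine isCompact_of_forall_coord (heq ▸ isClosed_halfplanes _ _) 1 fun x hx i => ?_
    have h0 := hx 0
    have h1 := hx 1
    have h2 := hx 2
    simp [bary] at h0 h1 h2
    fin_cases i
    · exact abs_le.2 ⟨by simp; linarith, by simp; linarith⟩
    · exact abs_le.2 ⟨by simp; linarith, by simp; linarith⟩
  · rw [heq]
    refine ⟨!₂[1 / 3, 1 / 3], mem_interior_of_forall_lt fun i => Or.inl ?_⟩
    rw [inner_triNormal, sub_lt_self_iff]
    fin_cases i <;> simp [bary]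
    norm_num

theorem stdTriangle_side {x : Plane} (hx : IsSmoothPoint stdTriangle x) :
    ∃ i, bary x i = 0 ∧ ∀ i', i' ≠ i → 0 < bary x i' := by
  have hP := isPolygon_stdTriangle
  have hxK := hP.isClosed.frontier_subset hx.1
  obtain ⟨i, -, hi⟩ := hP.exists_active hx.1
  refine ⟨i, by rw [inner_triNormal] at hi; linarith, fun i' hne => ?_⟩
  have := hP.lt_of_det_ne_zero (k := i') hx hxK hi (by
    revert hne
    clear hi
    revert i i'
    simp [Fin.forall_fin_succ, triNormal])
  rw [inner_triNormal] at this
  linarith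

section

variable {s : Fin 3 → ℝ}

theorem le_one_of_sum_eq_one (hs1 : ∑ k, s k = 1) (hs : ∀ k, 0 ≤ s k) (k : Fin 3) : s k ≤ 1 := by
  rw [← hs1]
  exact Finset.single_le_sum (fun k _ => hs k) (Finset.mem_univ _)

theorem inner_triNormal_hexVec (hs1 : ∑ k, s k = 1) (i k : Fin 3) :
    inner ℝ (triNormal i) (hexVec s k) = s i - (if i = k then 1 else 0) := by
  rw [Fin.sum_univ_three] at hs1
  fin_cases i <;> fin_cases k <;> simp [triNormal, hexVec, inner_plane] <;> linarith

theorem hexVec_ne_zero_iff (hs1 : ∑ k, s k = 1) (hs : ∀ k, 0 ≤ s k) (k : Fin 3) :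
    hexVec s k ≠ 0 ↔ s k < 1 := by
  constructor
  · intro h
    by_contra! hk
    apply h
    rw [Fin.sum_univ_three] at hs1
    have h0 := hs 0
    have h1 := hs 1
    have h2 := hs 2
    refine plane_ext ?_ ?_ <;> fin_cases k <;> simp [hexVec] at * <;> linarith
  · intro hk h
    have := inner_triNormal_hexVec hs1 k k
    rw [h] at this
    simp at this
    linarith

theorem hexNormal_ne_zero_iff (hs1 : ∑ k, s k = 1) (hs : ∀ k, 0 ≤ s k) (a : Fin 3 × Bool) :
    hexNormal s a ≠ 0 ↔ s a.1 < 1 := by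
  rw [← hexVec_ne_zero_iff hs1 hs]
  rcases a with ⟨k, e⟩
  cases e <;> simp [hexNormal]

theorem hexSlack_cobary (hs1 : ∑ k, s k = 1) (p : Plane) (a : Fin 3 × Bool) :
    hexSlack s (cobary p) a.1 a.2 = hexBound s a - inner ℝ (hexNormal s a) p := by
  rw [Fin.sum_univ_three] at hs1
  have h1 : (1 : Fin 3) + 1 = 2 := rfl
  have h2 : (1 : Fin 3) + 2 = 0 := rfl
  have h3 : (2 : Fin 3) + 1 = 0 := rfl
  have h4 : (2 : Fin 3) + 2 = 1 := rfl
  have e0 : s 0 = 1 - s 1 - s 2 := by linarith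
  rcases a with ⟨k, e⟩
  fin_cases k <;> cases e <;>
    simp [hexSlack, cobary, hexBound, hexNormal, hexVec, inner_plane, h1, h2, h3, h4, e0] <;> ring

theorem mem_hexagon_iff (hs1 : ∑ k, s k = 1) {p : Plane} :
    p ∈ hexagon s ↔ ∀ a, inner ℝ (hexNormal s a) p ≤ hexBound s a := by
  rw [Prod.forall]
  refine forall₂_congr fun k e => ?_
  rw [hexSlack_cobary hs1 p (k, e), sub_nonneg]

/-- The centre of symmetry of the hexagon. -/
noncomputable def hexCenter (s : Fin 3 → ℝ) : Plane := !₂[(1 - s 2) / 2, -((1 - s 1) / 2)]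

theorem inner_hexCenter (hs1 : ∑ k, s k = 1) (a : Fin 3 × Bool) :
    inner ℝ (hexNormal s a) (hexCenter s) = hexBound s a - (1 - s a.1) / 2 := by
  have e := hexSlack_cobary hs1 (hexCenter s) a
  have e' : cobary (hexCenter s) = fun k => (1 - s k) / 2 := by
    rw [Fin.sum_univ_three] at hs1
    funext k
    fin_cases k <;> simp [cobary, hexCenter]
    linarith
  have e'' : hexSlack s (fun k => (1 - s k) / 2) a.1 a.2 = (1 - s a.1) / 2 := by
    cases a.2 <;> · simp only [hexSlack, cond_true, cond_false]; ring
  rw [e', e''] at e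
  linarith

theorem isPolygon_hexagon (hs1 : ∑ k, s k = 1) (hs : ∀ k, 0 ≤ s k) :
    IsPolygon (hexNormal s) (hexBound s) (hexagon s) := by
  have heq : hexagon s = {p | ∀ a, inner ℝ (hexNormal s a) p ≤ hexBound s a} := by
    ext p
    exact mem_hexagon_iff hs1
  refine ⟨heq, ?_, ?_⟩
  · refine isCompact_of_forall_coord (heq ▸ isClosed_halfplanes _ _) 1 fun p hp i => ?_
    have key : ∀ i, cobary p i ≤ 1 := by
      intro i
      have h1 := sum_cobary p
      rw [sum_fin_three _ i] at h1
      -- These two slacks add up to the sum of the coordinates `i + 1` and `i + 2`, so coordinate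
      -- `i` is at most one.
      have h2 := hp (i + 1) false
      have h3 := hp (i + 2) true
      simp only [hexSlack, fin_three_add i, cond_true, cond_false] at h2 h3
      nlinarith
    have h0 := key 0
    have h1 := key 1
    have h2 := key 2
    simp [cobary] at h0 h1 h2
    fin_cases i
    · exact abs_le.2 ⟨by simp; linarith, by simp; linarith⟩
    · exact abs_le.2 ⟨by simp; linarith, by simp; linarith⟩
  · rw [heq]
    refine ⟨hexCenter s, mem_interior_of_forall_lt fun a => ?_⟩
    have e := inner_hexCenter hs1 a
    by_cases h : s a.1 < 1
    · left; linarith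
    · have h0 : hexNormal s a = 0 := by
        by_contra hne
        exact h ((hexNormal_ne_zero_iff hs1 hs a).1 hne)
      refine Or.inr ⟨h0, ?_⟩
      rw [h0, inner_zero_left] at e
      have := le_one_of_sum_eq_one hs1 hs a.1
      linarith

end

end Billiard

/-! ### Regular trajectories in the standard triangle with a hexagon. -/

namespace Billiard

open Set

section

variable {s : Fin 3 → ℝ} {q p : ℕ → Plane} {w : ℝ}

theorem inner_triNormal_hexNormal (hs1 : ∑ k, s k = 1) (i k : Fin 3) (e : Bool) :
    inner ℝ (triNormal i) (hexNormal s (k, e)) =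
      bif e then s i - (if i = k then 1 else 0) else (if i = k then 1 else 0) - s i := by
  cases e <;> simp [hexNormal, inner_triNormal_hexVec hs1]

theorem cobary_bounce {x y : Plane} {μ : ℝ} {i : Fin 3} (h : x - y = μ • triNormal i) :
    cobary y i = cobary x i ∧ cobary y (i + 1) = cobary x (i + 1) + μ ∧
      cobary y (i + 2) = cobary x (i + 2) - μ := by
  have h0 := congrArg (fun z : Plane => z 0) h
  have h1 := congrArg (fun z : Plane => z 1) h
  have a1 : (1 : Fin 3) + 1 = 2 := rfl
  have a2 : (1 : Fin 3) + 2 = 0 := rfl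
  have a3 : (2 : Fin 3) + 1 = 0 := rfl
  have a4 : (2 : Fin 3) + 2 = 1 := rfl
  fin_cases i <;> simp [triNormal] at h0 h1 <;> simp [cobary, a1, a2, a3, a4] <;>
    refine ⟨?_, ?_, ?_⟩ <;> linarith

theorem HexCorner.inner_eq (hs1 : ∑ k, s k = 1) {x : Plane} {k : Fin 3} {e : Bool}
    (hc : HexCorner s w (cobary x) k e) : inner ℝ (hexNormal s (k, e)) x = hexBound s (k, e) := by
  have h1 := hexSlack_cobary hs1 x (k, e)
  have h2 := hc.hexSlack_eq
  simp only at h1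
  linarith

theorem HexCorner.step (hs1 : ∑ k, s k = 1) (hs : ∀ k, 0 ≤ s k)
    (h : IsRegularTrajectory stdTriangle (hexagon s) q p) {j : ℕ} {k : Fin 3} {e : Bool}
    (hk : s k < 1) (hc : HexCorner s w (cobary (p j)) k e) :
    ∃ l : ℝ, 0 < l ∧ q (j + 1) - q j = l • hexNormal s (k, e) :=
  h.exists_smul_normal ((isPolygon_hexagon hs1 hs).mem_normalCone (hc.inner_eq hs1))
    ((hexNormal_ne_zero_iff hs1 hs _).2 hk)

/-- The active constraint comes from the outgoing step: its normal points away from side `i`, which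
restricts its label by the signs in `inner_triNormal_hexNormal`. -/
theorem hexBounce_of_bary_eq_zero (hs1 : ∑ k, s k = 1) (hs : ∀ k, 0 ≤ s k)
    (h : IsRegularTrajectory stdTriangle (hexagon s) q p) {j : ℕ} {i : Fin 3}
    (hi : bary (q (j + 1)) i = 0) : ∃ μ, HexBounce s (cobary (p j)) (cobary (p (j + 1))) i μ := by
  have hT := isPolygon_hexagon hs1 hs
  obtain ⟨⟨μ, -, hμ⟩, -, ⟨k, e⟩, hact, hneg⟩ := h.bounce isPolygon_stdTriangle hT
    (triNormal_ne_zero i) (by rw [inner_triNormal, hi, sub_zero])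
  obtain ⟨e0, e1, e2⟩ := cobary_bounce hμ
  refine ⟨μ, hT.isClosed.frontier_subset (h.p_mem _), e0, e1, e2, ?_⟩
  have hact' : hexSlack s (cobary (p (j + 1))) k e = 0 := by
    rw [hexSlack_cobary hs1 (p (j + 1)) (k, e), hact, sub_self]
  rw [inner_triNormal_hexNormal hs1] at hneg
  have hi0 := hs i
  cases e
  · simp only [cond_false] at hneg
    have hki : k ≠ i := by
      rintro rfl
      have := le_one_of_sum_eq_one hs1 hs k
      simp at hneg
      linarith
    refine Or.inr ⟨?_, by simpa [hki.symm] using hneg⟩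
    rcases fin_three_cases i k with rfl | rfl | rfl
    · exact absurd rfl hki
    · exact Or.inl hact'
    · exact Or.inr hact'
  · simp only [cond_true] at hneg
    have hki : i = k := by
      by_contra hne
      simp [hne] at hneg
      linarith
    subst hki
    exact Or.inl ⟨hact', by simpa using hneg⟩

/-- The conservation of `w` together with the transition rule for the labels. The incoming step
points out through side `i`, so its label is `(i, false)` or `(k, true)` with `k ≠ i`, which selects
the bounce lemma. -/
theorem HexCorner.next (hs1 : ∑ k, s k = 1) (hs : ∀ k, 0 ≤ s k) (hw : 0 ≤ w ∧ w ≤ 1)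
    (h : IsRegularTrajectory stdTriangle (hexagon s) q p) {j : ℕ} {k : Fin 3} {e : Bool}
    (hk : s k < 1) (hc : HexCorner s w (cobary (p j)) k e) :
    ∃ k' e', (s k' < 1 ∧ HexCorner s w (cobary (p (j + 1))) k' e') ∧
      ∀ i, bary (q (j + 1)) i = 0 → (k = i ∧ e = false ∧ k' = i ∧ e' = true) ∨
        (k ≠ i ∧ e = true ∧ k' ≠ i ∧ k' ≠ k ∧ e' = false) := by
  obtain ⟨i, hi, hpos⟩ := stdTriangle_side (h.q_smooth (j + 1))
  have huniq : ∀ i', bary (q (j + 1)) i' = 0 → i' = i := by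
    intro i' h0
    by_contra hne
    exact (hpos i' hne).ne' h0
  obtain ⟨μ, hb⟩ := hexBounce_of_bary_eq_zero hs1 hs h hi
  have hin := h.bounce isPolygon_stdTriangle (isPolygon_hexagon hs1 hs)
    (triNormal_ne_zero i) (by rw [inner_triNormal, hi, sub_zero]) |>.2.1 (k, e)
    ((hexNormal_ne_zero_iff hs1 hs _).2 hk) (hc.inner_eq hs1)
  rw [inner_triNormal_hexNormal hs1] at hin
  have hi0 := hs i
  obtain ⟨n1, n2, n3, n4⟩ := fin_three_ne i
  cases e
  · simp only [cond_false] at hin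
    have hki : i = k := by
      by_contra hne
      simp [hne] at hin
      linarith
    subst hki
    refine ⟨i, true, ⟨hk, hc.bounce_self hs hs1 hw hb hk⟩, fun i' h0 => ?_⟩
    rw [huniq i' h0]
    simp
  · simp only [cond_true] at hin
    have hki : i ≠ k := by
      rintro rfl
      simp at hin
      linarith
    have hip : 0 < s i := by simpa [hki] using hin
    have hlt := hs1
    rw [sum_fin_three _ i] at hlt
    rcases fin_three_cases i k with rfl | rfl | rfl
    · exact absurd rfl hki
    · refine ⟨i + 2, false, ⟨by linarith [hs (i + 1)], hc.bounce_succ hs hs1 hw hb hip⟩,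
        fun i' h0 => ?_⟩
      rw [huniq i' h0]
      simp [n1, n2, n4]
    · refine ⟨i + 1, false, ⟨by linarith [hs (i + 2)], hc.bounce_add_two hs hs1 hw hb hip⟩,
        fun i' h0 => ?_⟩
      rw [huniq i' h0]
      simp [n1, n2, n3]

theorem exists_seq_of_forall_exists {α : Type} {P : ℕ → α → Prop} {R : ℕ → α → α → Prop}
    (h0 : ∃ x, P 0 x) (h : ∀ n x, P n x → ∃ y, P (n + 1) y ∧ R n x y) :
    ∃ f : ℕ → α, ∀ n, P n (f n) ∧ R n (f n) (f (n + 1)) := by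
  choose! g hg using h
  obtain ⟨x, hx⟩ := h0
  let f : ℕ → α := fun n => Nat.rec x g n
  have hf : ∀ n, P n (f n) := by
    intro n
    induction n with
    | zero => exact hx
    | succ n ih => exact (hg n _ ih).1
  exact ⟨f, fun n => ⟨hf n, (hg n _ (hf n)).2⟩⟩

theorem exists_triOrbit (hs1 : ∑ k, s k = 1) (hs : ∀ k, 0 ≤ s k)
    (h : IsRegularTrajectory stdTriangle (hexagon s) q p) :
    ∃ (w : ℝ) (k : ℕ → Fin 3) (e : ℕ → Bool) (l : ℕ → ℝ),
      TriOrbit s (fun j => bary (q j)) k e l ∧ (∀ j, HexCorner s w (cobary (p j)) (k j) (e j)) ∧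
        ∀ j, q (j + 1) - q j = l j • hexNormal s (k j, e j) := by
  have hT := isPolygon_hexagon hs1 hs
  have h0 : ∃ w : ℝ, (0 ≤ w ∧ w ≤ 1) ∧ ∃ k e, s k < 1 ∧ HexCorner s w (cobary (p 0)) k e := by
    obtain ⟨⟨k, e⟩, hne, hk⟩ := hT.exists_active (h.p_mem 0)
    refine exists_hexCorner hs hs1 (sum_cobary _) (hT.isClosed.frontier_subset (h.p_mem 0))
      ((hexNormal_ne_zero_iff hs1 hs _).1 hne) (e := e) ?_
    rw [hexSlack_cobary hs1 (p 0) (k, e), hk, sub_self]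
  obtain ⟨w, hw, k₀, e₀, h0⟩ := h0
  obtain ⟨f, hf⟩ := exists_seq_of_forall_exists
    (P := fun j (a : Fin 3 × Bool) => s a.1 < 1 ∧ HexCorner s w (cobary (p j)) a.1 a.2)
    (R := fun j a a' => ∀ i, bary (q (j + 1)) i = 0 →
      (a.1 = i ∧ a.2 = false ∧ a'.1 = i ∧ a'.2 = true) ∨
        (a.1 ≠ i ∧ a.2 = true ∧ a'.1 ≠ i ∧ a'.1 ≠ a.1 ∧ a'.2 = false)) ⟨(k₀, e₀), h0⟩
    (fun j a ha => by
      obtain ⟨k', e', h1, h2⟩ := HexCorner.next hs1 hs hw h ha.1 ha.2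
      exact ⟨(k', e'), h1, h2⟩)
  choose l hl0 hl using fun j => HexCorner.step hs1 hs h (hf j).1.1 (hf j).1.2
  have hin : ∀ j i, inner ℝ (triNormal i) (q (j + 1) - q j) =
      l j * bif (f j).2 then s i - (if i = (f j).1 then 1 else 0)
        else (if i = (f j).1 then 1 else 0) - s i := by
    intro j i
    rw [hl, inner_smul_right, inner_triNormal_hexNormal hs1]
  refine ⟨w, fun j => (f j).1, fun j => (f j).2, l, ⟨hs, fun j => stdTriangle_side (h.q_smooth j),
    fun j => sum_bary _, fun j i => ?_, fun j i hi => ?_, fun j i => (hf j).2 i⟩,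
    fun j => (hf j).1.2, fun j => hl j⟩
  · have := hin j i
    rw [inner_sub_right, inner_triNormal, inner_triNormal] at this
    cases he : (f j).2 <;> rw [he] at this <;> simp only [cond_true, cond_false] at this ⊢ <;>
      linarith
  · have hneg := h.inner_normal_neg isPolygon_stdTriangle.isClosed
      (isPolygon_stdTriangle.mem_normalCone (i := i) (by rw [inner_triNormal, hi, sub_zero]))
      (triNormal_ne_zero i)
    rw [hin] at hneg
    replace hneg := neg_of_mul_neg_right hneg (hl0 j).le
    have hi0 := hs i
    have hi1 := le_one_of_sum_eq_one hs1 hs i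
    cases he : (f j).2 <;> rw [he] at hneg <;> simp only [cond_true, cond_false] at hneg
    · right
      refine ⟨fun hk => ?_, rfl⟩
      simp [hk] at hneg
      linarith
    · left
      refine ⟨?_, rfl⟩
      by_contra hk
      simp [Ne.symm hk] at hneg
      linarith

/-- Measured from the centre, the hexagon has support value `(1 - s k) / 2` at the normals with
label `k`; the centre itself contributes only the displacement from start to end. -/
theorem action_hexagon (hs1 : ∑ k, s k = 1) {k : ℕ → Fin 3} {e : ℕ → Bool} {l : ℕ → ℝ}
    (hc : ∀ j, HexCorner s w (cobary (p j)) (k j) (e j))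
    (hl : ∀ j, q (j + 1) - q j = l j • hexNormal s (k j, e j)) (m : ℕ) :
    action m q p = inner ℝ (q m - q 0) (hexCenter s) +
      ∑ j ∈ Finset.range m, l j * (1 - s (k j)) / 2 := by
  rw [← Finset.sum_range_sub, action, sum_inner, ← Finset.sum_add_distrib]
  refine Finset.sum_congr rfl fun j _ => ?_
  rw [hl, inner_smul_left, inner_smul_left, (hc j).inner_eq hs1, inner_hexCenter hs1]
  simp only [conj_trivial]
  ring

end

end Billiard

namespace Billiard

open Set

/-! ### The lower bound for cycles in the triangle -/

theorem IsCycle.inner_add_inner_le_action {K T : Set Plane} {m : ℕ} {q p : ℕ → Plane}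
    (h : IsCycle K T m q p) {a b : ℕ} (hab : a ≤ b) (hb : b ≤ m) {v₁ v₂ v₃ : Plane} (h₁ : v₁ ∈ T)
    (h₂ : v₂ ∈ T) (h₃ : v₃ ∈ T) :
    inner ℝ (q a - q 0) v₁ + inner ℝ (q b - q a) v₂ + inner ℝ (q 0 - q b) v₃ ≤ action m q p := by
  have e₁ := h.inner_le_sum_Ico h₁ (Nat.zero_le a)
  have e₂ := h.inner_le_sum_Ico h₂ hab
  have e₃ := h.inner_le_sum_Ico h₃ hb
  have hm : q m = q 0 := by simpa using h.q_periodic 0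
  rw [hm] at e₃
  rw [action, Finset.range_eq_Ico, ← Finset.sum_Ico_consecutive _ (Nat.zero_le b) hb,
    ← Finset.sum_Ico_consecutive _ (Nat.zero_le a) hab]
  linarith

/-- A cycle visits three of its points in one of the two cyclic orders. -/
theorem IsCycle.three_points {K T : Set Plane} {m : ℕ} {q p : ℕ → Plane} (h : IsCycle K T m q p)
    (i₀ i₁ i₂ : ℕ) {v₁ v₂ v₃ u₁ u₂ u₃ : Plane} (hv₁ : v₁ ∈ T) (hv₂ : v₂ ∈ T) (hv₃ : v₃ ∈ T)
    (hu₁ : u₁ ∈ T) (hu₂ : u₂ ∈ T) (hu₃ : u₃ ∈ T) :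
    inner ℝ (q i₁ - q i₀) v₁ + inner ℝ (q i₂ - q i₁) v₂ + inner ℝ (q i₀ - q i₂) v₃ ≤
        action m q p ∨
      inner ℝ (q i₂ - q i₀) u₁ + inner ℝ (q i₁ - q i₂) u₂ + inner ℝ (q i₀ - q i₁) u₃ ≤
        action m q p := by
  have hs := h.shift i₀
  rw [← h.action_shift i₀]
  obtain ⟨a, ha, ea⟩ := exists_add_eq_of_periodic h.pos h.q_periodic i₀ i₁
  obtain ⟨b, hb, eb⟩ := exists_add_eq_of_periodic h.pos h.q_periodic i₀ i₂
  rcases le_total a b with hab | hab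
  · left
    simpa only [ea, eb, zero_add] using hs.inner_add_inner_le_action hab hb hv₁ hv₂ hv₃
  · right
    simpa only [ea, eb, zero_add] using hs.inner_add_inner_le_action hab ha hu₁ hu₂ hu₃

section

variable {s : Fin 3 → ℝ} {q p : ℕ → Plane} {w : ℝ}

/-- The vertices of the rotated standard triangle. -/
noncomputable def rotVertex : Fin 3 → Plane := ![0, !₂[0, -1], !₂[1, 0]]

theorem cobary_rotVertex (i k : Fin 3) : cobary (rotVertex i) k = if k = i then 1 else 0 := by
  fin_cases i <;> fin_cases k <;> simp [cobary, rotVertex]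

theorem cobary_reflect (hs1 : ∑ k, s k = 1) (x : Plane) (k : Fin 3) :
    cobary (2 • hexCenter s - x) k = 1 - s k - cobary x k := by
  rw [Fin.sum_univ_three] at hs1
  fin_cases k <;> simp [cobary, hexCenter, two_smul] <;> linarith

theorem rotVertex_mem_hexagon (hs1 : ∑ k, s k = 1) (hs : ∀ k, 0 ≤ s k) (i : Fin 3) :
    rotVertex i ∈ hexagon s := by
  intro k e
  have h1 := hs (k + 1)
  have h2 := hs (k + 2)
  have h3 := le_one_of_sum_eq_one hs1 hs k
  cases e <;> simp only [hexSlack, cobary_rotVertex, cond_true, cond_false] <;> split_ifs <;> linarith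

theorem reflect_mem_hexagon (hs1 : ∑ k, s k = 1) {x : Plane} (hx : x ∈ hexagon s) :
    2 • hexCenter s - x ∈ hexagon s := by
  intro k e
  have hβ := sum_cobary x
  have hs1' := hs1
  rw [sum_fin_three _ k] at hs1' hβ
  have e0 : s (k + 1) = 1 - s k - s (k + 2) := by linarith
  have e1 : cobary x (k + 1) = 1 - cobary x k - cobary x (k + 2) := by linarith
  have h := hx k (!e)
  cases e <;> simp only [Bool.not_false, Bool.not_true, hexSlack, cond_true, cond_false,
    cobary_reflect hs1, e0, e1] at h ⊢ <;> linarith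

/-- The minima of the barycentric coordinates along a cycle of action below one have a positive sum
`σ`, so the cycle fits into a smaller copy of the triangle and can be moved into the interior. -/
theorem IsCycle.one_le_action_hexagon (hs1 : ∑ k, s k = 1) (hs : ∀ k, 0 ≤ s k) {m : ℕ}
    (h : IsCycle stdTriangle (hexagon s) m q p) : 1 ≤ action m q p := by
  by_contra! hlt
  choose i hi using fun k : Fin 3 => exists_forall_le_of_periodic h.pos
    (f := fun j => bary (q j) k) fun j => by simp only [h.q_periodic]
  have hu := rotVertex_mem_hexagon hs1 hs
  have hv := fun i => reflect_mem_hexagon hs1 (hu i)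
  have hsum : 0 < bary (q (i 0)) 0 + bary (q (i 1)) 1 + bary (q (i 2)) 2 := by
    -- The vertices of the rotated triangle suit one cyclic order, those of its reflection the
    -- other. In both cases the left-hand side is one minus the sum of the three minima.
    rcases h.three_points (i 0) (i 1) (i 2) (hv 2) (hv 0) (hv 1) (hu 1) (hu 0) (hu 2) with h1 | h1
    · simp [inner_plane, rotVertex, two_smul] at h1
      simp [bary]
      linarith
    · simp [inner_plane, rotVertex] at h1
      simp [bary]
      linarith
  set σ := bary (q (i 0)) 0 + bary (q (i 1)) 1 + bary (q (i 2)) 2 with hσ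
  -- After this translation each barycentric coordinate is at least `σ / 3`.
  obtain ⟨j, hj⟩ := h.exists_notMem_interior (isPolygon_hexagon hs1 hs).nonempty
    !₂[σ / 3 - bary (q (i 1)) 1, σ / 3 - bary (q (i 2)) 2]
  apply hj
  have h0 := hi 0 j
  have h1 := hi 1 j
  have h2 := hi 2 j
  rw [isPolygon_stdTriangle.eq]
  refine mem_interior_of_forall_lt fun i => Or.inl ?_
  rw [inner_triNormal, sub_lt_self_iff]
  simp [bary] at h0 h1 h2 hσ
  fin_cases i <;> simp [bary] <;> linarith

/-- The standard triangle and the hexagon. -/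
theorem isZoll_stdTriangle_hexagon (hs1 : ∑ k, s k = 1) (hs : ∀ k, 0 ≤ s k) :
    IsZoll stdTriangle (hexagon s) 1 := by
  have hq : ∀ q p, IsRegularTrajectory stdTriangle (hexagon s) q p → q 4 = q 0 ∧ p 4 = p 0 ∧
      (∃ j, q (j + 2) ≠ q j ∧ p (j + 2) ≠ p j) ∧ action 4 q p = 1 := by
    intro q p h
    obtain ⟨w, k, e, l, ho, hc, hl⟩ := exists_triOrbit hs1 hs h
    obtain ⟨h1, h2, h3, ⟨j, h4, h5, h6, h7⟩, h8⟩ := ho.closed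
    have hq4 : q 4 = q 0 := bary_injective h1
    refine ⟨hq4, ?_, ⟨j, fun he => h4 (congrArg bary he), fun he => ?_⟩, ?_⟩
    · have g0 := hc 0
      have g4 := hc 4
      rw [h2, h3] at g4
      apply cobary_injective
      funext i
      obtain ⟨a1, a2⟩ := g0
      obtain ⟨b1, b2⟩ := g4
      rcases fin_three_cases (k 0) i with rfl | rfl | rfl
      · rw [a1, b1]
      all_goals
        cases he : e 0 <;> rw [he] at a2 b2 <;> simp only [cond_true, cond_false] at a2 b2
        · simp only [a2, b2]
        · simp only [a2, b2]
    · have g1 := hc j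
      have g2 := hc (j + 2)
      rw [h6] at g2
      rw [h7] at g1
      exact g2.ne g1 h5 (congrArg cobary he)
    · rw [action_hexagon hs1 hc hl, hq4]
      simp only [sub_self, inner_zero_left, Finset.sum_range_succ, Finset.sum_range_zero]
      linarith
  refine ⟨fun q p h j => ?_, fun q p h j => ?_, fun q p h => ?_, fun q p h => ?_,
    fun q p h => (hq q p h).2.2.2, fun m q p h => h.one_le_action_hexagon hs1 hs⟩
  · simpa [add_comm] using (hq _ _ (h.shift j)).1
  · simpa [add_comm] using (hq _ _ (h.shift j)).2.1
  · obtain ⟨j, hj, -⟩ := (hq q p h).2.2.1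
    exact ⟨j, hj⟩
  · obtain ⟨j, -, hj⟩ := (hq q p h).2.2.1
    exact ⟨j, hj⟩

end

end Billiard

namespace Billiard

open Set MeasureTheory

/-! ### The hull of a triangle and a reflected triangle -/

section Hull

variable {s : Fin 3 → ℝ} {t : Plane}

theorem cobary_rotJ (x : Plane) : cobary (rotJ x) = bary x := by
  funext k
  fin_cases k <;> simp [cobary, bary, rotJ]
  ring

theorem convex_hullJ (Δ : Set Plane) (t : Plane) : Convex ℝ (hullJ Δ t) := convex_convexHull ℝ _

theorem rotJ_mem_hullJ {Δ : Set Plane} {x : Plane} (hx : x ∈ Δ) : rotJ x ∈ hullJ Δ t :=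
  subset_convexHull ℝ _ (Or.inl ⟨x, hx, rfl⟩)

theorem sub_rotJ_mem_hullJ {Δ : Set Plane} {x : Plane} (hx : x ∈ Δ) : t - rotJ x ∈ hullJ Δ t :=
  subset_convexHull ℝ _ (Or.inr ⟨x, hx, by simp only; abel⟩)

theorem exists_rotJ_eq_rotVertex (i : Fin 3) : ∃ x ∈ stdTriangle, rotJ x = rotVertex i := by
  refine ⟨![0, !₂[1, 0], !₂[0, 1]] i, fun k => ?_, plane_ext ?_ ?_⟩
  · fin_cases i <;> fin_cases k <;> simp [bary]
  · fin_cases i <;> simp [rotJ, rotVertex]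
  · fin_cases i <;> simp [rotJ, rotVertex]

theorem rotVertex_mem_hullJ (i : Fin 3) : rotVertex i ∈ hullJ stdTriangle t := by
  obtain ⟨x, hx, e⟩ := exists_rotJ_eq_rotVertex i
  exact e ▸ rotJ_mem_hullJ hx

theorem sub_rotVertex_mem_hullJ (i : Fin 3) : t - rotVertex i ∈ hullJ stdTriangle t := by
  obtain ⟨x, hx, e⟩ := exists_rotJ_eq_rotVertex i
  exact e ▸ sub_rotJ_mem_hullJ hx

theorem hullJ_subset_hexagon (hs1 : ∑ k, s k = 1) (hs : ∀ k, 0 ≤ s k) :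
    hullJ stdTriangle (2 • hexCenter s) ⊆ hexagon s := by
  have key : ∀ x ∈ stdTriangle, rotJ x ∈ hexagon s := by
    intro x hx k e
    rw [cobary_rotJ]
    have h := le_one_of_sum_eq_one hs1 hs k
    cases e
    · exact add_nonneg (mul_nonneg (hs _) (hx _)) (mul_nonneg (sub_nonneg.2 h) (hx _))
    · exact add_nonneg (mul_nonneg (hs _) (hx _)) (mul_nonneg (sub_nonneg.2 h) (hx _))
  refine convexHull_min ?_ (isPolygon_hexagon hs1 hs).convex
  rintro - (⟨x, hx, rfl⟩ | ⟨x, hx, rfl⟩)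
  · exact key x hx
  · have := reflect_mem_hexagon hs1 (key x hx)
    rwa [sub_eq_neg_add] at this

/-- A point of the hexagon lies in the rotated triangle or, if coordinate `i` is negative, in the
triangle spanned by the two vertices other than `i` and the reflected vertex `i`. -/
theorem hexagon_subset_hullJ (hs1 : ∑ k, s k = 1) (hs : ∀ k, 0 ≤ s k) :
    hexagon s ⊆ hullJ stdTriangle (2 • hexCenter s) := by
  intro p hp
  by_cases hneg : ∃ i, cobary p i < 0
  · obtain ⟨i, hi⟩ := hneg
    have a := fin_three_add i
    obtain ⟨n1, n2, n3, n4⟩ := fin_three_ne i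
    have h1 := hp (i + 1) true
    have h2 := hp (i + 2) false
    simp only [hexSlack, cond_true, cond_false, a] at h1 h2
    have hs1' := hs1
    have hβ := sum_cobary p
    rw [sum_fin_three _ i] at hs1' hβ
    have hpos : 0 < s i := by
      refine lt_of_le_of_ne (hs i) fun h0 => ?_
      rw [← h0] at h1 h2 hs1'
      nlinarith
    -- The reflected vertex has `i`-th coordinate `-s i` and the other two vertices have zero, so
    -- `z` must be its weight.
    obtain ⟨z, hz⟩ : ∃ z, cobary p i = -(z * s i) :=
      ⟨-cobary p i / s i, by field_simp⟩
    have hz0 : 0 ≤ z := by nlinarith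
    have hx : 0 ≤ cobary p (i + 1) - z * (1 - s (i + 1)) := by
      refine nonneg_of_mul_nonneg_right (a := s i) ?_ hpos
      rw [hz] at h1
      linarith
    have hy : 0 ≤ cobary p (i + 2) - z * (1 - s (i + 2)) := by
      refine nonneg_of_mul_nonneg_right (a := s i) ?_ hpos
      rw [hz] at h2
      linarith
    have e : p = (cobary p (i + 1) - z * (1 - s (i + 1))) • rotVertex (i + 1) +
        (cobary p (i + 2) - z * (1 - s (i + 2))) • rotVertex (i + 2) +
        z • (2 • hexCenter s - rotVertex i) := by
      clear h1 h2 hx hy hpos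
      have b1 : (1 : Fin 3) + 1 = 2 := rfl
      have b2 : (1 : Fin 3) + 2 = 0 := rfl
      have b3 : (2 : Fin 3) + 1 = 0 := rfl
      have b4 : (2 : Fin 3) + 2 = 1 := rfl
      rw [Fin.sum_univ_three] at hs1
      have e0 : s 0 = 1 - s 1 - s 2 := by linarith
      refine plane_ext ?_ ?_ <;> fin_cases i <;>
        simp [cobary, rotVertex, hexCenter, two_smul, b1, b2, b3, b4, e0] at hz ⊢ <;> linarith
    rw [e]
    have := (convex_hullJ stdTriangle (2 • hexCenter s)).sum_mem (t := Finset.univ)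
      (w := ![cobary p (i + 1) - z * (1 - s (i + 1)), cobary p (i + 2) - z * (1 - s (i + 2)), z])
      (z := ![rotVertex (i + 1), rotVertex (i + 2), 2 • hexCenter s - rotVertex i])
      (by intro k _; fin_cases k; exacts [hx, hy, hz0])
      (by simp [Fin.sum_univ_three]; linear_combination hβ - hz + z * hs1')
      (by
        intro k _
        fin_cases k
        exacts [rotVertex_mem_hullJ (i + 1), rotVertex_mem_hullJ (i + 2), sub_rotVertex_mem_hullJ i])
    simpa [Fin.sum_univ_three] using this
  · push Not at hneg
    have e : rotJ !₂[-p 1, p 0] = p := plane_ext (by simp [rotJ]) (by simp [rotJ])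
    rw [← e]
    apply rotJ_mem_hullJ
    rw [← e, cobary_rotJ] at hneg
    exact hneg

theorem hullJ_eq_hexagon (hs1 : ∑ k, s k = 1) (hs : ∀ k, 0 ≤ s k) :
    hullJ stdTriangle (2 • hexCenter s) = hexagon s :=
  (hullJ_subset_hexagon hs1 hs).antisymm (hexagon_subset_hullJ hs1 hs)

/-! ### Linear maps given by their columns, and areas -/

/-- The linear map with columns `u` and `v`. -/
noncomputable def columnMap (u v : Plane) : Plane →ₗ[ℝ] Plane where
  toFun x := x 0 • u + x 1 • v
  map_add' x y := by simp only [PiLp.add_apply, add_smul]; abel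
  map_smul' r x := by simp only [PiLp.smul_apply, smul_add, smul_smul, smul_eq_mul, RingHom.id_apply]

theorem columnMap_apply (u v x : Plane) : columnMap u v x = x 0 • u + x 1 • v := rfl

theorem det_columnMap (u v : Plane) : LinearMap.det (columnMap u v) = u 0 * v 1 - u 1 * v 0 := by
  rw [← LinearMap.det_toMatrix (EuclideanSpace.basisFun (Fin 2) ℝ).toBasis, Matrix.det_fin_two]
  simp [LinearMap.toMatrix_apply, columnMap_apply]
  ring

theorem volume_image_add (f : Plane →ₗ[ℝ] Plane) (c : Plane) (S : Set Plane) :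
    volume ((fun x => f x + c) '' S) = ENNReal.ofReal |LinearMap.det f| * volume S := by
  rw [← Measure.addHaar_image_linearMap, ← image_image (fun y => y + c) f, image_add_right,
    measure_preimage_add_right]

theorem volume_square_ne_zero : volume (square 0 1) ≠ 0 :=
  fun h => (isOpen_interior.measure_pos volume isPolygon_square.nonempty).ne'
    (measure_mono_null interior_subset h)

theorem ofReal_det_mul_le_volume {C : Set Plane} (hC : Convex ℝ C) {x u v : Plane} (h0 : x ∈ C)
    (hu : u + x ∈ C) (hv : v + x ∈ C) (huv : u + v + x ∈ C) :
    ENNReal.ofReal |u 0 * v 1 - u 1 * v 0| * volume (square 0 1) ≤ volume C := by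
  rw [← det_columnMap, ← volume_image_add _ x]
  refine measure_mono ?_
  rintro - ⟨y, hy, rfl⟩
  obtain ⟨y0, y1⟩ := mem_square_iff.1 hy
  have a := hC h0 hu (sub_nonneg.2 y0.2) y0.1 (by ring)
  have b := hC hv huv (sub_nonneg.2 y0.2) y0.1 (by ring)
  have := hC a b (sub_nonneg.2 y1.2) y1.1 (by ring)
  convert this using 1
  refine plane_ext ?_ ?_ <;> simp [columnMap_apply] <;> ring

/-- A competitor for the minimal area: for this translation both triangles lie in one translate of
the unit square. -/
theorem volume_hullJ_le : volume (hullJ stdTriangle !₂[1, -1]) ≤ volume (square 0 1) := by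
  have e := volume_image_add LinearMap.id !₂[0, -1] (square 0 1)
  simp only [LinearMap.id_apply, LinearMap.det_id, abs_one, ENNReal.ofReal_one, one_mul] at e
  rw [← e]
  refine measure_mono (convexHull_min ?_ ?_)
  · rintro - (⟨x, hx, rfl⟩ | ⟨x, hx, rfl⟩) <;>
    · have h0 := hx 0
      have h1 := hx 1
      have h2 := hx 2
      simp [bary] at h0 h1 h2
      refine ⟨_ - !₂[0, -1], mem_square_iff.2 ?_, sub_add_cancel _ _⟩
      simp [rotJ]
      refine ⟨⟨?_, ?_⟩, ?_, ?_⟩ <;> linarith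
  · have := isPolygon_square.convex.translate_preimage_right (-!₂[(0 : ℝ), -1])
    convert this using 1
    simp only [image_add_right]
    ext x
    simp [add_comm]

/-- If the hull has minimal area, then the parameters of the hexagon are non-negative. -/
theorem nonneg_of_minimal (hs1 : ∑ k, s k = 1)
    (hmin : ∀ t', volume (hullJ stdTriangle (2 • hexCenter s)) ≤ volume (hullJ stdTriangle t'))
    (i : Fin 3) : 0 ≤ s i := by
  have h1 := (hmin _).trans volume_hullJ_le
  -- Two vertices of the rotated triangle and their reflections span a parallelogram of area `|1 - s
  -- i|` inside the hull. As the minimal area is at most one, `s i` cannot be negative.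
  have key := ofReal_det_mul_le_volume (convex_hullJ stdTriangle (2 • hexCenter s))
    (x := rotVertex (i + 1)) (u := rotVertex (i + 2) - rotVertex (i + 1))
    (v := 2 • hexCenter s - rotVertex (i + 2) - rotVertex (i + 1)) (rotVertex_mem_hullJ _)
    (by simpa using rotVertex_mem_hullJ _) (by simpa using sub_rotVertex_mem_hullJ _)
    (by
      convert sub_rotVertex_mem_hullJ (t := 2 • hexCenter s) (i + 1) using 1
      abel)
  have hfin : volume (square 0 1) ≠ ⊤ := isPolygon_square.compact.measure_lt_top.ne
  have h2 := key.trans h1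
  nth_rewrite 2 [← one_mul (volume (square 0 1))] at h2
  rw [ENNReal.mul_le_mul_iff_left volume_square_ne_zero hfin, ENNReal.ofReal_le_one] at h2
  replace h2 := (le_abs_self _).trans h2
  have b1 : (1 : Fin 3) + 1 = 2 := rfl
  have b2 : (1 : Fin 3) + 2 = 0 := rfl
  have b3 : (2 : Fin 3) + 1 = 0 := rfl
  have b4 : (2 : Fin 3) + 2 = 1 := rfl
  rw [Fin.sum_univ_three] at hs1
  fin_cases i <;> simp [rotVertex, hexCenter, two_smul, b1, b2, b3, b4] at h2 ⊢ <;> linarith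

end Hull

end Billiard

namespace Billiard

open Set MeasureTheory

/-! ### Pairs of polygons -/

/-- A pair of polygons all of whose regular trajectories are closed and minimizing. -/
def IsZollPair (K T : Set Plane) : Prop :=
  (∃ (ι : Type) (_ : Finite ι) (n : ι → Plane) (c : ι → ℝ), IsPolygon n c K) ∧
    (∃ (κ : Type) (_ : Finite κ) (m : κ → Plane) (d : κ → ℝ), IsPolygon m d T) ∧
      ∃ L, IsZoll K T L

namespace IsZollPair

variable {K T : Set Plane}

theorem image (h : IsZollPair K T) {φ ψ : Plane ≃ₗ[ℝ] Plane} {r : ℝ} (hr : 0 < r)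
    (hφψ : ∀ x y, inner ℝ (φ x) (ψ y) = r * inner ℝ x y) (c v : Plane) :
    IsZollPair ((fun x => φ x + c) '' K) ((fun y => ψ y + v) '' T) := by
  obtain ⟨⟨ι, hι, n, c', hK⟩, ⟨κ, hκ, m, d, hT⟩, L, hZ⟩ := h
  obtain ⟨n', c'', hK'⟩ := hK.image φ c
  obtain ⟨m', d', hT'⟩ := hT.image ψ v
  exact ⟨⟨ι, hι, n', c'', hK'⟩, ⟨κ, hκ, m', d', hT'⟩, r * L, hZ.image hr hφψ⟩

theorem dual (h : IsZollPair K T) : IsZollPair T (Neg.neg '' K) := by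
  obtain ⟨⟨ι, hι, n, c, hK⟩, ⟨κ, hκ, m, d, hT⟩, L, hZ⟩ := h
  rw [image_neg_eq_neg]
  exact ⟨⟨κ, hκ, m, d, hT⟩, ⟨ι, hι, _, _, hK.neg⟩, L, hZ.dual hT.isClosed hK.nonempty⟩

theorem smul_add (h : IsZollPair K T) {r : ℝ} (hr : 0 < r) (v : Plane) :
    IsZollPair K ((fun y => r • y + v) '' T) := by
  simpa using h.image (φ := LinearEquiv.refl ℝ Plane) (ψ := LinearEquiv.smulOfNeZero ℝ Plane r hr.ne')
    hr (fun x y => by simp [inner_smul_right]) 0 v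

end IsZollPair

/-! ### The equality cases -/

theorem isZollPair_square {a a₁ a₂ : ℝ} (ha : 0 < a) (h₁ : a₁ ∈ Icc (0 : ℝ) 1)
    (h₂ : a₂ ∈ Icc (0 : ℝ) 1) (c : Plane) : IsZollPair (square c a) (diamond a₁ a₂) := by
  have h : IsZollPair (square 0 1) (diamond a₁ a₂) :=
    ⟨⟨_, inferInstance, _, _, isPolygon_square⟩, ⟨_, inferInstance, _, _, isPolygon_diamond h₁ h₂⟩, 1,
      isZoll_square_diamond h₁ h₂⟩
  have h' := h.image (φ := LinearEquiv.smulOfNeZero ℝ Plane a ha.ne') (ψ := LinearEquiv.refl ℝ Plane)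
    ha (fun x y => by simp [inner_smul_left]) c 0
  have e : (fun x => LinearEquiv.smulOfNeZero ℝ Plane a ha.ne' x + c) '' square 0 1 = square c a := by
    ext x
    constructor
    · rintro ⟨y, hy, rfl⟩ i
      obtain ⟨h1, h2⟩ := hy i
      simp only [PiLp.zero_apply, zero_add] at h1 h2
      simp only [LinearEquiv.smulOfNeZero_apply, PiLp.add_apply, PiLp.smul_apply, smul_eq_mul]
      constructor <;> nlinarith
    · intro hx
      refine ⟨a⁻¹ • (x - c), fun i => ?_, by simp [smul_smul, ha.ne']⟩
      obtain ⟨h1, h2⟩ := hx i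
      simp only [PiLp.zero_apply, zero_add, PiLp.smul_apply, PiLp.sub_apply, smul_eq_mul]
      exact ⟨mul_nonneg (by positivity) (by linarith), by
        rw [inv_mul_le_iff₀ ha]; linarith⟩
  rw [e] at h'
  simpa using h'

/-- The dual of the square case: diamond and reflected square, transported by `φ` and its inverse
adjoint. -/
theorem isZollPair_trapezoid (φ : Plane ≃ₗ[ℝ] Plane) {a₁ a₂ : ℝ} (h₁ : a₁ ∈ Icc (0 : ℝ) 1)
    (h₂ : a₂ ∈ Icc (0 : ℝ) 1) (c : Plane) :
    IsZollPair ((fun x => φ x + c) '' diamond a₁ a₂) (dualParallelogram φ) := by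
  have hinv : ∀ y : Plane, LinearMap.adjoint (φ : Plane →ₗ[ℝ] Plane)
      (LinearMap.adjoint (φ.symm : Plane →ₗ[ℝ] Plane) y) = y := fun y => by
    refine ext_inner_right ℝ fun x => ?_
    simp [LinearMap.adjoint_inner_left]
  have hinv' : ∀ y : Plane, LinearMap.adjoint (φ.symm : Plane →ₗ[ℝ] Plane)
      (LinearMap.adjoint (φ : Plane →ₗ[ℝ] Plane) y) = y := fun y => by
    refine ext_inner_right ℝ fun x => ?_
    simp [LinearMap.adjoint_inner_left]
  let ψ : Plane ≃ₗ[ℝ] Plane := LinearEquiv.ofLinearMap (LinearMap.adjoint (φ.symm : Plane →ₗ[ℝ] Plane))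
    (LinearMap.adjoint (φ : Plane →ₗ[ℝ] Plane)) (LinearMap.ext hinv') (LinearMap.ext hinv)
  have hψ : ∀ y, ψ y = LinearMap.adjoint (φ.symm : Plane →ₗ[ℝ] Plane) y := fun y => rfl
  -- The translation by `ψ (1, 1)` moves the image of the reflected square back to that of the unit
  -- square.
  have h := (isZollPair_square one_pos h₁ h₂ 0).dual.image (φ := φ) (ψ := ψ) one_pos
    (fun x y => by rw [hψ, LinearMap.adjoint_inner_right]; simp) c (ψ !₂[1, 1])
  convert h using 1
  rw [image_image]
  ext x
  constructor
  · intro hx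
    refine ⟨!₂[1, 1] - LinearMap.adjoint (φ : Plane →ₗ[ℝ] Plane) x, ?_, ?_⟩
    · obtain ⟨h0, h1⟩ := mem_square_iff.1 hx
      refine mem_square_iff.2 ?_
      simp only [PiLp.sub_apply]
      simp
      exact ⟨⟨h0.2, h0.1⟩, h1.2, h1.1⟩
    · simp only
      rw [← map_add, hψ]
      simp [hinv']
  · rintro ⟨y, hy, rfl⟩
    obtain ⟨h0, h1⟩ := mem_square_iff.1 hy
    simp only
    rw [← map_add, hψ]
    refine mem_square_iff.2 ?_
    rw [hinv]
    simp
    exact ⟨⟨h0.2, h0.1⟩, h1.2, h1.1⟩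

/-- The linear equivalence with columns `u` and `v`. -/
noncomputable def columnEquiv (u v : Plane) (h : u 0 * v 1 - u 1 * v 0 ≠ 0) : Plane ≃ₗ[ℝ] Plane :=
  (columnMap u v).equivOfDetNeZero (by rwa [det_columnMap])

theorem columnEquiv_apply {u v : Plane} (h : u 0 * v 1 - u 1 * v 0 ≠ 0) (x : Plane) :
    columnEquiv u v h x = x 0 • u + x 1 • v := rfl

theorem image_add_convexHull (f : Plane →ₗ[ℝ] Plane) (c : Plane) (S : Set Plane) :
    (fun x => f x + c) '' convexHull ℝ S = convexHull ℝ ((fun x => f x + c) '' S) :=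
  (f.toAffineMap + AffineMap.const ℝ Plane c).image_convexHull S

theorem stdTriangle_eq_convexHull : stdTriangle = convexHull ℝ {0, !₂[1, 0], !₂[0, 1]} := by
  refine Subset.antisymm (fun x hx => ?_) (convexHull_min ?_ isPolygon_stdTriangle.convex)
  · have := (convex_convexHull ℝ ({0, !₂[1, 0], !₂[0, 1]} : Set Plane)).sum_mem (t := Finset.univ)
      (w := bary x) (z := ![0, !₂[1, 0], !₂[0, 1]]) (fun k _ => hx k) (sum_bary x)
      (by
        intro k _
        apply subset_convexHull
        fin_cases k <;> simp)
    convert this using 1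
    refine plane_ext ?_ ?_ <;> simp [Fin.sum_univ_three, bary]
  · rintro x (rfl | rfl | rfl) <;> intro i <;> fin_cases i <;> simp [bary]

theorem det_ne_zero_of_affineIndependent {A B C : Plane} (h : AffineIndependent ℝ ![A, B, C]) :
    (B - A) 0 * (C - A) 1 - (B - A) 1 * (C - A) 0 ≠ 0 := by
  intro hd
  have key : ∀ a b : ℝ, a • (B - A) + b • (C - A) = 0 → a = 0 ∧ b = 0 := by
    intro a b hab
    have := affineIndependent_iff.1 h Finset.univ ![-(a + b), a, b]
      (by simp [Fin.sum_univ_three])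
      (by
        rw [← hab]
        simp only [Fin.sum_univ_three, Matrix.cons_val_zero, Matrix.cons_val_one, Matrix.cons_val]
        module)
    exact ⟨by simpa using this 1 (Finset.mem_univ _), by simpa using this 2 (Finset.mem_univ _)⟩
  have k0 := key ((C - A) 0) (-(B - A) 0) (plane_ext (by simp; ring) (by simp at hd ⊢; linarith))
  have k1 := key ((C - A) 1) (-(B - A) 1) (plane_ext (by simp at hd ⊢; linarith) (by simp; ring))
  have hB : B - A = 0 := plane_ext (neg_eq_zero.1 k0.2) (neg_eq_zero.1 k1.2)
  exact one_ne_zero (key 1 0 (by rw [hB]; simp)).1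

/-- Every triangle is an affine image of the standard triangle, with positive determinant. -/
theorem IsTriangle.exists_eq_image {Δ : Set Plane} (h : IsTriangle Δ) :
    ∃ (u v c : Plane), 0 < u 0 * v 1 - u 1 * v 0 ∧
      Δ = (fun x => columnMap u v x + c) '' stdTriangle := by
  have key : ∀ A B C : Plane,
      convexHull ℝ {A, B, C} = (fun x => columnMap (B - A) (C - A) x + A) '' stdTriangle := by
    intro A B C
    rw [stdTriangle_eq_convexHull, image_add_convexHull]
    simp [image_insert_eq, columnMap_apply]
  obtain ⟨A, B, C, hi, rfl⟩ := h
  -- Exchanging `B` and `C` corrects the orientation; the determinant is later the factor `r` and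
  -- must be positive.
  rcases (det_ne_zero_of_affineIndependent hi).lt_or_gt with hd | hd
  · refine ⟨C - A, B - A, A, by linarith, ?_⟩
    rw [← key A C B, pair_comm]
  · exact ⟨B - A, C - A, A, hd, key A B C⟩

/-- The columns `rotJ v` and `-rotJ u` are those of the linear part conjugated by `J`. -/
theorem hullJ_image (u v c t : Plane) :
    hullJ ((fun x => columnMap u v x + c) '' stdTriangle)
        (columnMap (rotJ v) (-rotJ u) t + (rotJ c + rotJ c)) =
      (fun y => columnMap (rotJ v) (-rotJ u) y + rotJ c) '' hullJ stdTriangle t := by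
  rw [hullJ, hullJ, image_add_convexHull, image_union]
  simp only [image_image]
  congr 2
  · refine image_congr fun x _ => plane_ext ?_ ?_ <;> simp [columnMap_apply, rotJ] <;> ring
  · refine image_congr fun x _ => plane_ext ?_ ?_ <;> simp [columnMap_apply, rotJ] <;> ring

theorem isZollPair_stdTriangle {t : Plane}
    (ht : ∀ t', volume (hullJ stdTriangle t) ≤ volume (hullJ stdTriangle t')) :
    IsZollPair stdTriangle (hullJ stdTriangle t) := by
  -- Obtained by solving `t = 2 • hexCenter s` with coordinates of sum one.
  let s : Fin 3 → ℝ := ![t 0 - t 1 - 1, 1 + t 1, 1 - t 0]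
  have hs1 : ∑ k, s k = 1 := by simp [Fin.sum_univ_three, s]; ring
  have e : t = 2 • hexCenter s := by
    refine plane_ext ?_ ?_ <;> simp [s, hexCenter, two_smul]
    ring
  rw [e] at ht ⊢
  have hs := nonneg_of_minimal hs1 ht
  rw [hullJ_eq_hexagon hs1 hs]
  exact ⟨⟨_, inferInstance, _, _, isPolygon_stdTriangle⟩,
    ⟨_, inferInstance, _, _, isPolygon_hexagon hs1 hs⟩, 1, isZoll_stdTriangle_hexagon hs1 hs⟩

theorem isZollPair_triangle {Δ T : Set Plane} (hΔ : IsTriangle Δ) (hT : T ∈ hullFamily Δ) :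
    IsZollPair Δ T := by
  obtain ⟨u, v, c, hd, rfl⟩ := hΔ.exists_eq_image
  obtain ⟨t, ht, rfl⟩ := hT
  have hd' : rotJ v 0 * (-rotJ u) 1 - rotJ v 1 * (-rotJ u) 0 = u 0 * v 1 - u 1 * v 0 := by
    simp [rotJ]; ring
  have hd'' : rotJ v 0 * (-rotJ u) 1 - rotJ v 1 * (-rotJ u) 0 ≠ 0 := by rw [hd']; exact hd.ne'
  obtain ⟨t, rfl⟩ : ∃ t₀, t = columnMap (rotJ v) (-rotJ u) t₀ + (rotJ c + rotJ c) := by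
    obtain ⟨t₀, h₀⟩ := (columnEquiv _ _ hd'').surjective (t - (rotJ c + rotJ c))
    exact ⟨t₀, (eq_add_of_sub_eq h₀.symm)⟩
  have hmin : ∀ t', volume (hullJ stdTriangle t) ≤ volume (hullJ stdTriangle t') := by
    intro t'
    have := ht (columnMap (rotJ v) (-rotJ u) t' + (rotJ c + rotJ c))
    rw [hullJ_image, hullJ_image, volume_image_add, volume_image_add] at this
    refine (ENNReal.mul_le_mul_iff_right ?_ ENNReal.ofReal_ne_top).1 this
    rw [det_columnMap, hd', abs_of_pos hd]
    exact (ENNReal.ofReal_pos.2 hd).ne'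
  rw [hullJ_image]
  -- In the plane the conjugate by `J` is the determinant times the inverse transpose, so the two
  -- maps are compatible with `r` equal to the determinant.
  refine (isZollPair_stdTriangle hmin).image (φ := columnEquiv u v hd.ne')
    (ψ := columnEquiv _ _ hd'') hd (fun x y => ?_) c (rotJ c)
  rw [columnEquiv_apply, columnEquiv_apply, inner_plane, inner_plane]
  simp [rotJ]
  ring

theorem IsBasicEqualityCase.isZollPair {K T : Set Plane} (h : IsBasicEqualityCase K T) :
    IsZollPair K T := by
  cases h with
  | triangle Δ T hΔ hT => exact isZollPair_triangle hΔ hT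
  | square c a a₁ a₂ ha h₁ h₂ => exact isZollPair_square ha h₁ h₂ c
  | trapezoid Q hQ φ c a₁ a₂ h₁ h₂ hφ => exact hφ ▸ isZollPair_trapezoid φ h₁ h₂ c

theorem IsEqualityCase.isZollPair {K T : Set Plane} (h : IsEqualityCase K T) : IsZollPair K T := by
  obtain ⟨T₀, s, v, h, hs, rfl⟩ := h
  exact h.isZollPair.smul_add hs v

end Billiard

theorem theorem1p5 (K T : Set Plane) (hKT : Billiard.IsEqualityCase K T) :
    (∀ q p : ℕ → Plane, Billiard.IsRegularTrajectory K T q p →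
      Billiard.IsClosedTrajectory K T 4 q p ∧
      (∀ m : ℕ, 0 < m → m < 4 → ¬ ∀ j, q (j + m) = q j) ∧
      Billiard.IsMinimizer K T 4 q p) ∧
    closure {x : Plane | ∃ q p : ℕ → Plane,
      Billiard.IsRegularTrajectory K T q p ∧ x ∈ Billiard.path q} = K ∧
    closure {y : Plane | ∃ q p : ℕ → Plane,
      Billiard.IsRegularTrajectory K T q p ∧ y ∈ Billiard.path p} = T := by
  obtain ⟨⟨ι, hι, n, c, hK⟩, ⟨κ, hκ, m, d, hT⟩, L, hZ⟩ := hKT.isZollPair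
  exact hZ.conclusion hK hT
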